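/- Let $X_1,X_2,\dots$ be i.i.d. random variables with values in a measurable space $\mathcal X$ and common distribution $\nu$; let $X$ have distribution $\nu$. Let $f:\mathcal X^2\to\mathbb R$ be measurable with $\mathbb E\,f(X_1,X_2)^2<\infty$. Put $$\mu:=\mathbb E f(X_1,X_2),\quad f_1(x):=\int f(x,y)\,d\nu(y)-\mu,\quad f_2(y):=\int f(x,y)\,d\nu(x)-\mu,\quad f_{12}(x,y):=f(x,y)-f_1(x)-f_2(y)-\mu ,$$ and let the bi-alternating $U$-statistic be $U^{--}_n(f):=\sum_{1\le i<j\le n}(-1)^{i+j}f(X_i,X_j)$. For a square integrable kernel $g$ on a probability space $(\mathcal Y,m)$, let $T_g$ be the integral operator $T_g\varphi(x)=\int g(x,y)\varphi(y)\,dm(y)$ on $L^2(\mathcal Y,m)$. Let $\hat f_{12}$ be the symmetric kernel on $\mathcal X\times[0,1]$ (with the measure $\nu\times\mathrm{Leb}$) given by $\hat f_{12}((x,t),(y,u)):=f_{12}(x,y)$ if $t<u$, $:=f_{12}(y,x)$ if $t>u$, and $:=0$ if $t=u$. Eigenvalues are repeated according to their multiplicity, infinite sums of random variables converge in $L^2$,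 and limits are as $n\to\infty$. Then the following hold. (i) $\mathbb E[U^{--}_n(f)]=-\lfloor n/2\rfloor\mu=O(n)$ for every $n$, and $\binom n2^{-1}U^{--}_n(f)\to0$ in probability. (ii) $\operatorname{Var}[U^{--}_n(f)]=\frac12n^2\operatorname{Var}[f_{12}(X_1,X_2)]+O(n)$. The operator $T_{\hat f_{12}}$ on $L^2(\mathcal X\times[0,1],\nu\times\mathrm{Leb})$ is self-adjoint, its nonzero eigenvalues form a finite or infinite sequence of real numbers $(\lambda_r)_{r=1}^R$, and $$n^{-1}\bigl(U^{--}_n(f)-\mathbb E[U^{--}_n(f)]\bigr)\overset{d}{\longrightarrow}W:=\sum_{r=1}^R\tfrac12\lambda_r(\zeta_r^2-1),$$ where $(\zeta_r)_{r=1}^R$ are independent standard normal variables. Moreover $\operatorname{Var}W=\frac12\sum_{r=1}^R\lambda_r^2=\frac12\operatorname{Var}[f_{12}(X_1,X_2)]<\infty$. (iii) If $f$ is symmetric ($f(x,y)=f(y,x)$ a.e.), then the coefficients $(\lambda_r)_{r=1}^R$ in (ii) are the nonzero eigenvalues of the self-adjoint operator $T_{f_{12}}$ on $L^2(\mathcal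 X,\nu)$. (iv) If $f$ is antisymmetric ($f(x,y)=-f(y,x)$ a.e.), then the operator $T_{f_{12}}$ on the complex space $L^2_{\mathbb C}(\mathcal X,\nu)$ is anti-self-adjoint. Let $(\lambda'_q)_{q=1}^{Q}$ be the finite or infinite sequence of the positive numbers such that $\mathrm i\lambda'_q$ is an eigenvalue of it. Then also $$n^{-1}U^{--}_n(f)\overset{d}{\longrightarrow}W:=\sum_{q=1}^{Q}\lambda'_q\eta_q,$$ where $(\eta_q)_{q=1}^{Q}$ are independent random variables with the distribution of Lévy's stochastic area, i.e. the probability distribution on $\mathbb R$ with characteristic function $t\mapsto1/\cosh t$. Moreover $\operatorname{Var}W=\sum_{q=1}^{Q}(\lambda'_q)^2=\frac12\operatorname{Var}[f_{12}(X_1,X_2)]$. (v) If $f_{12}=0$ a.e., put $\sigma_e^2:=\frac12\bigl(\operatorname{Var}[f_1(X)]+\operatorname{Var}[f_2(X)]\bigr)$ and $\sigma_o^2:=\frac12\operatorname{Var}[f_1(X)+f_2(X)]$. Then $$\operatorname{Var}[U^{--}_{2n}(f)]=2n\,\sigma_e^2+O(1),\qquad\operatorname{Var}[U^{--}_{2n+1}(f)]=(2n+1)\,\sigma_o^2+O(1),$$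 $$(2n)^{-1/2}\bigl(U^{--}_{2n}(f)-\mathbb E[U^{--}_{2n}(f)]\bigr)\overset{d}{\longrightarrow}N(0,\sigma_e^2),\qquad(2n+1)^{-1/2}\bigl(U^{--}_{2n+1}(f)-\mathbb E[U^{--}_{2n+1}(f)]\bigr)\overset{d}{\longrightarrow}N(0,\sigma_o^2).$$ -/

import Mathlib

open MeasureTheory ProbabilityTheory Filter Topology Asymptotics

/-! ### Hoeffding's decomposition of a kernel of order two -/

section Kernels

variable {S : Type*} [MeasurableSpace S]

/-- The mean `∫∫ f(x, y) dν(x) dν(y)`. -/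
noncomputable def kernelMean (ν : Measure S) (f : S → S → ℝ) : ℝ :=
  ∫ p : S × S, f p.1 p.2 ∂(ν.prod ν)

/-- `f₁(x) = ∫ f(x, y) dν(y) - mean`. -/
noncomputable def hoeffding1 (ν : Measure S) (f : S → S → ℝ) (x : S) : ℝ :=
  (∫ y, f x y ∂ν) - kernelMean ν f

/-- `f₂(y) = ∫ f(x, y) dν(x) - mean`. -/
noncomputable def hoeffding2 (ν : Measure S) (f : S → S → ℝ) (y : S) : ℝ :=
  (∫ x, f x y ∂ν) - kernelMean ν f

/-- `f₁₂(x, y) = f(x, y) - f₁(x) - f₂(y) - mean`. -/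
noncomputable def hoeffding12 (ν : Measure S) (f : S → S → ℝ) (x y : S) : ℝ :=
  f x y - hoeffding1 ν f x - hoeffding2 ν f y - kernelMean ν f

/-- The symmetric kernel on `S × [0,1]` equal to `f(x, y)` at `((x,t),(y,u))` if `t < u`,
to `f(y, x)` if `t > u`, and to `0` if `t = u`. -/
noncomputable def hatKernel (f : S → S → ℝ) (p q : S × unitInterval) : ℝ :=
  if p.2 < q.2 then f p.1 q.1 else if q.2 < p.2 then f q.1 p.1 else 0

lemma measurable_hoeffding1 (ν : Measure S) [IsProbabilityMeasure ν] {f : S → S → ℝ}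
    (hf : Measurable (Function.uncurry f)) : Measurable (hoeffding1 ν f) :=
  (hf.stronglyMeasurable.integral_prod_right.measurable).sub_const _

lemma measurable_hoeffding2 (ν : Measure S) [IsProbabilityMeasure ν] {f : S → S → ℝ}
    (hf : Measurable (Function.uncurry f)) : Measurable (hoeffding2 ν f) :=
  (hf.stronglyMeasurable.integral_prod_left.measurable).sub_const _

lemma measurable_hoeffding12 (ν : Measure S) [IsProbabilityMeasure ν] {f : S → S → ℝ}
    (hf : Measurable (Function.uncurry f)) :
    Measurable (Function.uncurry (hoeffding12 ν f)) :=
  ((hf.sub ((measurable_hoeffding1 ν hf).comp measurable_fst)).sub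
    ((measurable_hoeffding2 ν hf).comp measurable_snd)).sub_const _

/-- The partial integral of a square integrable kernel is square integrable. -/
lemma memLp_integral_right (ν : Measure S) [IsProbabilityMeasure ν] {f : S → S → ℝ}
    (hf : Measurable (Function.uncurry f)) (h2 : MemLp (Function.uncurry f) 2 (ν.prod ν)) :
    MemLp (fun x => ∫ y, f x y ∂ν) 2 ν := by
  have hm : AEStronglyMeasurable (fun x => ∫ y, f x y ∂ν) ν :=
    hf.stronglyMeasurable.integral_prod_right.aestronglyMeasurable
  rw [memLp_two_iff_integrable_sq hm]
  have hsq : Integrable (fun p : S × S => f p.1 p.2 ^ 2) (ν.prod ν) := h2.integrable_sq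
  refine hsq.integral_prod_left.mono (hm.pow 2) ?_
  filter_upwards [hsq.prod_right_ae] with x hx
  have hfx : Measurable (fun y => f x y) := hf.comp measurable_prodMk_left
  have hfx2 : MemLp (fun y => f x y) 2 ν :=
    (memLp_two_iff_integrable_sq hfx.aestronglyMeasurable).2 hx
  have hv := variance_nonneg (fun y => f x y) ν
  rw [variance_eq_sub hfx2] at hv
  have h0 : 0 ≤ ∫ y, f x y ^ 2 ∂ν := integral_nonneg fun y => sq_nonneg _
  rw [Real.norm_of_nonneg (sq_nonneg _), Real.norm_of_nonneg h0]
  simpa [sub_nonneg] using hv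

lemma memLp_swap (ν : Measure S) [IsProbabilityMeasure ν] {f : S → S → ℝ}
    (h2 : MemLp (Function.uncurry f) 2 (ν.prod ν)) :
    MemLp (Function.uncurry fun x y => f y x) 2 (ν.prod ν) :=
  h2.comp_measurePreserving (Measure.measurePreserving_swap (μ := ν) (ν := ν))

lemma memLp_hoeffding1 (ν : Measure S) [IsProbabilityMeasure ν] {f : S → S → ℝ}
    (hf : Measurable (Function.uncurry f)) (h2 : MemLp (Function.uncurry f) 2 (ν.prod ν)) :
    MemLp (hoeffding1 ν f) 2 ν :=
  (memLp_integral_right ν hf h2).sub (memLp_const _)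

lemma memLp_hoeffding2 (ν : Measure S) [IsProbabilityMeasure ν] {f : S → S → ℝ}
    (hf : Measurable (Function.uncurry f)) (h2 : MemLp (Function.uncurry f) 2 (ν.prod ν)) :
    MemLp (hoeffding2 ν f) 2 ν :=
  (memLp_integral_right ν (f := fun x y => f y x) (hf.comp measurable_swap)
    (memLp_swap ν h2)).sub (memLp_const _)

lemma memLp_hoeffding12 (ν : Measure S) [IsProbabilityMeasure ν] {f : S → S → ℝ}
    (hf : Measurable (Function.uncurry f)) (h2 : MemLp (Function.uncurry f) 2 (ν.prod ν)) :
    MemLp (Function.uncurry (hoeffding12 ν f)) 2 (ν.prod ν) :=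
  ((h2.sub ((memLp_hoeffding1 ν hf h2).comp_measurePreserving measurePreserving_fst)).sub
    ((memLp_hoeffding2 ν hf h2).comp_measurePreserving measurePreserving_snd)).sub
      (memLp_const _)

lemma memLp_hatKernel (ν : Measure S) [IsProbabilityMeasure ν] {f : S → S → ℝ}
    (hf : Measurable (Function.uncurry f)) (h2 : MemLp (Function.uncurry f) 2 (ν.prod ν)) :
    MemLp (Function.uncurry (hatKernel f)) 2
      ((ν.prod (volume : Measure unitInterval)).prod
        (ν.prod (volume : Measure unitInterval))) := by
  have mp : MeasurePreserving
      (fun z : (S × unitInterval) × (S × unitInterval) => (z.1.1, z.2.1))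
      ((ν.prod (volume : Measure unitInterval)).prod
        (ν.prod (volume : Measure unitInterval))) (ν.prod ν) :=
    (measurePreserving_fst (μ := ν) (ν := (volume : Measure unitInterval))).prod
      (measurePreserving_fst (μ := ν) (ν := (volume : Measure unitInterval)))
  have h1 := h2.comp_measurePreserving mp
  have h1' := (memLp_swap ν h2).comp_measurePreserving mp
  have hm1 : Measurable fun z : (S × unitInterval) × (S × unitInterval) => f z.1.1 z.2.1 :=
    hf.comp mp.measurable
  have hm2 : Measurable fun z : (S × unitInterval) × (S × unitInterval) => f z.2.1 z.1.1 :=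
    (hf.comp measurable_swap).comp mp.measurable
  have hmeas : Measurable (Function.uncurry (hatKernel f)) := by
    refine Measurable.ite (measurableSet_lt (by fun_prop) (by fun_prop)) hm1
      (Measurable.ite (measurableSet_lt (by fun_prop) (by fun_prop)) hm2 measurable_const)
  refine (h1.norm.add h1'.norm).mono hmeas.aestronglyMeasurable (ae_of_all _ fun z => ?_)
  have e : (0 : ℝ) ≤ ‖f z.1.1 z.2.1‖ + ‖f z.2.1 z.1.1‖ := by positivity
  change ‖hatKernel f z.1 z.2‖ ≤ ‖‖f z.1.1 z.2.1‖ + ‖f z.2.1 z.1.1‖‖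
  rw [Real.norm_of_nonneg e]
  unfold hatKernel
  split_ifs
  · exact le_add_of_nonneg_right (norm_nonneg _)
  · exact le_add_of_nonneg_left (norm_nonneg _)
  · simpa using e

end Kernels

/-! ### Integral operators with square integrable kernels, and their eigenvalues -/

section IntegralOperators

variable {𝕜 : Type*} [RCLike 𝕜] {A : Type*} [MeasurableSpace A]

lemma ae_memLp_section (m : Measure A) [SFinite m] {g : A → A → 𝕜}
    (hg : MemLp (Function.uncurry g) 2 (m.prod m)) :
    ∀ᵐ x ∂m, MemLp (g x) 2 m := by
  have hsq : Integrable (fun p : A × A => ‖g p.1 p.2‖ ^ 2) (m.prod m) :=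
    hg.norm.integrable_sq
  filter_upwards [hsq.prod_right_ae, hg.1.prodMk_left] with x hx hx'
  exact (memLp_two_iff_integrable_sq_norm hx').2 hx

lemma norm_integral_kernel_le (m : Measure A) {u : A → 𝕜} (hu : MemLp u 2 m) {v : A → 𝕜}
    (hv : MemLp v 2 m) :
    ‖∫ y, u y * v y ∂m‖ ^ 2 ≤ (∫ y, ‖u y‖ ^ 2 ∂m) * ∫ y, ‖v y‖ ^ 2 ∂m := by
  have hh := integral_mul_norm_le_Lp_mul_Lq (μ := m) (f := u) (g := v)
    Real.HolderConjugate.two_two (by simpa using hu) (by simpa using hv)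
  simp only [Real.rpow_two] at hh
  have h1 : 0 ≤ ∫ y, ‖u y‖ ^ 2 ∂m := integral_nonneg fun y => sq_nonneg _
  have h2 : 0 ≤ ∫ y, ‖v y‖ ^ 2 ∂m := integral_nonneg fun y => sq_nonneg _
  have h3 : ‖∫ y, u y * v y ∂m‖ ≤ ∫ y, ‖u y‖ * ‖v y‖ ∂m :=
    (norm_integral_le_integral_norm _).trans_eq (by simp only [norm_mul])
  rw [← Real.sqrt_eq_rpow, ← Real.sqrt_eq_rpow] at hh
  calc ‖∫ y, u y * v y ∂m‖ ^ 2
      ≤ (√(∫ y, ‖u y‖ ^ 2 ∂m) * √(∫ y, ‖v y‖ ^ 2 ∂m)) ^ 2 := by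
        gcongr; exact h3.trans hh
    _ = _ := by rw [mul_pow, Real.sq_sqrt h1, Real.sq_sqrt h2]

lemma memLp_integral_kernel (m : Measure A) [SFinite m] {g : A → A → 𝕜}
    (hg : MemLp (Function.uncurry g) 2 (m.prod m)) (φ : Lp 𝕜 2 m) :
    MemLp (fun x => ∫ y, g x y * φ y ∂m) 2 m := by
  have hm : AEStronglyMeasurable (fun x => ∫ y, g x y * φ y ∂m) m :=
    (hg.1.mul (Lp.aestronglyMeasurable φ).comp_snd).integral_prod_right'
  rw [memLp_two_iff_integrable_sq_norm hm]
  have hsq : Integrable (fun p : A × A => ‖g p.1 p.2‖ ^ 2) (m.prod m) :=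
    hg.norm.integrable_sq
  refine (hsq.integral_prod_left.mul_const (∫ y, ‖φ y‖ ^ 2 ∂m)).mono' (hm.norm.pow 2) ?_
  filter_upwards [ae_memLp_section m hg] with x hx
  rw [Real.norm_of_nonneg (sq_nonneg _)]
  exact norm_integral_kernel_le m hx (Lp.memLp φ)

lemma norm_sq_Lp_two (m : Measure A) {u : A → 𝕜} (hu : MemLp u 2 m) :
    ‖hu.toLp u‖ ^ 2 = ∫ x, ‖u x‖ ^ 2 ∂m := by
  rw [Lp.norm_toLp, hu.eLpNorm_eq_integral_rpow_norm (by norm_num) (by norm_num)]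
  have h : 0 ≤ ∫ x, ‖u x‖ ^ 2 ∂m := integral_nonneg fun y => sq_nonneg _
  simp only [ENNReal.toReal_ofNat, Real.rpow_two]
  rw [ENNReal.toReal_ofReal (by positivity), ← one_div, ← Real.sqrt_eq_rpow, Real.sq_sqrt h]

/-- The integral operator `(T_g φ)(x) = ∫ g(x, y) φ(y) dm(y)` on `L²(m)`, for a kernel `g`
in `L²(m × m)`. -/
noncomputable def integralOperator (m : Measure A) [SFinite m] (g : A → A → 𝕜)
    (hg : MemLp (Function.uncurry g) 2 (m.prod m)) : Lp 𝕜 2 m →L[𝕜] Lp 𝕜 2 m :=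
  LinearMap.mkContinuous
    { toFun := fun φ => (memLp_integral_kernel m hg φ).toLp _
      map_add' := by
        intro φ ψ
        rw [← MemLp.toLp_add]
        refine MemLp.toLp_congr _ _ ?_
        filter_upwards [ae_memLp_section m hg] with x hx
        have e1 : (fun y => g x y * (φ + ψ : Lp 𝕜 2 m) y) =ᵐ[m]
            fun y => g x y * φ y + g x y * ψ y := by
          filter_upwards [Lp.coeFn_add φ ψ] with y hy
          rw [hy, Pi.add_apply, mul_add]
        exact (integral_congr_ae e1).trans (integral_add (hx.integrable_mul (Lp.memLp φ))
          (hx.integrable_mul (Lp.memLp ψ)))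
      map_smul' := by
        intro c φ
        rw [RingHom.id_apply, ← MemLp.toLp_const_smul]
        refine MemLp.toLp_congr _ _ (ae_of_all _ fun x => ?_)
        have e1 : (fun y => g x y * (c • φ : Lp 𝕜 2 m) y) =ᵐ[m]
            fun y => c • (g x y * φ y) := by
          filter_upwards [Lp.coeFn_smul c φ] with y hy
          rw [hy, Pi.smul_apply, smul_eq_mul, smul_eq_mul, mul_left_comm]
        exact (integral_congr_ae e1).trans (integral_smul c _) }
    (√(∫ p : A × A, ‖g p.1 p.2‖ ^ 2 ∂(m.prod m)))
    (by
      intro φ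
      change ‖(memLp_integral_kernel m hg φ).toLp _‖ ≤ _
      have hsq : Integrable (fun p : A × A => ‖g p.1 p.2‖ ^ 2) (m.prod m) :=
        hg.norm.integrable_sq
      have h0 : 0 ≤ ∫ p : A × A, ‖g p.1 p.2‖ ^ 2 ∂(m.prod m) :=
        integral_nonneg fun y => sq_nonneg _
      refine (pow_le_pow_iff_left₀ (norm_nonneg _) (by positivity) two_ne_zero).1 ?_
      rw [norm_sq_Lp_two, mul_pow, Real.sq_sqrt h0]
      have hφ : ‖φ‖ ^ 2 = ∫ y, ‖φ y‖ ^ 2 ∂m := by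
        rw [← norm_sq_Lp_two m (Lp.memLp φ), Lp.toLp_coeFn]
      rw [hφ, integral_prod _ hsq, ← integral_mul_const]
      refine integral_mono_ae (memLp_integral_kernel m hg φ).norm.integrable_sq
        (hsq.integral_prod_left.mul_const _) ?_
      filter_upwards [ae_memLp_section m hg] with x hx
      exact norm_integral_kernel_le m hx (Lp.memLp φ))

lemma integralOperator_apply_ae (m : Measure A) [SFinite m] (g : A → A → 𝕜)
    (hg : MemLp (Function.uncurry g) 2 (m.prod m)) (φ : Lp 𝕜 2 m) :
    integralOperator m g hg φ =ᵐ[m] fun x => ∫ y, g x y * φ y ∂m :=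
  (memLp_integral_kernel m hg φ).coeFn_toLp

/-- The multiplicity of `z` as an eigenvalue of `T`: the dimension of the eigenspace
(`0` if `z` is not an eigenvalue). -/
noncomputable def eigenMultiplicity {E : Type*} [NormedAddCommGroup E] [NormedSpace 𝕜 E]
    (T : E →L[𝕜] E) (z : 𝕜) : ℕ∞ :=
  Cardinal.toENat (Module.rank 𝕜 (Module.End.eigenspace (T : E →ₗ[𝕜] E) z))

end IntegralOperators

/-- The index set of a finite or infinite sequence of length `R`. -/
abbrev SeqIndex (R : ℕ∞) : Type := {r : ℕ // (r : ℕ∞) < R}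

/-- `c` lists the nonzero eigenvalues of `T`, each repeated according to its multiplicity. -/
def ListsNonzeroEigenvalues {E : Type*} [NormedAddCommGroup E] [NormedSpace ℝ E]
    (T : E →L[ℝ] E) {R : ℕ∞} (c : SeqIndex R → ℝ) : Prop :=
  (∀ r, c r ≠ 0) ∧ ∀ s : ℝ, s ≠ 0 → {r | c r = s}.encard = eigenMultiplicity T s

/-- `c` lists the positive reals `s` such that `i s` is an eigenvalue of `T`, each repeated
according to the multiplicity of that eigenvalue. -/
def ListsPositiveImaginaryEigenvalues {E : Type*} [NormedAddCommGroup E] [NormedSpace ℂ E]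
    (T : E →L[ℂ] E) {Q : ℕ∞} (c : SeqIndex Q → ℝ) : Prop :=
  (∀ q, 0 < c q) ∧
    ∀ s : ℝ, 0 < s → {q | c q = s}.encard = eigenMultiplicity T (Complex.I * s)

/-! ### Limit variables -/

/-- `W` is the sum, convergent in `L²`, of the random variables `Z r`. -/
def IsL2Sum {Ω ι : Type*} [MeasurableSpace Ω] (P : Measure Ω) (Z : ι → Ω → ℝ) (W : Ω → ℝ) :
    Prop :=
  MemLp W 2 P ∧
    Tendsto (fun s : Finset ι => eLpNorm (fun ω => ∑ r ∈ s, Z r ω - W ω) 2 P) atTop (𝓝 0)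

/-- The distribution of Lévy's stochastic area, given by its characteristic function. -/
def IsStochasticAreaLaw (ρ : Measure ℝ) : Prop :=
  IsProbabilityMeasure ρ ∧ ∀ t : ℝ, charFun ρ t = ((1 / Real.cosh t : ℝ) : ℂ)

/-! ### The bi-alternating U-statistic -/

/-- `∑_{1 ≤ i < j ≤ n} (-1)^(i+j) f(X_i, X_j)`. The sequence `X_1, X_2, …` is indexed from `0`
here: `X k` is `X_{k+1}`. -/
def biAltU {Ω S : Type*} (X : ℕ → Ω → S) (f : S → S → ℝ) (n : ℕ) (ω : Ω) : ℝ :=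
  ∑ j ∈ Finset.range n, ∑ i ∈ Finset.range j,
    (-1 : ℝ) ^ ((i + 1) + (j + 1)) * f (X i ω) (X j ω)

/-! ### Hilbert–Schmidt theory of integral operators -/

section HilbertSchmidt

open scoped ComplexConjugate

variable {𝕜 : Type*} [RCLike 𝕜] {A : Type*} [MeasurableSpace A] {m : Measure A}

/-! Hoeffding's decomposition splits the statistic into orthogonal pieces: a constant, sums of
functions of single variables, and the statistic of the degenerate kernel `hoeffding12`. The
alternating signs cancel most of the first two: the constant becomes -⌊n/2⌋μ and the linear part a
sum of ⌊n/2⌋ independent centred terms, whose shape depends on the parity of n (`biAltU_add_eq`).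
The degenerate part is a sum of n(n-1)/2 orthogonal terms. This gives the exact variance
(`variance_biAltU`) and all moment claims. Divided by n, the linear part is negligible; it governs
the limit only when the second order component vanishes, and then the classical central limit
theorem applies along each parity.

For the general limit law, consecutive variables are grouped into pairs. A sign depends only on the
positions inside the pairs, so after scaling the statistic is, up to an L² error of order n^{-1/2},
an unsigned ordered sum of `pairKernel` over independent identically distributed pairs
(`biAltU_two_mul`, `integral_sq_biAltU_sub_pairs_le`). That kernel is not symmetric, but the pairs
may be given independent uniform times and be sorted by them without changing the law
(`charFun_map_sum_hatKernel`). The ordered sum then has a symmetric kernel, which is the alternation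
over two points with a common time of the kernel f̂₁₂ (`hatKernel_pairKernel`).

Now f̂₁₂ is expanded as Σ λ_r e_r ⊗ e_r in L². Degeneracy forces e_r to have mean zero in the space
variable at almost every time, so the normalized differences d_r = (e_r(x,t) - e_r(x',t))/√2 are
again orthonormal and centred, and alternation turns the expansion into 2 Σ λ_r d_r ⊗ d_r. For
finitely many terms the central limit theorem and the law of large numbers give Σ λ_r (ζ_r² - 1)/2
(`tendsto_charFun_finite_rank`); the truncation error is bounded uniformly in n by the L² remainder
of the kernel. The argument needs only an orthonormal family of eigenfunctions whose squared nonzero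
eigenvalues exhaust the L² norm (`tendstoInDistribution_biAltU`). For a full list of eigenvalues
this is Parseval's identity, from the spectral theorem for compact symmetric operators
(`hasSum_sq_eigenvalues`).

If f is symmetric, f̂₁₂ does not depend on time. If f is antisymmetric, f̂₁₂ is f₁₂ times the sign
of u - t, and an eigenfunction φ of f₁₂ with eigenvalue iλ' yields the eigenfunctions φ(x)
exp(-i(2k+1)πt) with eigenvalues 2λ'/((2k+1)π). Their real and imaginary parts already exhaust the
norm, because Σ 1/(2n+1)² = π²/8. Multiplying the characteristic functions over k gives Euler's
product for 1/cosh, that is, one stochastic area for each λ'. -/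

lemma memLp_tensor {u v : A → 𝕜} (hu : MemLp u 2 m) (hv : MemLp v 2 m) :
    MemLp (fun p : A × A => u p.1 * conj (v p.2)) 2 (m.prod m) := by
  have hm : AEStronglyMeasurable (fun p : A × A => u p.1 * conj (v p.2)) (m.prod m) :=
    hu.1.comp_fst.mul (RCLike.continuous_conj.comp_aestronglyMeasurable hv.1.comp_snd)
  rw [memLp_two_iff_integrable_sq_norm hm]
  have := (hu.norm.integrable_sq).mul_prod (hv.norm.integrable_sq)
  refine this.congr (ae_of_all _ fun p => ?_)
  simp [mul_pow]

/-- The tensor product `u(x) conj (v(y))` of two square integrable functions. -/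
noncomputable def tensorLp (u v : Lp 𝕜 2 m) : Lp 𝕜 2 (m.prod m) :=
  (memLp_tensor (Lp.memLp u) (Lp.memLp v)).toLp _

lemma coeFn_tensorLp (u v : Lp 𝕜 2 m) :
    tensorLp u v =ᵐ[m.prod m] fun p => u p.1 * conj (v p.2) :=
  MemLp.coeFn_toLp _

lemma memLp_uncurry_coeFn (G : Lp 𝕜 2 (m.prod m)) :
    MemLp (Function.uncurry fun x y => G (x, y)) 2 (m.prod m) :=
  Lp.memLp G

lemma integrable_kernel_form {g : A → A → 𝕜} (hg : MemLp (Function.uncurry g) 2 (m.prod m))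
    {u v : A → 𝕜} (hu : MemLp u 2 m) (hv : MemLp v 2 m) :
    Integrable (fun p : A × A => conj (u p.1) * (g p.1 p.2 * v p.2)) (m.prod m) := by
  have h := (memLp_tensor hu hv).star.integrable_mul hg
  refine h.congr (ae_of_all _ fun p => ?_)
  simp only [Pi.mul_apply, Pi.star_apply, RCLike.star_def, map_mul, RCLike.conj_conj,
    Function.uncurry]
  ring

variable [IsFiniteMeasure m]

/-- The integral operator whose kernel is an element of `L²`. -/
noncomputable def kernelOp (G : Lp 𝕜 2 (m.prod m)) : Lp 𝕜 2 m →L[𝕜] Lp 𝕜 2 m :=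
  integralOperator m (fun x y => G (x, y)) (memLp_uncurry_coeFn G)

lemma inner_integralOperator {g : A → A → 𝕜} (hg : MemLp (Function.uncurry g) 2 (m.prod m))
    (u v : Lp 𝕜 2 m) :
    inner 𝕜 u (integralOperator m g hg v) =
      ∫ p : A × A, conj (u p.1) * (g p.1 p.2 * v p.2) ∂(m.prod m) := by
  rw [L2.inner_def, integral_prod _ (integrable_kernel_form hg (Lp.memLp u) (Lp.memLp v))]
  refine integral_congr_ae ?_
  filter_upwards [integralOperator_apply_ae m g hg v] with x hx
  rw [hx, RCLike.inner_apply', integral_const_mul]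

/-- This duality turns every statement about an operator into one about its kernel in the Hilbert
space of square integrable kernels, and conversely. -/
lemma inner_tensorLp (u v : Lp 𝕜 2 m) (G : Lp 𝕜 2 (m.prod m)) :
    inner 𝕜 (tensorLp u v) G = inner 𝕜 u (kernelOp G v) := by
  rw [kernelOp, inner_integralOperator, L2.inner_def]
  refine integral_congr_ae ?_
  filter_upwards [coeFn_tensorLp u v] with p hp
  rw [hp, RCLike.inner_apply', map_mul, RCLike.conj_conj]
  ring

lemma integralOperator_eq_kernelOp {g : A → A → 𝕜}
    (hg : MemLp (Function.uncurry g) 2 (m.prod m)) :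
    integralOperator m g hg = kernelOp (hg.toLp _) := by
  refine ContinuousLinearMap.ext fun v => ext_inner_left 𝕜 fun u => ?_
  rw [kernelOp, inner_integralOperator, inner_integralOperator]
  refine integral_congr_ae ?_
  filter_upwards [hg.coeFn_toLp] with p hp
  rw [hp]; rfl

lemma kernelOp_tensorLp (u v w : Lp 𝕜 2 m) :
    kernelOp (tensorLp u v) w = (inner 𝕜 v w) • u := by
  refine ext_inner_left 𝕜 fun z => ?_
  rw [inner_smul_right, kernelOp, inner_integralOperator]
  have e : (fun p : A × A => conj (z p.1) * (tensorLp u v (p.1, p.2) * w p.2)) =ᵐ[m.prod m]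
      fun p => (conj (z p.1) * u p.1) * (conj (v p.2) * w p.2) := by
    filter_upwards [coeFn_tensorLp u v] with p hp
    rw [hp]; ring
  rw [integral_congr_ae e, integral_prod_mul (fun x => conj (z x) * u x)
    (fun y => conj (v y) * w y),
    mul_comm, L2.inner_def, L2.inner_def]
  simp only [RCLike.inner_apply']

lemma inner_tensorLp_tensorLp (u v u' v' : Lp 𝕜 2 m) :
    inner 𝕜 (tensorLp u v) (tensorLp u' v') = inner 𝕜 v' v * inner 𝕜 u u' := by
  rw [inner_tensorLp, kernelOp_tensorLp, inner_smul_right]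

lemma norm_tensorLp (u v : Lp 𝕜 2 m) : ‖tensorLp u v‖ = ‖u‖ * ‖v‖ := by
  have h := inner_tensorLp_tensorLp u v u v
  simp only [inner_self_eq_norm_sq_to_K] at h
  have h2 : ‖tensorLp u v‖ ^ 2 = (‖u‖ * ‖v‖) ^ 2 := by
    rw [mul_pow, mul_comm]; exact_mod_cast h
  exact (pow_left_inj₀ (norm_nonneg _) (by positivity) two_ne_zero).1 h2

variable (𝕜 m) in
/-- The bounded linear map sending a kernel to its integral operator. -/
noncomputable def kernelOpL : Lp 𝕜 2 (m.prod m) →L[𝕜] (Lp 𝕜 2 m →L[𝕜] Lp 𝕜 2 m) :=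
  LinearMap.mkContinuous
    { toFun := kernelOp
      map_add' := fun G H => ContinuousLinearMap.ext fun v => ext_inner_left 𝕜 fun u => by
        simp only [add_apply, inner_add_right, ← inner_tensorLp]
      map_smul' := fun c G => ContinuousLinearMap.ext fun v => ext_inner_left 𝕜 fun u => by
        simp only [smul_apply, inner_smul_right, ← inner_tensorLp,
          RingHom.id_apply] } 1 (by
      intro G
      rw [one_mul]
      refine ContinuousLinearMap.opNorm_le_bound _ (norm_nonneg _) fun v => ?_
      change ‖kernelOp G v‖ ≤ _
      -- Cauchy–Schwarz against the tensor of `kernelOp G v` and `v`; one factor `‖kernelOp G v‖` is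
      -- cancelled afterwards.
      have h : ‖kernelOp G v‖ ^ 2 ≤ ‖kernelOp G v‖ * (‖G‖ * ‖v‖) := by
        have h1 : ‖inner 𝕜 (tensorLp (kernelOp G v) v) G‖ ≤ _ := norm_inner_le_norm _ _
        rw [inner_tensorLp, inner_self_eq_norm_sq_to_K, norm_tensorLp] at h1
        simp only [norm_pow, RCLike.norm_ofReal, abs_norm] at h1
        linarith
      rcases eq_or_ne ‖kernelOp G v‖ 0 with h0 | h0
      · rw [h0]; positivity
      · have hp : 0 < ‖kernelOp G v‖ := lt_of_le_of_ne (norm_nonneg _) h0.symm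
        nlinarith)

lemma kernelOpL_apply (G : Lp 𝕜 2 (m.prod m)) : kernelOpL 𝕜 m G = kernelOp G := rfl

/-- Tensor products of indicators recover the integrals of `G` over measurable rectangles. These
form a π-system generating the product σ-algebra, so all set integrals of `G` vanish. -/
lemma eq_zero_of_forall_inner_tensorLp {G : Lp 𝕜 2 (m.prod m)}
    (h : ∀ u v : Lp 𝕜 2 m, inner 𝕜 (tensorLp u v) G = 0) : G = 0 := by
  have hG : Integrable G (m.prod m) := (Lp.memLp G).integrable (by norm_num)
  have rect : ∀ s t : Set A, MeasurableSet s → MeasurableSet t →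
      ∫ p in s ×ˢ t, G p ∂(m.prod m) = 0 := by
    intro s t hs ht
    have h1 := h (indicatorConstLp 2 hs (measure_ne_top _ _) 1)
      (indicatorConstLp 2 ht (measure_ne_top _ _) 1)
    rw [L2.inner_def] at h1
    rw [← integral_indicator (hs.prod ht), ← h1]
    refine integral_congr_ae ?_
    have hs' := Measure.quasiMeasurePreserving_fst (μ := m) (ν := m) |>.ae_eq_comp
      (indicatorConstLp_coeFn (p := 2) (hs := hs) (hμs := measure_ne_top m s) (c := (1 : 𝕜)))
    have ht' := Measure.quasiMeasurePreserving_snd (μ := m) (ν := m) |>.ae_eq_comp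
      (indicatorConstLp_coeFn (p := 2) (hs := ht) (hμs := measure_ne_top m t) (c := (1 : 𝕜)))
    filter_upwards [coeFn_tensorLp (indicatorConstLp 2 hs (measure_ne_top m s) (1 : 𝕜))
      (indicatorConstLp 2 ht (measure_ne_top m t) 1), hs', ht'] with p hp hp1 hp2
    simp only [Function.comp] at hp1 hp2
    rw [hp, hp1, hp2, RCLike.inner_apply']
    by_cases h1 : p.1 ∈ s <;> by_cases h2 : p.2 ∈ t <;> simp [Set.indicator, h1, h2]
  have all : ∀ s : Set (A × A), MeasurableSet s → ∫ p in s, G p ∂(m.prod m) = 0 := by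
    intro s hs
    induction s, hs using MeasurableSpace.induction_on_inter generateFrom_prod.symm
      isPiSystem_prod with
    | empty => simp
    | basic s hs =>
      obtain ⟨a, ha, b, hb, rfl⟩ := hs
      exact rect a b ha hb
    | compl s hs ih =>
      have := integral_add_compl hs hG
      rw [ih, zero_add] at this
      rw [this, ← setIntegral_univ, ← Set.univ_prod_univ]
      exact rect _ _ .univ .univ
    | iUnion f hd hm ih =>
      rw [integral_iUnion hm hd hG.integrableOn]
      simp [ih]
  have := hG.ae_eq_zero_of_forall_setIntegral_eq_zero fun s hs _ => all s hs
  exact (Lp.eq_zero_iff_ae_eq_zero).2 this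

/-- Kernels with compact operators form a subspace, closed because the operator depends continuously
on the kernel. It contains all tensor products, whose operators have rank one, and nothing but zero
is orthogonal to those. -/
lemma isCompactOperator_kernelOp (G : Lp 𝕜 2 (m.prod m)) : IsCompactOperator (kernelOp G) := by
  let K : Submodule 𝕜 (Lp 𝕜 2 (m.prod m)) :=
    { carrier := {G | IsCompactOperator (kernelOpL 𝕜 m G)}
      add_mem' := fun {a b} ha hb => by
        simp only [Set.mem_ofPred_eq, map_add] at *
        exact ha.add hb
      zero_mem' := by
        simp only [Set.mem_ofPred_eq, map_zero]
        exact isCompactOperator_zero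
      smul_mem' := fun c a ha => by
        simp only [Set.mem_ofPred_eq, map_smul] at *
        exact ha.smul c }
  have hK : IsClosed (K : Set (Lp 𝕜 2 (m.prod m))) :=
    isClosed_setOfPred_isCompactOperator.preimage (kernelOpL 𝕜 m).continuous
  have htop : K = ⊤ := by
    have hc : CompleteSpace K := hK.completeSpace_coe
    rw [← Submodule.orthogonal_eq_bot_iff, Submodule.eq_bot_iff]
    intro H hH
    refine eq_zero_of_forall_inner_tensorLp fun u v => hH _ ?_
    change IsCompactOperator (kernelOp (tensorLp u v))
    have e : kernelOp (tensorLp u v) = (innerSL 𝕜 v).smulRight u := by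
      ext1 w
      rw [kernelOp_tensorLp]; rfl
    rw [e]
    have hc : IsCompactOperator (ContinuousLinearMap.toSpanSingleton 𝕜 u) :=
      isCompactOperator_of_locallyCompactSpace_rng _
    exact hc.comp_clm (innerSL 𝕜 v)
  have : G ∈ K := htop ▸ Submodule.mem_top
  exact this

/-- Parseval's identity for a symmetric kernel: the squared norm of the kernel is the sum of the
squares of the eigenvalues. -/
lemma hasSum_sq_eigenvalues {ι : Type*} {G : Lp 𝕜 2 (m.prod m)}
    (hsym : (kernelOp G).IsSymmetric) {e : ι → Lp 𝕜 2 m} (he : Orthonormal 𝕜 e) {l : ι → 𝕜}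
    (hl0 : ∀ r, l r ≠ 0) (hl : ∀ r, kernelOp G (e r) = l r • e r)
    (hspan : ∀ s : 𝕜, s ≠ 0 →
      Module.End.eigenspace (kernelOp G : Lp 𝕜 2 m →ₗ[𝕜] Lp 𝕜 2 m) s ≤
        Submodule.span 𝕜 (Set.range e)) :
    HasSum (fun r => ‖l r‖ ^ 2) (‖G‖ ^ 2) := by
  have ht : Orthonormal 𝕜 (fun r => tensorLp (e r) (e r)) := by
    refine ⟨fun r => by rw [norm_tensorLp, he.1 r, mul_one], fun r s hrs => ?_⟩
    simp only [inner_tensorLp_tensorLp]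
    rw [he.2 hrs, mul_zero]
  have hc : ∀ r, inner 𝕜 (tensorLp (e r) (e r)) G = l r := fun r => by
    rw [inner_tensorLp, hl, inner_smul_right, inner_self_eq_norm_sq_to_K, he.1 r]; simp
  -- Bessel's inequality for the orthonormal tensors makes the diagonal expansion converge; its sum
  -- `H` has to be identified with `G`.
  have hsum : Summable fun r => l r • tensorLp (e r) (e r) := by
    have h1 := (ht.orthogonalFamily).summable_iff_norm_sq_summable l
    have h2 := ht.inner_products_summable G
    simp only [hc] at h2
    exact h1.2 h2
  obtain ⟨H, hH⟩ := hsum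
  have hsum_apply : ∀ w : Lp 𝕜 2 m, HasSum (fun r => l r • inner 𝕜 (e r) w • e r)
      (kernelOp H w) := by
    intro w
    have h1 := (hH.mapL (kernelOpL 𝕜 m)).mapL (ContinuousLinearMap.apply 𝕜 (Lp 𝕜 2 m) w)
    simpa only [map_smul, kernelOpL_apply, ContinuousLinearMap.apply_apply, kernelOp_tensorLp]
      using h1
  have hDe : ∀ k, kernelOp H (e k) = kernelOp G (e k) := by
    intro k
    rw [hl]
    refine (hsum_apply (e k)).unique ?_
    have h2 : l k • e k = l k • inner 𝕜 (e k) (e k) • e k := by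
      rw [inner_self_eq_norm_sq_to_K, he.1 k]; simp
    rw [h2]
    refine hasSum_single k fun r hr => ?_
    rw [he.2 hr, zero_smul, smul_zero]
  -- By symmetry, the null space of `kernelOp G` is orthogonal to every eigenvector with a nonzero
  -- eigenvalue.
  have hker : ∀ w, kernelOp G w = 0 → kernelOp H w = 0 := by
    intro w hw
    refine (hsum_apply w).unique ?_
    have h0 : ∀ r, inner 𝕜 (e r) w = 0 := by
      intro r
      have h1 : inner 𝕜 (kernelOp G (e r)) w = inner 𝕜 (e r) (kernelOp G w) := hsym (e r) w
      rw [hl, hw, inner_zero_right, inner_smul_left] at h1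
      exact (mul_eq_zero.1 h1).resolve_left (by simpa using hl0 r)
    simp [h0]
  -- The two operators agree on each eigenspace, and the eigenspaces of a compact symmetric operator
  -- span a dense subspace.
  have hD : kernelOp (G - H) = 0 := by
    have hle : (⨆ s, Module.End.eigenspace (kernelOp G : Lp 𝕜 2 m →ₗ[𝕜] Lp 𝕜 2 m) s) ≤
        LinearMap.ker (kernelOp (G - H) : Lp 𝕜 2 m →ₗ[𝕜] Lp 𝕜 2 m) := by
      have hsub : ∀ w, kernelOp (G - H) w = kernelOp G w - kernelOp H w := fun w => by
        rw [← kernelOpL_apply, map_sub]; rfl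
      refine iSup_le fun s => ?_
      rcases eq_or_ne s 0 with rfl | hs
      · intro w hw
        have hw0 : kernelOp G w = 0 := by
          have := Module.End.mem_eigenspace_iff.1 hw
          simpa using this
        change kernelOp (G - H) w = 0
        rw [hsub, hw0, hker w hw0, sub_zero]
      · refine (hspan s hs).trans (Submodule.span_le.2 ?_)
        rintro _ ⟨r, rfl⟩
        change kernelOp (G - H) (e r) = 0
        rw [hsub, hDe, sub_self]
    have hcl := Submodule.topologicalClosure_minimal _ hle (kernelOp (G - H)).isClosed_ker
    rw [(Submodule.topologicalClosure_eq_top_iff).2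
      (ContinuousLinearMap.orthogonalComplement_iSup_eigenspaces_eq_bot
        (isCompactOperator_kernelOp G) hsym)] at hcl
    ext1 w
    exact hcl Submodule.mem_top
  have hGH : G = H := sub_eq_zero.1 <| eq_zero_of_forall_inner_tensorLp fun u v => by
    rw [inner_tensorLp, hD]; simp
  have h3 := hH.mapL (innerSL 𝕜 G)
  rw [← hGH] at h3
  simp only [innerSL_apply_apply, inner_smul_right] at h3
  have h4 : ∀ r, l r * inner 𝕜 G (tensorLp (e r) (e r)) = ((‖l r‖ ^ 2 : ℝ) : 𝕜) := fun r => by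
    rw [← inner_conj_symm, hc, RCLike.mul_conj]; norm_cast
  simp only [h4, inner_self_eq_norm_sq_to_K] at h3
  exact_mod_cast h3

/-- If the squared norm of a kernel is the sum of the squares of the eigenvalues of an orthonormal
family of eigenfunctions, then the kernel is the sum of the corresponding expansion. -/
lemma hasSum_eigenfunction_expansion {ι : Type*} {G : Lp 𝕜 2 (m.prod m)}
    {e : ι → Lp 𝕜 2 m} (he : Orthonormal 𝕜 e) {l : ι → 𝕜}
    (hl : ∀ r, kernelOp G (e r) = l r • e r)
    (hsum : HasSum (fun r => ‖l r‖ ^ 2) (‖G‖ ^ 2)) :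
    HasSum (fun r => l r • tensorLp (e r) (e r)) G := by
  have ht : Orthonormal 𝕜 (fun r => tensorLp (e r) (e r)) := by
    refine ⟨fun r => by rw [norm_tensorLp, he.1 r, mul_one], fun r s hrs => ?_⟩
    simp only [inner_tensorLp_tensorLp]
    rw [he.2 hrs, mul_zero]
  have hc : ∀ r, inner 𝕜 (tensorLp (e r) (e r)) G = l r := fun r => by
    rw [inner_tensorLp, hl, inner_smul_right, inner_self_eq_norm_sq_to_K, he.1 r]; simp
  have h1 := (ht.orthogonalFamily).summable_iff_norm_sq_summable l
  obtain ⟨H, hH⟩ := h1.2 hsum.summable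
  replace hH : HasSum (fun r => l r • tensorLp (e r) (e r)) H := hH
  have hcH : ∀ r, inner 𝕜 (tensorLp (e r) (e r)) H = l r := fun r => by
    have h2 : l r = innerSL 𝕜 (tensorLp (e r) (e r)) (l r • tensorLp (e r) (e r)) := by
      rw [innerSL_apply_apply, inner_smul_right, inner_self_eq_norm_sq_to_K, ht.1 r]; simp
    have h3 := (hH.mapL (innerSL 𝕜 (tensorLp (e r) (e r)))).unique
      (hasSum_single r fun k hk => by
        rw [innerSL_apply_apply, inner_smul_right, ht.2 hk.symm, mul_zero])
    rw [← h2] at h3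
    exact h3
  -- Pairing with `H` sees only the diagonal coefficients, which `G` and `H` share. Hence `⟪G, H⟫`
  -- and `⟪H, H⟫` both equal `‖G‖ ^ 2`, which forces `G - H` to have norm zero.
  have key : ∀ K : Lp 𝕜 2 (m.prod m), (∀ r, inner 𝕜 (tensorLp (e r) (e r)) K = l r) →
      inner 𝕜 K H = ((‖G‖ ^ 2 : ℝ) : 𝕜) := by
    intro K hK
    refine (hH.mapL (innerSL 𝕜 K)).unique ?_
    have h4 : ∀ r, innerSL 𝕜 K (l r • tensorLp (e r) (e r)) = ((‖l r‖ ^ 2 : ℝ) : 𝕜) := fun r => by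
      rw [innerSL_apply_apply, inner_smul_right, ← inner_conj_symm, hK, RCLike.mul_conj]; norm_cast
    simp only [h4]
    exact_mod_cast hsum
  have hGG := key G hc
  have hHH := key H hcH
  have : ‖G - H‖ ^ 2 = 0 := by
    rw [@norm_sub_sq 𝕜, hGG]
    rw [inner_self_eq_norm_sq_to_K] at hHH
    have hHn : ‖H‖ ^ 2 = ‖G‖ ^ 2 := by exact_mod_cast hHH
    rw [hHn, RCLike.ofReal_re]; ring
  have hGH : G = H := by
    rw [← sub_eq_zero, ← norm_eq_zero]
    exact pow_eq_zero_iff two_ne_zero |>.1 this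
  rw [hGH]
  exact hH

end HilbertSchmidt

/-! ### Adjoints of integral operators -/

section Adjoint

open scoped ComplexConjugate

variable {𝕜 : Type*} [RCLike 𝕜] {A : Type*} [MeasurableSpace A] {m : Measure A}
  [IsFiniteMeasure m]

lemma inner_integralOperator_left {g h : A → A → 𝕜}
    (hg : MemLp (Function.uncurry g) 2 (m.prod m)) (hh : MemLp (Function.uncurry h) 2 (m.prod m))
    (hgh : ∀ᵐ p ∂(m.prod m), h p.1 p.2 = conj (g p.2 p.1)) (u v : Lp 𝕜 2 m) :
    inner 𝕜 (integralOperator m g hg u) v = inner 𝕜 u (integralOperator m h hh v) := by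
  rw [← inner_conj_symm, inner_integralOperator, inner_integralOperator, ← integral_conj,
    ← integral_prod_swap]
  refine integral_congr_ae ?_
  filter_upwards [hgh] with p hp
  simp only [Prod.fst_swap, Prod.snd_swap, map_mul, RCLike.conj_conj, hp]
  ring

lemma adjoint_integralOperator {g h : A → A → 𝕜}
    (hg : MemLp (Function.uncurry g) 2 (m.prod m)) (hh : MemLp (Function.uncurry h) 2 (m.prod m))
    (hgh : ∀ᵐ p ∂(m.prod m), h p.1 p.2 = conj (g p.2 p.1)) :
    ContinuousLinearMap.adjoint (integralOperator m g hg) = integralOperator m h hh := by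
  symm
  rw [ContinuousLinearMap.eq_adjoint_iff]
  intro u v
  rw [← inner_conj_symm, ← inner_integralOperator_left hg hh hgh, inner_conj_symm]

lemma integralOperator_congr {g h : A → A → 𝕜}
    (hg : MemLp (Function.uncurry g) 2 (m.prod m)) (hh : MemLp (Function.uncurry h) 2 (m.prod m))
    (hgh : ∀ᵐ p ∂(m.prod m), g p.1 p.2 = h p.1 p.2) :
    integralOperator m g hg = integralOperator m h hh := by
  rw [integralOperator_eq_kernelOp, integralOperator_eq_kernelOp]
  congr 1
  exact MemLp.toLp_congr _ _ hgh

end Adjoint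

/-! ### Enumerating eigenvalues with multiplicity -/

section Listing

variable {𝕜 : Type*} [RCLike 𝕜] {E : Type*} [NormedAddCommGroup E] [InnerProductSpace 𝕜 E]

lemma eigenMultiplicity_eq_finrank (T : E →L[𝕜] E) (z : 𝕜)
    [FiniteDimensional 𝕜 (Module.End.eigenspace (T : E →ₗ[𝕜] E) z)] :
    eigenMultiplicity T z =
      (Module.finrank 𝕜 (Module.End.eigenspace (T : E →ₗ[𝕜] E) z) : ℕ∞) := by
  rw [eigenMultiplicity, ← Module.finrank_eq_rank, Cardinal.toENat_nat]

/-- A list of eigenvalues with multiplicities is realized by an orthonormal family of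
eigenvectors which spans the eigenspaces. -/
lemma exists_orthonormal_eigenvectors (T : E →L[𝕜] E) (ev : ℝ → 𝕜) (p : ℝ → Prop) {ι : Type*}
    (c : ι → ℝ) (hc : ∀ r, p (c r))
    (hcard : ∀ s, p s → {r | c r = s}.encard = eigenMultiplicity T (ev s))
    (hfin : ∀ s, p s → FiniteDimensional 𝕜 (Module.End.eigenspace (T : E →ₗ[𝕜] E) (ev s)))
    (horth : ∀ s t, p s → p t → s ≠ t → ∀ u v, T u = ev s • u → T v = ev t • v →
      inner 𝕜 u v = 0) :
    ∃ e : ι → E, Orthonormal 𝕜 e ∧ (∀ r, T (e r) = ev (c r) • e r) ∧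
      ∀ s, p s → Module.End.eigenspace (T : E →ₗ[𝕜] E) (ev s) ≤
        Submodule.span 𝕜 (Set.range e) := by
  -- Eigenspaces are finite dimensional, so equality of cardinals makes each fibre of `c` a valid
  -- index set for a basis of the corresponding eigenspace.
  have hσ : ∀ s, p s → Nonempty ({r // c r = s} ≃
      Fin (Module.finrank 𝕜 (Module.End.eigenspace (T : E →ₗ[𝕜] E) (ev s)))) := by
    intro s hs
    have := hfin s hs
    have h := hcard s hs
    rw [eigenMultiplicity_eq_finrank] at h
    have hf : {r | c r = s}.Finite := Set.finite_of_encard_eq_coe h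
    have : Finite {r // c r = s} := hf
    refine ⟨Finite.equivFinOfCardEq ?_⟩
    have h2 := hf.cast_ncard_eq
    rw [h] at h2
    exact_mod_cast h2
  have hb : ∀ s, p s → ∃ b : {r // c r = s} → E, Orthonormal 𝕜 b ∧ (∀ r, T (b r) = ev s • b r) ∧
      Module.End.eigenspace (T : E →ₗ[𝕜] E) (ev s) = Submodule.span 𝕜 (Set.range b) := by
    intro s hs
    have := hfin s hs
    obtain ⟨σ⟩ := hσ s hs
    have := Fintype.ofEquiv _ σ.symm
    let B := (stdOrthonormalBasis 𝕜 (Module.End.eigenspace (T : E →ₗ[𝕜] E) (ev s))).reindex σ.symm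
    refine ⟨fun r => (B r : E), B.orthonormal.comp_linearIsometry (Submodule.subtypeₗᵢ _),
      fun r => Module.End.mem_eigenspace_iff.1 (B r).2, ?_⟩
    have h := congrArg (Submodule.map (Submodule.subtype _)) B.toBasis.span_eq
    rw [Submodule.map_top, Submodule.range_subtype, Submodule.map_span, ← Set.range_comp] at h
    refine h.symm.trans ?_
    congr 2
  choose! b hb1 hb2 hb3 using hb
  -- Vectors indexed in one fibre have to be compared inside a single basis; substitution removes
  -- the dependence of the basis on `c r`.
  have he : ∀ s r (h : c r = s), b (c r) ⟨r, rfl⟩ = b s ⟨r, h⟩ := by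
    rintro s r rfl; rfl
  refine ⟨fun r => b (c r) ⟨r, rfl⟩, ⟨fun r => (hb1 _ (hc r)).1 _, fun r r' hr => ?_⟩,
    fun r => hb2 _ (hc r) _, fun s hs => ?_⟩
  · by_cases h : c r = c r'
    · simp only
      rw [he _ _ h]
      exact (hb1 _ (hc r')).2 (by simpa using hr)
    · exact horth _ _ (hc r) (hc r') h _ _ (hb2 _ (hc r) _) (hb2 _ (hc r') _)
  · rw [hb3 s hs]
    refine Submodule.span_mono ?_
    rintro _ ⟨⟨r, hr⟩, rfl⟩
    exact ⟨r, he s r hr⟩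

lemma exists_seqIndex_equiv (ι : Type*) [Countable ι] : ∃ R : ℕ∞, Nonempty (SeqIndex R ≃ ι) := by
  rcases finite_or_infinite ι with h | h
  · refine ⟨(Nat.card ι : ℕ∞), ⟨Equiv.trans ?_ (Finite.equivFin ι).symm⟩⟩
    exact (Equiv.subtypeEquivRight fun r => by simp).trans Fin.equivSubtype.symm
  · obtain ⟨d⟩ := nonempty_denumerable ι
    exact ⟨⊤, ⟨((Equiv.subtypeUnivEquiv fun r => by simp)).trans (Denumerable.eqv ι).symm⟩⟩

/-- Countably many eigenvalues with finite multiplicities can be enumerated. -/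
lemma exists_eigenvalue_listing (T : E →L[𝕜] E) (ev : ℝ → 𝕜) (p : ℝ → Prop)
    (hfin : ∀ s, p s → FiniteDimensional 𝕜 (Module.End.eigenspace (T : E →ₗ[𝕜] E) (ev s)))
    (hcount : {s | p s ∧ Module.End.eigenspace (T : E →ₗ[𝕜] E) (ev s) ≠ ⊥}.Countable) :
    ∃ (R : ℕ∞) (c : SeqIndex R → ℝ), (∀ r, p (c r)) ∧
      ∀ s, p s → {r | c r = s}.encard = eigenMultiplicity T (ev s) := by
  have : Countable {s | p s ∧ Module.End.eigenspace (T : E →ₗ[𝕜] E) (ev s) ≠ ⊥} :=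
    hcount.to_subtype
  -- One index for each coordinate of each nontrivial eigenspace: countably many eigenvalues, each
  -- of finite multiplicity.
  let ι := (s : {s | p s ∧ Module.End.eigenspace (T : E →ₗ[𝕜] E) (ev s) ≠ ⊥}) ×
    Fin (Module.finrank 𝕜 (Module.End.eigenspace (T : E →ₗ[𝕜] E) (ev s)))
  obtain ⟨R, ⟨φ⟩⟩ := exists_seqIndex_equiv ι
  refine ⟨R, fun r => (φ r).1, fun r => (φ r).1.2.1, fun s hs => ?_⟩
  have := hfin s hs
  rw [eigenMultiplicity_eq_finrank]
  have e1 : {r | ((φ r).1 : ℝ) = s} = φ ⁻¹' {x : ι | (x.1 : ℝ) = s} := rfl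
  rw [e1, ← Equiv.image_symm_eq_preimage, φ.symm.injective.encard_image]
  by_cases h : Module.End.eigenspace (T : E →ₗ[𝕜] E) (ev s) = ⊥
  · have e2 : {x : ι | (x.1 : ℝ) = s} = ∅ := by
      refine Set.eq_empty_iff_forall_notMem.2 ?_
      rintro ⟨⟨t, ht⟩, i⟩ rfl
      exact ht.2 h
    rw [e2, h]
    simp
  · let f : Fin (Module.finrank 𝕜 (Module.End.eigenspace (T : E →ₗ[𝕜] E) (ev s))) → ι :=
      fun i => ⟨⟨s, hs, h⟩, i⟩
    have e2 : {x : ι | (x.1 : ℝ) = s} = Set.range f := by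
      ext x
      constructor
      · obtain ⟨⟨t, ht⟩, i⟩ := x
        rintro rfl
        exact ⟨i, rfl⟩
      · rintro ⟨i, rfl⟩
        rfl
    have hf : Function.Injective f := fun i j hij =>
      eq_of_heq (Sigma.mk.inj hij).2
    rw [e2, ← Set.image_univ, hf.encard_image]
    simp

end Listing

section Countability

variable {𝕜 : Type*} [RCLike 𝕜] {A : Type*} [MeasurableSpace A] {m : Measure A}
  [IsFiniteMeasure m]

/-- Unit eigenvectors for distinct eigenvalues are orthonormal, hence so are their tensor squares,
whose coefficients in `G` are the eigenvalues. By Bessel's inequality the squared eigenvalues are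
summable, and a summable family of nonzero terms is countable. -/
lemma countable_eigenvalues (G : Lp 𝕜 2 (m.prod m)) (ev : ℝ → 𝕜) (p : ℝ → Prop)
    (hev : ∀ s, p s → ev s ≠ 0)
    (horth : ∀ s t, p s → p t → s ≠ t → ∀ u v, kernelOp G u = ev s • u →
      kernelOp G v = ev t • v → inner 𝕜 u v = 0) :
    {s | p s ∧ Module.End.eigenspace (kernelOp G : Lp 𝕜 2 m →ₗ[𝕜] Lp 𝕜 2 m) (ev s) ≠
      ⊥}.Countable := by
  have h1 : ∀ s : {s | p s ∧ Module.End.eigenspace (kernelOp G : Lp 𝕜 2 m →ₗ[𝕜] Lp 𝕜 2 m)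
      (ev s) ≠ ⊥}, ∃ u : Lp 𝕜 2 m, ‖u‖ = 1 ∧ kernelOp G u = ev s • u := by
    rintro ⟨s, hs, h⟩
    obtain ⟨u, hu, hu0⟩ := Submodule.exists_mem_ne_zero_of_ne_bot h
    refine ⟨((‖u‖⁻¹ : ℝ) : 𝕜) • u, ?_, ?_⟩
    · rw [norm_smul, RCLike.norm_ofReal, abs_of_nonneg (by positivity),
        inv_mul_cancel₀ (norm_ne_zero_iff.2 hu0)]
    · rw [map_smul, smul_comm]
      congr 1
      exact Module.End.mem_eigenspace_iff.1 hu
  choose u hu1 hu2 using h1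
  have hu : Orthonormal 𝕜 u := ⟨hu1, fun s t hst =>
    horth s t s.2.1 t.2.1 (fun h => hst (Subtype.ext h)) _ _ (hu2 s) (hu2 t)⟩
  have ht : Orthonormal 𝕜 (fun r => tensorLp (u r) (u r)) := by
    refine ⟨fun r => by rw [norm_tensorLp, hu.1 r, mul_one], fun r s hrs => ?_⟩
    simp only [inner_tensorLp_tensorLp]
    rw [hu.2 hrs, mul_zero]
  have hs := ht.inner_products_summable G
  have hc := hs.countable_support
  have huniv : Function.support (fun i => ‖inner 𝕜 (tensorLp (u i) (u i)) G‖ ^ 2) =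
      Set.univ := by
    refine Set.eq_univ_of_forall fun s => ?_
    rw [Function.mem_support, inner_tensorLp, hu2, inner_smul_right, inner_self_eq_norm_sq_to_K,
      hu1 s]
    simpa using hev s s.2.1
  rw [huniv, Set.countable_univ_iff] at hc
  exact Set.countable_coe_iff.1 hc

lemma finiteDimensional_eigenspace_kernelOp (G : Lp 𝕜 2 (m.prod m)) {z : 𝕜} (hz : z ≠ 0) :
    FiniteDimensional 𝕜
      (Module.End.eigenspace (kernelOp G : Lp 𝕜 2 m →ₗ[𝕜] Lp 𝕜 2 m) z) :=
  ContinuousLinearMap.finite_dimensional_eigenspace (isCompactOperator_kernelOp G) z hz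

end Countability

/-! ### Real symmetric kernels -/

section RealSymmetric

variable {A : Type*} [MeasurableSpace A] {m : Measure A} [IsFiniteMeasure m]

lemma inner_eq_zero_of_ne_eigenvalue {G : Lp ℝ 2 (m.prod m)} (hG : (kernelOp G).IsSymmetric)
    {s t : ℝ} (hst : s ≠ t) {u v : Lp ℝ 2 m} (hu : kernelOp G u = s • u)
    (hv : kernelOp G v = t • v) : inner ℝ u v = 0 := by
  have h : inner ℝ (kernelOp G u) v = inner ℝ u (kernelOp G v) := hG u v
  rw [hu, hv, inner_smul_left, inner_smul_right] at h
  have h2 : (s - t) * inner ℝ u v = 0 := by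
    simp only [conj_trivial] at h
    linarith
  exact (mul_eq_zero.1 h2).resolve_left (sub_ne_zero.2 hst)

lemma exists_listsNonzeroEigenvalues {G : Lp ℝ 2 (m.prod m)} (hG : (kernelOp G).IsSymmetric) :
    ∃ (R : ℕ∞) (c : SeqIndex R → ℝ), ListsNonzeroEigenvalues (kernelOp G) c :=
  exists_eigenvalue_listing (kernelOp G) id (· ≠ 0)
    (fun _ hs => finiteDimensional_eigenspace_kernelOp G hs)
    (countable_eigenvalues G id (· ≠ 0) (fun _ hs => hs)
      fun _ _ _ _ hst _ _ => inner_eq_zero_of_ne_eigenvalue hG hst)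

/-- Eigenspaces of a symmetric operator are mutually orthogonal, so their bases combine into one
orthonormal family, to which Parseval's identity applies. -/
lemma ListsNonzeroEigenvalues.exists_orthonormal {G : Lp ℝ 2 (m.prod m)}
    (hG : (kernelOp G).IsSymmetric) {R : ℕ∞} {c : SeqIndex R → ℝ}
    (hc : ListsNonzeroEigenvalues (kernelOp G) c) :
    ∃ e : SeqIndex R → Lp ℝ 2 m, Orthonormal ℝ e ∧ (∀ r, kernelOp G (e r) = c r • e r) ∧
      HasSum (fun r => c r ^ 2) (‖G‖ ^ 2) := by
  obtain ⟨e, he1, he2, he3⟩ := exists_orthonormal_eigenvectors (kernelOp G) id (· ≠ 0) c hc.1 hc.2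
    (fun _ hs => finiteDimensional_eigenspace_kernelOp G hs)
    fun _ _ _ _ hst _ _ => inner_eq_zero_of_ne_eigenvalue hG hst
  refine ⟨e, he1, he2, ?_⟩
  simpa only [Real.norm_eq_abs, sq_abs] using hasSum_sq_eigenvalues hG he1 hc.1 he2 he3

end RealSymmetric

/-! ### Degenerate kernels of independent variables -/

section Degenerate

variable {Ω A B : Type*} [MeasurableSpace Ω] [MeasurableSpace A] [MeasurableSpace B]
  {P : Measure Ω} {ρ : Measure A}

/-- Pairwise orthogonal square integrable variables satisfy Pythagoras' theorem. -/
lemma integral_sq_sum_of_orthogonal {κ : Type*} (s : Finset κ) {a : κ → Ω → ℝ}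
    (ha : ∀ q ∈ s, MemLp (a q) 2 P)
    (hort : ∀ q ∈ s, ∀ q' ∈ s, q ≠ q' → ∫ ω, a q ω * a q' ω ∂P = 0) :
    ∫ ω, (∑ q ∈ s, a q ω) ^ 2 ∂P = ∑ q ∈ s, ∫ ω, a q ω ^ 2 ∂P := by
  have e : ∀ ω, (∑ q ∈ s, a q ω) ^ 2 = ∑ q ∈ s, ∑ q' ∈ s, a q ω * a q' ω := fun ω => by
    rw [sq, Finset.sum_mul_sum]
  have hi : ∀ q ∈ s, ∀ q' ∈ s, Integrable (fun ω => a q ω * a q' ω) P := fun q hq q' hq' =>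
    (ha q hq).integrable_mul (ha q' hq')
  simp only [e]
  rw [integral_finsetSum _ fun q hq => integrable_finsetSum _ fun q' hq' => hi q hq q' hq']
  refine Finset.sum_congr rfl fun q hq => ?_
  rw [integral_finsetSum _ fun q' hq' => hi q hq q' hq', Finset.sum_eq_single_of_mem q hq]
  · simp only [sq]
  · intro q' hq' hne
    exact hort q hq q' hq' hne.symm

variable [IsProbabilityMeasure P]

lemma map_prodMk_of_indepFun {Z : Ω → B} {Y : Ω → A} (hZ : Measurable Z) (hY : Measurable Y)
    (hZY : IndepFun Z Y P) (hYρ : P.map Y = ρ) :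
    P.map (fun ω => (Z ω, Y ω)) = (P.map Z).prod ρ := by
  rw [hZY.map_prod_eq_prod_map_map hZ.aemeasurable hY.aemeasurable, hYρ]

lemma map_pair_of_iIndepFun {Y : ℕ → Ω → A} (hYm : ∀ i, Measurable (Y i)) (hYi : iIndepFun Y P)
    (hYρ : ∀ i, P.map (Y i) = ρ) {i j : ℕ} (hij : i ≠ j) :
    MeasurePreserving (fun ω => (Y i ω, Y j ω)) P (ρ.prod ρ) := by
  refine ⟨(hYm i).prodMk (hYm j), ?_⟩
  rw [map_prodMk_of_indepFun (hYm i) (hYm j) (hYi.indepFun hij) (hYρ j), hYρ i]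

variable [IsProbabilityMeasure ρ]

/-- If `∫ G(x, y) dρ(y) = 0` for almost every `x` and `Y` is independent of `(V, D)`, then
`G(V, Y)` is orthogonal to every function `D`. -/
lemma integral_degenerate_mul_eq_zero {C : Type*} [MeasurableSpace C] {G : C → A → ℝ}
    (hG : Measurable (Function.uncurry G)) {V : Ω → C} {D : Ω → ℝ} {Y : Ω → A}
    (hV : Measurable V) (hD : Measurable D) (hY : Measurable Y)
    (hind : IndepFun (fun ω => (V ω, D ω)) Y P) (hYρ : P.map Y = ρ)
    (hdeg : ∀ᵐ x ∂(P.map V), ∫ y, G x y ∂ρ = 0)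
    (hint : Integrable (fun ω => G (V ω) (Y ω) * D ω) P) :
    ∫ ω, G (V ω) (Y ω) * D ω ∂P = 0 := by
  have hZ : Measurable (fun ω => (V ω, D ω)) := hV.prodMk hD
  have hlaw := map_prodMk_of_indepFun hZ hY hind hYρ
  have hm : Measurable (fun q : (C × ℝ) × A => G q.1.1 q.2 * q.1.2) :=
    (hG.comp (measurable_fst.fst.prodMk measurable_snd)).mul measurable_fst.snd
  have h1 : Integrable (fun q : (C × ℝ) × A => G q.1.1 q.2 * q.1.2)
      ((P.map fun ω => (V ω, D ω)).prod ρ) := by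
    rw [← hlaw]
    exact (integrable_map_measure hm.aestronglyMeasurable (hZ.prodMk hY).aemeasurable).2 hint
  have : IsProbabilityMeasure (P.map fun ω => (V ω, D ω)) :=
    Measure.isProbabilityMeasure_map hZ.aemeasurable
  have h2 : ∫ ω, G (V ω) (Y ω) * D ω ∂P =
      ∫ q, G q.1.1 q.2 * q.1.2 ∂((P.map fun ω => (V ω, D ω)).prod ρ) := by
    rw [← hlaw, integral_map (hZ.prodMk hY).aemeasurable hm.aestronglyMeasurable]
  -- Independence makes the joint law a product, so `Y` is integrated out first with `(V, D)` fixed;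
  -- this inner integral vanishes by degeneracy.
  rw [h2, integral_prod _ h1]
  refine integral_eq_zero_of_ae ?_
  have h3 : ∀ᵐ q ∂(P.map fun ω => (V ω, D ω)), ∫ y, G q.1 y ∂ρ = 0 := by
    have h4 : (P.map fun ω => (V ω, D ω)).map Prod.fst = P.map V := by
      rw [Measure.map_map measurable_fst hZ]; rfl
    rw [← h4] at hdeg
    exact ae_of_ae_map measurable_fst.aemeasurable hdeg
  filter_upwards [h3] with q hq
  simp only [integral_mul_const, hq, zero_mul, Pi.zero_apply]

/-- `G(Y_i, Y_j)` is orthogonal to every function of variables other than `Y_j`. -/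
lemma integral_degenerate_mul_pair_eq_zero {Y : ℕ → Ω → A} (hYm : ∀ i, Measurable (Y i))
    (hYi : iIndepFun Y P) (hYρ : ∀ i, P.map (Y i) = ρ) {G : A → A → ℝ}
    (hG : Measurable (Function.uncurry G)) (hG2 : MemLp (Function.uncurry G) 2 (ρ.prod ρ))
    (hdeg : ∀ᵐ x ∂ρ, ∫ y, G x y ∂ρ = 0) {i j k l : ℕ} (hij : i ≠ j) (hkj : k ≠ j) (hlj : l ≠ j)
    {D : A → A → ℝ} (hD : Measurable (Function.uncurry D))
    (hD2 : MemLp (fun ω => D (Y k ω) (Y l ω)) 2 P) :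
    ∫ ω, G (Y i ω) (Y j ω) * D (Y k ω) (Y l ω) ∂P = 0 := by
  refine integral_degenerate_mul_eq_zero hG (hYm i)
    (hD.comp ((hYm k).prodMk (hYm l))) (hYm j) ?_ (hYρ j) (hYρ i ▸ hdeg)
    ((hG2.comp_measurePreserving (map_pair_of_iIndepFun hYm hYi hYρ hij)).integrable_mul hD2)
  -- The indices `i`, `k`, `l` may coincide among themselves; only their being different from `j`
  -- matters.
  have h := hYi.indepFun_finset {i, k, l} {j} (by simp [hij.symm, hkj.symm, hlj.symm]) hYm
  have hmz : Measurable fun z : (({i, k, l} : Finset ℕ) → A) =>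
      (z ⟨i, by simp⟩, D (z ⟨k, by simp⟩) (z ⟨l, by simp⟩)) :=
    (measurable_pi_apply _).prodMk
      (hD.comp (g := Function.uncurry D) (f := fun z : (({i, k, l} : Finset ℕ) → A) =>
        (z ⟨k, by simp⟩, z ⟨l, by simp⟩)) (by fun_prop))
  exact h.comp (φ := fun z : (({i, k, l} : Finset ℕ) → A) =>
      (z ⟨i, by simp⟩, D (z ⟨k, by simp⟩) (z ⟨l, by simp⟩)))
    (ψ := fun z : (({j} : Finset ℕ) → A) => z ⟨j, by simp⟩)
    hmz (measurable_pi_apply _)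

/-- The second moment of a weighted sum of a degenerate kernel over pairs of variables. -/
lemma integral_sq_sum_degenerate {Y : ℕ → Ω → A} (hYm : ∀ i, Measurable (Y i))
    (hYi : iIndepFun Y P) (hYρ : ∀ i, P.map (Y i) = ρ) {G : A → A → ℝ}
    (hG : Measurable (Function.uncurry G)) (hG2 : MemLp (Function.uncurry G) 2 (ρ.prod ρ))
    (hdeg : ∀ᵐ x ∂ρ, ∫ y, G x y ∂ρ = 0) (hdeg' : ∀ᵐ y ∂ρ, ∫ x, G x y ∂ρ = 0)
    (s : Finset (ℕ × ℕ)) (hs : ∀ q ∈ s, q.1 < q.2) (w : ℕ × ℕ → ℝ) :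
    ∫ ω, (∑ q ∈ s, w q * G (Y q.1 ω) (Y q.2 ω)) ^ 2 ∂P =
      (∑ q ∈ s, w q ^ 2) * ∫ p : A × A, G p.1 p.2 ^ 2 ∂(ρ.prod ρ) := by
  have hmem : ∀ q ∈ s, MemLp (fun ω => G (Y q.1 ω) (Y q.2 ω)) 2 P := fun q hq =>
    hG2.comp_measurePreserving (map_pair_of_iIndepFun hYm hYi hYρ (hs q hq).ne)
  rw [integral_sq_sum_of_orthogonal s fun q hq => (hmem q hq).const_mul (w q)]
  · rw [Finset.sum_mul]
    refine Finset.sum_congr rfl fun q hq => ?_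
    simp only [mul_pow, integral_const_mul]
    congr 1
    have hmp := map_pair_of_iIndepFun hYm hYi hYρ (hs q hq).ne
    have hm2 : Measurable fun p : A × A => G p.1 p.2 ^ 2 := hG.pow_const 2
    rw [← hmp.map_eq, integral_map hmp.measurable.aemeasurable hm2.aestronglyMeasurable]
  · intro q hq q' hq' hne
    have key : ∫ ω, G (Y q.1 ω) (Y q.2 ω) * G (Y q'.1 ω) (Y q'.2 ω) ∂P = 0 := by
      have h1 := hs q hq
      have h2 := hs q' hq'
      -- Two distinct ordered pairs cannot share both indices, so `q'` misses `q.2` or `q.1`, and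
      -- the kernel at `q` is integrated out in the missed variable.
      by_cases hc : q'.1 ≠ q.2 ∧ q'.2 ≠ q.2
      · exact integral_degenerate_mul_pair_eq_zero hYm hYi hYρ hG hG2 hdeg h1.ne hc.1 hc.2 hG
          (hmem q' hq')
      · have hc' : q'.1 ≠ q.1 ∧ q'.2 ≠ q.1 := by
          by_contra hc'
          refine hne (Prod.ext ?_ ?_) <;> omega
        exact integral_degenerate_mul_pair_eq_zero hYm hYi hYρ (G := fun x y => G y x)
          (hG.comp measurable_swap) (memLp_swap ρ hG2) hdeg' h1.ne' hc'.1 hc'.2 hG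
          (hmem q' hq')
    have e : ∀ ω, w q * G (Y q.1 ω) (Y q.2 ω) * (w q' * G (Y q'.1 ω) (Y q'.2 ω)) =
        w q * w q' * (G (Y q.1 ω) (Y q.2 ω) * G (Y q'.1 ω) (Y q'.2 ω)) := fun ω => by ring
    simp only [e, integral_const_mul, key, mul_zero]

end Degenerate

/-! ### Pairing consecutive variables -/

section Pairing

variable {Ω A : Type*} [MeasurableSpace Ω] [MeasurableSpace A]
  {P : Measure Ω} [IsProbabilityMeasure P]

/-- Independence says that the joint law is the product of the marginals, and a product over `ι × κ`
is an iterated product. -/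
lemma iIndepFun_curry {ι κ : Type*} {X : ι × κ → Ω → A} (hXm : ∀ p, Measurable (X p))
    (hX : iIndepFun X P) : iIndepFun (fun i ω j => X (i, j) ω) P := by
  have hp : ∀ p, IsProbabilityMeasure (P.map (X p)) := fun p =>
    Measure.isProbabilityMeasure_map (hXm p).aemeasurable
  have h1 := (iIndepFun_iff_map_fun_eq_infinitePi_map hXm).1 hX
  rw [iIndepFun_iff_map_fun_eq_infinitePi_map fun i => measurable_pi_lambda _ fun j => hXm _]
  have h2 : ∀ i, P.map (fun ω j => X (i, j) ω) =
      Measure.infinitePi fun j => P.map (X (i, j)) := fun i =>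
    (iIndepFun_iff_map_fun_eq_infinitePi_map fun j => hXm (i, j)).1
      (hX.precomp (g := fun j => (i, j)) fun a b h => (Prod.mk.inj h).2)
  simp only [h2]
  have h3 := Measure.infinitePi_map_curry (fun (i : ι) (j : κ) => P.map (X (i, j)))
  rw [← h3]
  have h4 : (Measure.infinitePi fun p : ι × κ => P.map (X (p.1, p.2))) =
    P.map (fun ω i => X i ω) := h1.symm
  rw [h4, Measure.map_map (by fun_prop) (measurable_pi_lambda _ hXm)]
  rfl

lemma iIndepFun_pairs {X : ℕ → Ω → A} (hXm : ∀ i, Measurable (X i)) (hX : iIndepFun X P) :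
    iIndepFun (fun k ω => (X (2 * k) ω, X (2 * k + 1) ω)) P := by
  have h1 : iIndepFun (fun p : ℕ × Fin 2 => X (2 * p.1 + p.2)) P := by
    refine hX.precomp (g := fun p : ℕ × Fin 2 => 2 * p.1 + p.2) ?_
    rintro ⟨a, i⟩ ⟨b, j⟩ h
    simp only at h
    have := i.2; have := j.2
    ext <;> simp <;> omega
  exact (iIndepFun_curry (X := fun p : ℕ × Fin 2 => X (2 * p.1 + p.2)) (fun p => hXm _) h1).comp
    (fun _ z => (z 0, z 1)) fun _ => by fun_prop

end Pairing

/-! ### Combinatorics of the alternating double sum -/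

section Alternating

/-- The pairs `i < j < n`. -/
def ltPairs (n : ℕ) : Finset (ℕ × ℕ) :=
  (Finset.range n ×ˢ Finset.range n).filter fun q => q.1 < q.2

lemma sum_ltPairs {M : Type*} [AddCommMonoid M] (n : ℕ) (a : ℕ → ℕ → M) :
    ∑ q ∈ ltPairs n, a q.1 q.2 = ∑ j ∈ Finset.range n, ∑ i ∈ Finset.range j, a i j := by
  rw [ltPairs, Finset.sum_filter, Finset.sum_product_right]
  refine Finset.sum_congr rfl fun j hj => ?_
  rw [← Finset.sum_filter]
  refine Finset.sum_congr ?_ fun _ _ => rfl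
  ext i
  simp only [Finset.mem_filter, Finset.mem_range] at hj ⊢
  omega

lemma mem_ltPairs {n : ℕ} {q : ℕ × ℕ} : q ∈ ltPairs n ↔ q.1 < q.2 ∧ q.2 < n := by
  simp only [ltPairs, Finset.mem_filter, Finset.mem_product, Finset.mem_range]
  omega

lemma card_ltPairs (n : ℕ) : ((ltPairs n).card : ℝ) = n * (n - 1) / 2 := by
  have h := sum_ltPairs n (fun _ _ => (1 : ℝ))
  simp only [Finset.sum_const, nsmul_eq_mul, mul_one, Finset.card_range] at h
  rw [h]
  clear h
  induction n with
  | zero => simp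
  | succ n ih => rw [Finset.sum_range_succ, ih]; push_cast; ring

lemma neg_one_pow_two_mul_add (k i : ℕ) : (-1 : ℝ) ^ (2 * k + i) = (-1) ^ i := by
  rw [pow_add, pow_mul]; simp

lemma sum_range_two_mul {M : Type*} [AddCommMonoid M] (a : ℕ → M) (m : ℕ) :
    ∑ i ∈ Finset.range (2 * m), a i = ∑ k ∈ Finset.range m, (a (2 * k) + a (2 * k + 1)) := by
  induction m with
  | zero => simp
  | succ m ih =>
    rw [show 2 * (m + 1) = 2 * m + 1 + 1 by ring, Finset.sum_range_succ, Finset.sum_range_succ, ih,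
      Finset.sum_range_succ, add_assoc]

variable {Ω S : Type*} (X : ℕ → Ω → S)

lemma biAltU_eq_sum_ltPairs (f : S → S → ℝ) (n : ℕ) (ω : Ω) :
    biAltU X f n ω = ∑ q ∈ ltPairs n, (-1 : ℝ) ^ (q.1 + q.2) * f (X q.1 ω) (X q.2 ω) := by
  rw [sum_ltPairs n fun i j => (-1 : ℝ) ^ (i + j) * f (X i ω) (X j ω), biAltU]
  refine Finset.sum_congr rfl fun j _ => Finset.sum_congr rfl fun i _ => ?_
  rw [show i + 1 + (j + 1) = 2 * 1 + (i + j) by ring, neg_one_pow_two_mul_add]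

lemma biAltU_add (f g : S → S → ℝ) (n : ℕ) (ω : Ω) :
    biAltU X (fun x y => f x y + g x y) n ω = biAltU X f n ω + biAltU X g n ω := by
  simp only [biAltU, mul_add, Finset.sum_add_distrib]

lemma biAltU_two_mul_succ (f : S → S → ℝ) (m : ℕ) (ω : Ω) :
    biAltU X f (2 * m + 1) ω = biAltU X f (2 * m) ω +
      ∑ k ∈ Finset.range m,
        (f (X (2 * k) ω) (X (2 * m) ω) - f (X (2 * k + 1) ω) (X (2 * m) ω)) := by
  rw [biAltU, Finset.sum_range_succ]
  congr 1
  rw [sum_range_two_mul]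
  refine Finset.sum_congr rfl fun k _ => ?_
  rw [show 2 * k + 1 + (2 * m + 1) = 2 * (k + m + 1) + 0 by ring,
    show 2 * k + 1 + 1 + (2 * m + 1) = 2 * (k + m + 1) + 1 by ring]
  simp only [neg_one_pow_two_mul_add]
  ring

lemma biAltU_two_mul_add_two (f : S → S → ℝ) (m : ℕ) (ω : Ω) :
    biAltU X f (2 * (m + 1)) ω = biAltU X f (2 * m) ω +
      ∑ k ∈ Finset.range m, (f (X (2 * k) ω) (X (2 * m) ω) - f (X (2 * k + 1) ω) (X (2 * m) ω)
        - f (X (2 * k) ω) (X (2 * m + 1) ω) + f (X (2 * k + 1) ω) (X (2 * m + 1) ω))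
      - f (X (2 * m) ω) (X (2 * m + 1) ω) := by
  rw [show 2 * (m + 1) = 2 * m + 1 + 1 by ring, biAltU, Finset.sum_range_succ]
  rw [← biAltU, biAltU_two_mul_succ, Finset.sum_range_succ, sum_range_two_mul]
  have e : ∀ k, (-1 : ℝ) ^ (2 * k + 1 + (2 * m + 1 + 1)) = -1 := fun k => by
    rw [show 2 * k + 1 + (2 * m + 1 + 1) = 2 * (k + m + 1) + 1 by ring, neg_one_pow_two_mul_add]
    simp
  have e' : ∀ k, (-1 : ℝ) ^ (2 * k + 1 + 1 + (2 * m + 1 + 1)) = 1 := fun k => by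
    rw [show 2 * k + 1 + 1 + (2 * m + 1 + 1) = 2 * (k + m + 2) + 0 by ring,
      neg_one_pow_two_mul_add]
    simp
  simp only [e, e']
  rw [← add_assoc, add_assoc (biAltU X f (2 * m) ω), ← Finset.sum_add_distrib, neg_one_mul,
    sub_eq_add_neg]
  congr 2
  refine Finset.sum_congr rfl fun k _ => ?_
  ring

/-- The kernel on pairs `(x, x')` obtained by alternating `f` in both pairs. -/
def pairKernel (f : S → S → ℝ) (z w : S × S) : ℝ :=
  f z.1 w.1 - f z.2 w.1 - f z.1 w.2 + f z.2 w.2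

/-- A sign depends only on the positions of the two indices inside their blocks `{2k, 2k+1}`. Two
different blocks thus contribute `pairKernel` with no further sign, and a single block contributes
its only ordered pair, with sign `-1`. -/
lemma biAltU_two_mul (f : S → S → ℝ) (m : ℕ) (ω : Ω) :
    biAltU X f (2 * m) ω = ∑ l ∈ Finset.range m, ∑ k ∈ Finset.range l,
        pairKernel f (X (2 * k) ω, X (2 * k + 1) ω) (X (2 * l) ω, X (2 * l + 1) ω)
      - ∑ k ∈ Finset.range m, f (X (2 * k) ω) (X (2 * k + 1) ω) := by
  induction m with
  | zero => simp [biAltU]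
  | succ m ih =>
    rw [biAltU_two_mul_add_two, ih, Finset.sum_range_succ, Finset.sum_range_succ]
    simp only [pairKernel]
    ring

/-- `pairKernel` annihilates sums of functions of one variable, so only the terms inside the blocks
survive. -/
lemma biAltU_add_two_mul (a b : S → ℝ) (m : ℕ) (ω : Ω) :
    biAltU X (fun x y => a x + b y) (2 * m) ω =
      -∑ k ∈ Finset.range m, (a (X (2 * k) ω) + b (X (2 * k + 1) ω)) := by
  rw [biAltU_two_mul]
  have : ∀ k l, pairKernel (fun x y => a x + b y) (X (2 * k) ω, X (2 * k + 1) ω)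
      (X (2 * l) ω, X (2 * l + 1) ω) = 0 := fun k l => by
    simp only [pairKernel]; ring
  simp [this]

/-- The unpaired last variable cancels from its own terms, but its row replaces each `a (X (2 * k))`
by `a (X (2 * k + 1))`. This is why the variance constants for even and odd `n` differ. -/
lemma biAltU_add_two_mul_succ (a b : S → ℝ) (m : ℕ) (ω : Ω) :
    biAltU X (fun x y => a x + b y) (2 * m + 1) ω =
      -∑ k ∈ Finset.range m, (a (X (2 * k + 1) ω) + b (X (2 * k + 1) ω)) := by
  rw [biAltU_two_mul_succ, biAltU_add_two_mul, ← Finset.sum_neg_distrib, ← Finset.sum_neg_distrib,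
    ← Finset.sum_add_distrib]
  refine Finset.sum_congr rfl fun k _ => ?_
  ring

/-- The coefficient function of even-numbered variables in the linear part of `biAltU X f n`. -/
def linEven (n : ℕ) (a : S → ℝ) (x : S) : ℝ := if Even n then a x else 0

/-- The coefficient function of odd-numbered variables in the linear part of `biAltU X f n`. -/
def linOdd (n : ℕ) (a b : S → ℝ) (x : S) : ℝ := if Even n then b x else a x + b x

lemma biAltU_add_eq (a b : S → ℝ) (n : ℕ) (ω : Ω) :
    biAltU X (fun x y => a x + b y) n ω =
      -∑ k ∈ Finset.range (n / 2),
        (linEven n a (X (2 * k) ω) + linOdd n a b (X (2 * k + 1) ω)) := by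
  rcases Nat.even_or_odd' n with ⟨m, rfl | rfl⟩
  · rw [biAltU_add_two_mul]
    simp [linEven, linOdd]
  · rw [biAltU_add_two_mul_succ, show (2 * m + 1) / 2 = m by omega]
    have : ¬ Even (2 * m + 1) := by simp
    simp [linEven, linOdd, this]

lemma biAltU_const (μ : ℝ) (n : ℕ) (ω : Ω) :
    biAltU X (fun _ _ => μ) n ω = -((n / 2 : ℕ) : ℝ) * μ := by
  have h := biAltU_add_eq X (fun _ => 0) (fun _ => μ) n ω
  simp only [zero_add] at h
  rw [h]
  simp [linEven, linOdd]

lemma biAltU_hoeffding [MeasurableSpace S] (ν : Measure S) (f : S → S → ℝ) (n : ℕ) (ω : Ω) :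
    biAltU X f n ω = biAltU X (hoeffding12 ν f) n ω
      - ∑ k ∈ Finset.range (n / 2), (linEven n (hoeffding1 ν f) (X (2 * k) ω) +
        linOdd n (hoeffding1 ν f) (hoeffding2 ν f) (X (2 * k + 1) ω))
      - ((n / 2 : ℕ) : ℝ) * kernelMean ν f := by
  have e : f = fun x y => hoeffding12 ν f x y + ((hoeffding1 ν f x + hoeffding2 ν f y) +
      kernelMean ν f) := by
    funext x y
    simp only [hoeffding12]; ring
  conv_lhs => rw [e]
  rw [biAltU_add, biAltU_add X (fun x y => hoeffding1 ν f x + hoeffding2 ν f y),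
    biAltU_add_eq, biAltU_const]
  ring

end Alternating

/-! ### The Hoeffding components -/

section HoeffdingComponents

set_option linter.unusedSectionVars false

variable {S : Type*} [MeasurableSpace S] {ν : Measure S} [IsProbabilityMeasure ν] {f : S → S → ℝ}

lemma integral_hoeffding1 (h2 : MemLp (Function.uncurry f) 2 (ν.prod ν)) :
    ∫ x, hoeffding1 ν f x ∂ν = 0 := by
  have hi : Integrable (fun p : S × S => f p.1 p.2) (ν.prod ν) := h2.integrable one_le_two
  simp only [hoeffding1]
  rw [integral_sub hi.integral_prod_left (integrable_const _), kernelMean, integral_prod _ hi]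
  simp

lemma integral_hoeffding2 (h2 : MemLp (Function.uncurry f) 2 (ν.prod ν)) :
    ∫ y, hoeffding2 ν f y ∂ν = 0 := by
  have hi : Integrable (fun p : S × S => f p.1 p.2) (ν.prod ν) := h2.integrable one_le_two
  simp only [hoeffding2]
  rw [integral_sub hi.integral_prod_right (integrable_const _), kernelMean,
    integral_prod_symm _ hi]
  simp

/-- Degeneracy: subtracting the projections removes the partial mean. Only almost every section of
`f` is integrable, hence the exceptional null set. -/
lemma integral_hoeffding12_right (hf : Measurable (Function.uncurry f))
    (h2 : MemLp (Function.uncurry f) 2 (ν.prod ν)) :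
    ∀ᵐ x ∂ν, ∫ y, hoeffding12 ν f x y ∂ν = 0 := by
  have hi : Integrable (fun p : S × S => f p.1 p.2) (ν.prod ν) := h2.integrable one_le_two
  have h2i : Integrable (hoeffding2 ν f) ν := (memLp_hoeffding2 ν hf h2).integrable one_le_two
  filter_upwards [hi.prod_right_ae] with x hx
  simp only [hoeffding12]
  have i1 : Integrable (fun y => f x y - hoeffding1 ν f x) ν := hx.sub (integrable_const _)
  have i2 : Integrable (fun y => f x y - hoeffding1 ν f x - hoeffding2 ν f y) ν := i1.sub h2i
  rw [integral_sub i2 (integrable_const _), integral_sub i1 h2i,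
    integral_sub hx (integrable_const _),
    integral_hoeffding2 h2]
  simp [hoeffding1]

lemma integral_hoeffding12_left (hf : Measurable (Function.uncurry f))
    (h2 : MemLp (Function.uncurry f) 2 (ν.prod ν)) :
    ∀ᵐ y ∂ν, ∫ x, hoeffding12 ν f x y ∂ν = 0 := by
  have hi : Integrable (fun p : S × S => f p.1 p.2) (ν.prod ν) := h2.integrable one_le_two
  have h1i : Integrable (hoeffding1 ν f) ν := (memLp_hoeffding1 ν hf h2).integrable one_le_two
  filter_upwards [hi.prod_left_ae] with y hy
  simp only [hoeffding12]
  have i1 : Integrable (fun x => f x y - hoeffding1 ν f x) ν := hy.sub h1i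
  have i2 : Integrable (fun x => f x y - hoeffding1 ν f x - hoeffding2 ν f y) ν :=
    i1.sub (integrable_const _)
  rw [integral_sub i2 (integrable_const _), integral_sub i1 (integrable_const _),
    integral_sub hy h1i,
    integral_hoeffding1 h2]
  simp [hoeffding2]

lemma measurable_linEven (n : ℕ) {a : S → ℝ} (ha : Measurable a) : Measurable (linEven n a) := by
  unfold linEven; split_ifs <;> fun_prop

lemma measurable_linOdd (n : ℕ) {a b : S → ℝ} (ha : Measurable a) (hb : Measurable b) :
    Measurable (linOdd n a b) := by
  unfold linOdd; split_ifs <;> fun_prop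

lemma memLp_linEven (n : ℕ) {a : S → ℝ} (ha : MemLp a 2 ν) : MemLp (linEven n a) 2 ν := by
  unfold linEven
  split_ifs
  · exact ha
  · exact MemLp.zero'

lemma memLp_linOdd (n : ℕ) {a b : S → ℝ} (ha : MemLp a 2 ν) (hb : MemLp b 2 ν) :
    MemLp (linOdd n a b) 2 ν := by
  unfold linOdd
  split_ifs
  · exact hb
  · exact ha.add hb

lemma integral_linEven (n : ℕ) {a : S → ℝ} (ha : ∫ x, a x ∂ν = 0) :
    ∫ x, linEven n a x ∂ν = 0 := by
  unfold linEven; split_ifs <;> simp [ha]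

lemma integral_linOdd (n : ℕ) {a b : S → ℝ} (hai : Integrable a ν) (hbi : Integrable b ν)
    (ha : ∫ x, a x ∂ν = 0) (hb : ∫ x, b x ∂ν = 0) :
    ∫ x, linOdd n a b x ∂ν = 0 := by
  unfold linOdd
  split_ifs
  · exact hb
  · rw [integral_add hai hbi, ha, hb, add_zero]

/-- The variance per pair of the linear part. -/
noncomputable def linVar (ν : Measure S) (f : S → S → ℝ) (n : ℕ) : ℝ :=
  Var[linEven n (hoeffding1 ν f); ν] + Var[linOdd n (hoeffding1 ν f) (hoeffding2 ν f); ν]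

lemma linVar_even (m : ℕ) : linVar ν f (2 * m) =
    Var[hoeffding1 ν f; ν] + Var[hoeffding2 ν f; ν] := by
  have h1 : linEven (2 * m) (hoeffding1 ν f) = hoeffding1 ν f := by
    funext x; simp [linEven]
  have h2 : linOdd (2 * m) (hoeffding1 ν f) (hoeffding2 ν f) = hoeffding2 ν f := by
    funext x; simp [linOdd]
  rw [linVar, h1, h2]

lemma linVar_odd (m : ℕ) : linVar ν f (2 * m + 1) =
    Var[fun x => hoeffding1 ν f x + hoeffding2 ν f x; ν] := by
  have h1 : linEven (2 * m + 1) (hoeffding1 ν f) = 0 := by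
    funext x; simp [linEven]
  have h2 : linOdd (2 * m + 1) (hoeffding1 ν f) (hoeffding2 ν f) =
      fun x => hoeffding1 ν f x + hoeffding2 ν f x := by
    funext x; simp [linOdd]
  rw [linVar, h1, h2, variance_zero, zero_add]

end HoeffdingComponents

/-! ### Moments of the bi-alternating U-statistic -/

section Moments

set_option linter.unusedSectionVars false

variable {Ω S : Type*} [MeasurableSpace Ω] [MeasurableSpace S]
  {P : Measure Ω} [IsProbabilityMeasure P] {ν : Measure S} [IsProbabilityMeasure ν]
  {X : ℕ → Ω → S} {f : S → S → ℝ}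

lemma measurePreserving_of_map_eq
    (hXm : ∀ i, Measurable (X i)) (hXν : ∀ i, P.map (X i) = ν) (i : ℕ) :
    MeasurePreserving (X i) P ν := ⟨hXm i, hXν i⟩

lemma memLp_kernel_comp
    (hXm : ∀ i, Measurable (X i)) (hXi : iIndepFun X P) (hXν : ∀ i, P.map (X i) = ν)
    (hf2 : MemLp (Function.uncurry f) 2 (ν.prod ν)) {i j : ℕ} (hij : i ≠ j) :
    MemLp (fun ω => f (X i ω) (X j ω)) 2 P :=
  hf2.comp_measurePreserving (map_pair_of_iIndepFun hXm hXi hXν hij)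

lemma memLp_biAltU
    (hXm : ∀ i, Measurable (X i)) (hXi : iIndepFun X P) (hXν : ∀ i, P.map (X i) = ν)
    (hf2 : MemLp (Function.uncurry f) 2 (ν.prod ν)) (n : ℕ) : MemLp (biAltU X f n) 2 P := by
  have : biAltU X f n = fun ω => ∑ q ∈ ltPairs n,
      (-1 : ℝ) ^ (q.1 + q.2) * f (X q.1 ω) (X q.2 ω) :=
    funext fun ω => biAltU_eq_sum_ltPairs X f n ω
  rw [this]
  exact memLp_finsetSum _ fun q hq =>
    (memLp_kernel_comp hXm hXi hXν hf2 (mem_ltPairs.1 hq).1.ne).const_mul _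

/-- The linear part of the Hoeffding decomposition of `biAltU X f n`. -/
noncomputable def linPart (ν : Measure S) (X : ℕ → Ω → S) (f : S → S → ℝ) (n : ℕ) (ω : Ω) : ℝ :=
  ∑ k ∈ Finset.range (n / 2), (linEven n (hoeffding1 ν f) (X (2 * k) ω) +
    linOdd n (hoeffding1 ν f) (hoeffding2 ν f) (X (2 * k + 1) ω))

lemma memLp_linPart_term
    (hXm : ∀ i, Measurable (X i)) (hXν : ∀ i, P.map (X i) = ν)
    (hf : Measurable (Function.uncurry f)) (hf2 : MemLp (Function.uncurry f) 2 (ν.prod ν))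
    (n k : ℕ) :
    MemLp (fun ω => linEven n (hoeffding1 ν f) (X (2 * k) ω) +
      linOdd n (hoeffding1 ν f) (hoeffding2 ν f) (X (2 * k + 1) ω)) 2 P :=
  ((memLp_linEven n (memLp_hoeffding1 ν hf hf2)).comp_measurePreserving
    (measurePreserving_of_map_eq hXm hXν (2 * k))).add
  ((memLp_linOdd n (memLp_hoeffding1 ν hf hf2) (memLp_hoeffding2 ν hf hf2)).comp_measurePreserving
    (measurePreserving_of_map_eq hXm hXν (2 * k + 1)))

lemma memLp_linPart
    (hXm : ∀ i, Measurable (X i)) (hXν : ∀ i, P.map (X i) = ν)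
    (hf : Measurable (Function.uncurry f)) (hf2 : MemLp (Function.uncurry f) 2 (ν.prod ν)) (n : ℕ) :
    MemLp (linPart ν X f n) 2 P :=
  memLp_finsetSum _ fun k _ => memLp_linPart_term hXm hXν hf hf2 n k

lemma integral_comp_eq
    (hXm : ∀ i, Measurable (X i)) (hXν : ∀ i, P.map (X i) = ν) {a : S → ℝ} (ha : Measurable a)
    (i : ℕ) :
    ∫ ω, a (X i ω) ∂P = ∫ x, a x ∂ν := by
  rw [← hXν i, integral_map (hXm i).aemeasurable ha.aestronglyMeasurable]

lemma integral_linPart_term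
    (hXm : ∀ i, Measurable (X i)) (hXν : ∀ i, P.map (X i) = ν)
    (hf : Measurable (Function.uncurry f)) (hf2 : MemLp (Function.uncurry f) 2 (ν.prod ν))
    (n k : ℕ) :
    ∫ ω, (linEven n (hoeffding1 ν f) (X (2 * k) ω) +
      linOdd n (hoeffding1 ν f) (hoeffding2 ν f) (X (2 * k + 1) ω)) ∂P = 0 := by
  have h1 := memLp_hoeffding1 ν hf hf2
  have h2 := memLp_hoeffding2 ν hf hf2
  have i1 := ((memLp_linEven n h1).comp_measurePreserving
    (measurePreserving_of_map_eq hXm hXν (2 * k))).integrable one_le_two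
  have i2 := ((memLp_linOdd n h1 h2).comp_measurePreserving
    (measurePreserving_of_map_eq hXm hXν (2 * k + 1))).integrable one_le_two
  refine (integral_add i1 i2).trans ?_
  simp only [Function.comp]
  rw [integral_comp_eq hXm hXν (measurable_linEven n (measurable_hoeffding1 ν hf)),
    integral_comp_eq hXm hXν (measurable_linOdd n (measurable_hoeffding1 ν hf)
      (measurable_hoeffding2 ν hf)), integral_linEven n (integral_hoeffding1 hf2),
    integral_linOdd n (h1.integrable one_le_two) (h2.integrable one_le_two)
      (integral_hoeffding1 hf2) (integral_hoeffding2 hf2), add_zero]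

lemma integral_linPart
    (hXm : ∀ i, Measurable (X i)) (hXν : ∀ i, P.map (X i) = ν)
    (hf : Measurable (Function.uncurry f)) (hf2 : MemLp (Function.uncurry f) 2 (ν.prod ν)) (n : ℕ) :
    ∫ ω, linPart ν X f n ω ∂P = 0 := by
  simp only [linPart]
  rw [integral_finsetSum _ fun k _ =>
    (memLp_linPart_term hXm hXν hf hf2 n k).integrable one_le_two]
  exact Finset.sum_eq_zero fun k _ => integral_linPart_term hXm hXν hf hf2 n k

lemma variance_linPart_term
    (hXm : ∀ i, Measurable (X i)) (hXi : iIndepFun X P) (hXν : ∀ i, P.map (X i) = ν)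
    (hf : Measurable (Function.uncurry f)) (hf2 : MemLp (Function.uncurry f) 2 (ν.prod ν))
    (n k : ℕ) :
    Var[fun ω => linEven n (hoeffding1 ν f) (X (2 * k) ω) +
      linOdd n (hoeffding1 ν f) (hoeffding2 ν f) (X (2 * k + 1) ω); P] = linVar ν f n := by
  have h1 := memLp_hoeffding1 ν hf hf2
  have h2 := memLp_hoeffding2 ν hf hf2
  have me := measurable_linEven n (measurable_hoeffding1 ν hf)
  have mo := measurable_linOdd n (measurable_hoeffding1 ν hf) (measurable_hoeffding2 ν hf)
  have hind : IndepFun (linEven n (hoeffding1 ν f) ∘ X (2 * k))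
      (linOdd n (hoeffding1 ν f) (hoeffding2 ν f) ∘ X (2 * k + 1)) P :=
    (hXi.indepFun (by omega : 2 * k ≠ 2 * k + 1)).comp me mo
  have h := hind.variance_add
    ((memLp_linEven n h1).comp_measurePreserving (measurePreserving_of_map_eq hXm hXν (2 * k)))
    ((memLp_linOdd n h1 h2).comp_measurePreserving
      (measurePreserving_of_map_eq hXm hXν (2 * k + 1)))
  rw [linVar]
  refine h.trans ?_
  rw [← variance_map (by rw [hXν]; exact me.aemeasurable) (hXm _).aemeasurable,
    ← variance_map (by rw [hXν]; exact mo.aemeasurable) (hXm _).aemeasurable, hXν, hXν]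

lemma iIndepFun_linPart_term
    (hXm : ∀ i, Measurable (X i)) (hXi : iIndepFun X P) (hf : Measurable (Function.uncurry f))
    (n : ℕ) :
    iIndepFun (fun k ω => linEven n (hoeffding1 ν f) (X (2 * k) ω) +
      linOdd n (hoeffding1 ν f) (hoeffding2 ν f) (X (2 * k + 1) ω)) P := by
  have me := measurable_linEven n (measurable_hoeffding1 ν hf)
  have mo := measurable_linOdd n (measurable_hoeffding1 ν hf) (measurable_hoeffding2 ν hf)
  exact (iIndepFun_pairs hXm hXi).comp (fun _ z => linEven n (hoeffding1 ν f) z.1 +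
    linOdd n (hoeffding1 ν f) (hoeffding2 ν f) z.2) fun _ =>
      (me.comp measurable_fst).add (mo.comp measurable_snd)

lemma integral_sq_linPart
    (hXm : ∀ i, Measurable (X i)) (hXi : iIndepFun X P) (hXν : ∀ i, P.map (X i) = ν)
    (hf : Measurable (Function.uncurry f)) (hf2 : MemLp (Function.uncurry f) 2 (ν.prod ν)) (n : ℕ) :
    ∫ ω, linPart ν X f n ω ^ 2 ∂P = (n / 2 : ℕ) * linVar ν f n := by
  have hmem := memLp_linPart hXm hXν hf hf2 n
  rw [← variance_of_integral_eq_zero hmem.aemeasurable (integral_linPart hXm hXν hf hf2 n)]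
  have h := IndepFun.variance_sum (μ := P) (s := Finset.range (n / 2))
    (X := fun k ω => linEven n (hoeffding1 ν f) (X (2 * k) ω) +
      linOdd n (hoeffding1 ν f) (hoeffding2 ν f) (X (2 * k + 1) ω))
    (fun k _ => memLp_linPart_term hXm hXν hf hf2 n k)
    (fun i _ j _ hij => (iIndepFun_linPart_term hXm hXi hf n).indepFun hij)
  have e : linPart ν X f n = ∑ k ∈ Finset.range (n / 2), fun ω =>
      linEven n (hoeffding1 ν f) (X (2 * k) ω) +
      linOdd n (hoeffding1 ν f) (hoeffding2 ν f) (X (2 * k + 1) ω) := by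
    funext ω; simp [linPart]
  rw [e, h, Finset.sum_congr rfl fun k _ => variance_linPart_term hXm hXi hXν hf hf2 n k]
  simp

/-- Since `i ≠ j`, the index `k` differs from at least one of them, and the kernel is integrated out
in that variable; hence no restriction on `k`. -/
lemma integral_hoeffding12_mul
    (hXm : ∀ i, Measurable (X i)) (hXi : iIndepFun X P) (hXν : ∀ i, P.map (X i) = ν)
    (hf : Measurable (Function.uncurry f)) (hf2 : MemLp (Function.uncurry f) 2 (ν.prod ν))
    {d : S → ℝ} (hd : Measurable d) (hd2 : MemLp d 2 ν) {i j : ℕ}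
    (hij : i ≠ j) (k : ℕ) : ∫ ω, hoeffding12 ν f (X i ω) (X j ω) * d (X k ω) ∂P = 0 := by
  have hm := measurable_hoeffding12 ν hf
  have h12 := memLp_hoeffding12 ν hf hf2
  have hD2 : MemLp (fun ω => d (X k ω)) 2 P :=
    hd2.comp_measurePreserving (measurePreserving_of_map_eq hXm hXν k)
  by_cases hk : k = j
  · have hki : k ≠ i := fun h => hij (h.symm.trans hk)
    exact integral_degenerate_mul_pair_eq_zero hXm hXi hXν
      (G := fun x y => hoeffding12 ν f y x) (hm.comp measurable_swap) (memLp_swap ν h12)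
      (integral_hoeffding12_left hf hf2) hij.symm hki hki
      (D := fun x _ => d x) (hd.comp measurable_fst) hD2
  · exact integral_degenerate_mul_pair_eq_zero hXm hXi hXν hm h12
      (integral_hoeffding12_right hf hf2) hij hk hk
      (D := fun x _ => d x) (hd.comp measurable_fst) hD2

lemma integral_hoeffding12_comp
    (hXm : ∀ i, Measurable (X i)) (hXi : iIndepFun X P) (hXν : ∀ i, P.map (X i) = ν)
    (hf : Measurable (Function.uncurry f)) (hf2 : MemLp (Function.uncurry f) 2 (ν.prod ν)) {i j : ℕ}
    (hij : i ≠ j) :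
    ∫ ω, hoeffding12 ν f (X i ω) (X j ω) ∂P = 0 := by
  -- Orthogonality to the constant `1` is the vanishing of the mean; the index `0` is arbitrary.
  have := integral_hoeffding12_mul hXm hXi hXν hf hf2 (d := fun _ => 1) measurable_const
    (memLp_const 1) hij 0
  simpa using this

lemma variance_hoeffding12
    (hXm : ∀ i, Measurable (X i)) (hXi : iIndepFun X P) (hXν : ∀ i, P.map (X i) = ν)
    (hf : Measurable (Function.uncurry f)) (hf2 : MemLp (Function.uncurry f) 2 (ν.prod ν)) :
    Var[fun ω => hoeffding12 ν f (X 0 ω) (X 1 ω); P] =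
      ∫ p : S × S, hoeffding12 ν f p.1 p.2 ^ 2 ∂(ν.prod ν) := by
  have hmp := map_pair_of_iIndepFun hXm hXi hXν zero_ne_one
  have hm2 : Measurable fun p : S × S => hoeffding12 ν f p.1 p.2 ^ 2 :=
    (measurable_hoeffding12 ν hf).pow_const 2
  rw [variance_of_integral_eq_zero (memLp_kernel_comp hXm hXi hXν
    (memLp_hoeffding12 ν hf hf2) zero_ne_one).aemeasurable
    (integral_hoeffding12_comp hXm hXi hXν hf hf2 zero_ne_one), ← hmp.map_eq,
    integral_map hmp.measurable.aemeasurable hm2.aestronglyMeasurable]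

lemma integral_sq_sum_hoeffding12
    (hXm : ∀ i, Measurable (X i)) (hXi : iIndepFun X P) (hXν : ∀ i, P.map (X i) = ν)
    (hf : Measurable (Function.uncurry f)) (hf2 : MemLp (Function.uncurry f) 2 (ν.prod ν))
    (s : Finset (ℕ × ℕ)) (hs : ∀ q ∈ s, q.1 < q.2)
    (w : ℕ × ℕ → ℝ) :
    ∫ ω, (∑ q ∈ s, w q * hoeffding12 ν f (X q.1 ω) (X q.2 ω)) ^ 2 ∂P =
      (∑ q ∈ s, w q ^ 2) * Var[fun ω => hoeffding12 ν f (X 0 ω) (X 1 ω); P] := by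
  rw [variance_hoeffding12 hXm hXi hXν hf hf2]
  exact integral_sq_sum_degenerate hXm hXi hXν (measurable_hoeffding12 ν hf)
    (memLp_hoeffding12 ν hf hf2) (integral_hoeffding12_right hf hf2)
    (integral_hoeffding12_left hf hf2) s hs w

lemma integral_biAltU_hoeffding12
    (hXm : ∀ i, Measurable (X i)) (hXi : iIndepFun X P) (hXν : ∀ i, P.map (X i) = ν)
    (hf : Measurable (Function.uncurry f)) (hf2 : MemLp (Function.uncurry f) 2 (ν.prod ν)) (n : ℕ) :
    ∫ ω, biAltU X (hoeffding12 ν f) n ω ∂P = 0 := by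
  simp only [biAltU_eq_sum_ltPairs]
  rw [integral_finsetSum _ fun q hq => ((memLp_kernel_comp hXm hXi hXν
    (memLp_hoeffding12 ν hf hf2) (mem_ltPairs.1 hq).1.ne).const_mul _).integrable one_le_two]
  refine Finset.sum_eq_zero fun q hq => ?_
  rw [integral_const_mul, integral_hoeffding12_comp hXm hXi hXν hf hf2 (mem_ltPairs.1 hq).1.ne,
    mul_zero]

lemma integral_sq_biAltU_hoeffding12
    (hXm : ∀ i, Measurable (X i)) (hXi : iIndepFun X P) (hXν : ∀ i, P.map (X i) = ν)
    (hf : Measurable (Function.uncurry f)) (hf2 : MemLp (Function.uncurry f) 2 (ν.prod ν)) (n : ℕ) :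
    ∫ ω, biAltU X (hoeffding12 ν f) n ω ^ 2 ∂P =
      n * (n - 1) / 2 * Var[fun ω => hoeffding12 ν f (X 0 ω) (X 1 ω); P] := by
  simp only [biAltU_eq_sum_ltPairs]
  rw [integral_sq_sum_hoeffding12 hXm hXi hXν hf hf2 _ (fun q hq => (mem_ltPairs.1 hq).1)
    fun q => (-1) ^ (q.1 + q.2), ← card_ltPairs]
  simp [← pow_mul, mul_comm _ 2]

/-- Each term of the linear part involves one variable only and is therefore orthogonal to each
degenerate term; the variance has no mixed contribution. -/
lemma integral_biAltU_hoeffding12_mul_linPart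
    (hXm : ∀ i, Measurable (X i)) (hXi : iIndepFun X P) (hXν : ∀ i, P.map (X i) = ν)
    (hf : Measurable (Function.uncurry f)) (hf2 : MemLp (Function.uncurry f) 2 (ν.prod ν)) (n : ℕ) :
    ∫ ω, biAltU X (hoeffding12 ν f) n ω * linPart ν X f n ω ∂P = 0 := by
  have h1 := memLp_hoeffding1 ν hf hf2
  have h2 := memLp_hoeffding2 ν hf hf2
  have h12 := memLp_hoeffding12 ν hf hf2
  have me := measurable_linEven n (measurable_hoeffding1 ν hf)
  have mo := measurable_linOdd n (measurable_hoeffding1 ν hf) (measurable_hoeffding2 ν hf)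
  have le := memLp_linEven n h1
  have lo := memLp_linOdd n h1 h2
  simp only [biAltU_eq_sum_ltPairs, linPart, Finset.sum_mul_sum]
  have hi : ∀ q ∈ ltPairs n, ∀ k, Integrable (fun ω => (-1 : ℝ) ^ (q.1 + q.2) *
      hoeffding12 ν f (X q.1 ω) (X q.2 ω) * (linEven n (hoeffding1 ν f) (X (2 * k) ω) +
      linOdd n (hoeffding1 ν f) (hoeffding2 ν f) (X (2 * k + 1) ω))) P := fun q hq k =>
    ((memLp_kernel_comp hXm hXi hXν h12 (mem_ltPairs.1 hq).1.ne).const_mul _).integrable_mul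
      (memLp_linPart_term hXm hXν hf hf2 n k)
  rw [integral_finsetSum _ fun q hq => integrable_finsetSum _ fun k _ => hi q hq k]
  refine Finset.sum_eq_zero fun q hq => ?_
  have hq' := (mem_ltPairs.1 hq).1.ne
  rw [integral_finsetSum _ fun k _ => hi q hq k]
  refine Finset.sum_eq_zero fun k _ => ?_
  have hk := memLp_kernel_comp hXm hXi hXν h12 hq'
  have i1 : Integrable (fun ω => hoeffding12 ν f (X q.1 ω) (X q.2 ω) *
      linEven n (hoeffding1 ν f) (X (2 * k) ω)) P :=
    hk.integrable_mul (le.comp_measurePreserving (measurePreserving_of_map_eq hXm hXν (2 * k)))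
  have i2 : Integrable (fun ω => hoeffding12 ν f (X q.1 ω) (X q.2 ω) *
      linOdd n (hoeffding1 ν f) (hoeffding2 ν f) (X (2 * k + 1) ω)) P :=
    hk.integrable_mul (lo.comp_measurePreserving (measurePreserving_of_map_eq hXm hXν (2 * k + 1)))
  simp only [mul_assoc, integral_const_mul]
  simp only [mul_add]
  rw [integral_add i1 i2, integral_hoeffding12_mul hXm hXi hXν hf hf2 me le hq',
    integral_hoeffding12_mul hXm hXi hXν hf hf2 mo lo hq']
  simp

lemma integral_biAltU
    (hXm : ∀ i, Measurable (X i)) (hXi : iIndepFun X P) (hXν : ∀ i, P.map (X i) = ν)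
    (hf : Measurable (Function.uncurry f)) (hf2 : MemLp (Function.uncurry f) 2 (ν.prod ν)) (n : ℕ) :
    ∫ ω, biAltU X f n ω ∂P = -((n / 2 : ℕ) : ℝ) * kernelMean ν f := by
  have hQ := (memLp_biAltU hXm hXi hXν (memLp_hoeffding12 ν hf hf2) n).integrable one_le_two
  have hL := (memLp_linPart hXm hXν hf hf2 n).integrable one_le_two
  have e : biAltU X f n = fun ω => biAltU X (hoeffding12 ν f) n ω - linPart ν X f n ω -
      ((n / 2 : ℕ) : ℝ) * kernelMean ν f := funext fun ω => biAltU_hoeffding X ν f n ω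
  have hQL : Integrable (fun ω => biAltU X (hoeffding12 ν f) n ω - linPart ν X f n ω) P :=
    hQ.sub hL
  simp only [e]
  rw [integral_sub hQL (integrable_const _), integral_sub hQ hL,
    integral_biAltU_hoeffding12 hXm hXi hXν hf hf2, integral_linPart hXm hXν hf hf2]
  simp

lemma biAltU_sub_integral
    (hXm : ∀ i, Measurable (X i)) (hXi : iIndepFun X P) (hXν : ∀ i, P.map (X i) = ν)
    (hf : Measurable (Function.uncurry f)) (hf2 : MemLp (Function.uncurry f) 2 (ν.prod ν)) (n : ℕ)
    (ω : Ω) :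
    biAltU X f n ω - ∫ ω, biAltU X f n ω ∂P =
      biAltU X (hoeffding12 ν f) n ω - linPart ν X f n ω := by
  rw [integral_biAltU hXm hXi hXν hf hf2, biAltU_hoeffding X ν f n ω, linPart]
  ring

/-- The exact variance of the bi-alternating U-statistic. -/
lemma variance_biAltU
    (hXm : ∀ i, Measurable (X i)) (hXi : iIndepFun X P) (hXν : ∀ i, P.map (X i) = ν)
    (hf : Measurable (Function.uncurry f)) (hf2 : MemLp (Function.uncurry f) 2 (ν.prod ν)) (n : ℕ) :
    Var[biAltU X f n; P] =
      n * (n - 1) / 2 * Var[fun ω => hoeffding12 ν f (X 0 ω) (X 1 ω); P] +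
        (n / 2 : ℕ) * linVar ν f n := by
  have hQ := memLp_biAltU hXm hXi hXν (memLp_hoeffding12 ν hf hf2) n
  have hL := memLp_linPart hXm hXν hf hf2 n
  rw [variance_eq_integral (memLp_biAltU hXm hXi hXν hf2 n).aemeasurable]
  simp only [biAltU_sub_integral hXm hXi hXν hf hf2]
  have e : ∀ ω, (biAltU X (hoeffding12 ν f) n ω - linPart ν X f n ω) ^ 2 =
      biAltU X (hoeffding12 ν f) n ω ^ 2 + linPart ν X f n ω ^ 2 -
        2 * (biAltU X (hoeffding12 ν f) n ω * linPart ν X f n ω) := fun ω => by ring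
  simp only [e]
  have i1 : Integrable (fun ω => biAltU X (hoeffding12 ν f) n ω ^ 2 + linPart ν X f n ω ^ 2) P :=
    hQ.integrable_sq.add hL.integrable_sq
  have i2 : Integrable (fun ω => 2 * (biAltU X (hoeffding12 ν f) n ω * linPart ν X f n ω)) P :=
    (hQ.integrable_mul hL).const_mul 2
  rw [integral_sub i1 i2, integral_add hQ.integrable_sq hL.integrable_sq, integral_const_mul]
  have h0 := integral_biAltU_hoeffding12_mul_linPart hXm hXi hXν hf hf2 n
  rw [integral_sq_biAltU_hoeffding12 hXm hXi hXν hf hf2, integral_sq_linPart hXm hXi hXν hf hf2]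
  simp only [h0, mul_zero, sub_zero]

end Moments

/-! ### Convergence in distribution of real random variables -/

section Convergence

variable {Ω Ω' : Type*} [MeasurableSpace Ω] [MeasurableSpace Ω'] {P : Measure Ω}
  {P' : Measure Ω'}

lemma toReal_eLpNorm_two {g : Ω → ℝ} (hg : MemLp g 2 P) :
    (eLpNorm g 2 P).toReal = √(∫ ω, g ω ^ 2 ∂P) := by
  have h := norm_sq_Lp_two P hg
  rw [Lp.norm_toLp] at h
  simp only [Real.norm_eq_abs, sq_abs] at h
  rw [← h, Real.sqrt_sq ENNReal.toReal_nonneg]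

lemma tendsto_eLpNorm_two_zero {ι : Type*} {l : Filter ι} {Y : ι → Ω → ℝ}
    (hY : ∀ n, MemLp (Y n) 2 P) (h : Tendsto (fun n => ∫ ω, Y n ω ^ 2 ∂P) l (𝓝 0)) :
    Tendsto (fun n => eLpNorm (Y n) 2 P) l (𝓝 0) := by
  rw [← ENNReal.tendsto_toReal_iff (fun n => (hY n).2.ne) ENNReal.zero_ne_top]
  simp only [toReal_eLpNorm_two (hY _), ENNReal.toReal_zero]
  simpa using h.sqrt

lemma tendstoInMeasure_zero_of_integral_sq {ι : Type*} {l : Filter ι} {Y : ι → Ω → ℝ}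
    (hY : ∀ n, MemLp (Y n) 2 P) (h : Tendsto (fun n => ∫ ω, Y n ω ^ 2 ∂P) l (𝓝 0)) :
    TendstoInMeasure P Y l (fun _ => 0) := by
  refine tendstoInMeasure_of_tendsto_eLpNorm (p := 2) two_ne_zero (fun n => (hY n).1)
    aestronglyMeasurable_const ?_
  have e : ∀ n, Y n - (fun _ => (0 : ℝ)) = Y n := fun n => by ext; simp
  simp only [e]
  exact tendsto_eLpNorm_two_zero hY h

lemma charFun_map_real {Y : Ω → ℝ} (hY : AEMeasurable Y P) (t : ℝ) :
    charFun (P.map Y) t = ∫ ω, Complex.exp ((t * Y ω : ℝ) * Complex.I) ∂P := by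
  rw [charFun_apply_real, integral_map hY (by fun_prop)]
  simp only [Complex.ofReal_mul]

variable [IsProbabilityMeasure P] [IsProbabilityMeasure P']

lemma tendstoInDistribution_of_tendsto_charFun {Y : ℕ → Ω → ℝ} {W : Ω' → ℝ}
    (hY : ∀ n, AEMeasurable (Y n) P) (hW : AEMeasurable W P')
    (h : ∀ t : ℝ, Tendsto (fun n => charFun (P.map (Y n)) t) atTop (𝓝 (charFun (P'.map W) t))) :
    TendstoInDistribution Y atTop W (fun _ => P) P' where
  forall_aemeasurable := hY
  aemeasurable_limit := hW
  tendsto := ProbabilityMeasure.tendsto_iff_tendsto_charFun.2 fun t => h t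

lemma tendsto_charFun_of_tendstoInDistribution {E : Type*} [NormedAddCommGroup E]
    [InnerProductSpace ℝ E] [FiniteDimensional ℝ E] [MeasurableSpace E] [BorelSpace E]
    {Y : ℕ → Ω → E} {W : Ω' → E}
    (h : TendstoInDistribution Y atTop W (fun _ => P) P') (t : E) :
    Tendsto (fun n => charFun (P.map (Y n)) t) atTop (𝓝 (charFun (P'.map W) t)) :=
  ProbabilityMeasure.tendsto_iff_tendsto_charFun.1 h.tendsto t

lemma tendstoInMeasure_const_of_tendsto {c : ℕ → ℝ} {a : ℝ} (h : Tendsto c atTop (𝓝 a)) :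
    TendstoInMeasure P (fun n _ => c n) atTop (fun _ => a) :=
  tendstoInMeasure_of_tendsto_ae (fun _ => aestronglyMeasurable_const) (ae_of_all _ fun _ => h)

lemma MeasureTheory.TendstoInDistribution.mul_of_tendsto {Y : ℕ → Ω → ℝ} {W : Ω' → ℝ} {c : ℕ → ℝ}
    {a : ℝ}
    (h : TendstoInDistribution Y atTop W (fun _ => P) P') (hc : Tendsto c atTop (𝓝 a)) :
    TendstoInDistribution (fun n ω => c n * Y n ω) atTop (fun ω => a * W ω) (fun _ => P) P' :=
  h.continuous_comp_prodMk_of_tendstoInMeasure_const (g := fun x : ℝ × ℝ => x.2 * x.1)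
    (by fun_prop) (tendstoInMeasure_const_of_tendsto hc) fun _ => aemeasurable_const

/-- Slutsky's principle: an error vanishing in L² vanishes in probability and does not affect limits
in distribution. -/
lemma MeasureTheory.TendstoInDistribution.of_integral_sq_sub {Y Y' : ℕ → Ω → ℝ} {W : Ω' → ℝ}
    (h : TendstoInDistribution Y atTop W (fun _ => P) P') (hY : ∀ n, MemLp (Y n) 2 P)
    (hY' : ∀ n, MemLp (Y' n) 2 P)
    (hd : Tendsto (fun n => ∫ ω, (Y' n ω - Y n ω) ^ 2 ∂P) atTop (𝓝 0)) :
    TendstoInDistribution Y' atTop W (fun _ => P) P' := by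
  refine tendstoInDistribution_of_tendstoInMeasure_sub Y' W h ?_ fun n => (hY' n).aemeasurable
  exact tendstoInMeasure_zero_of_integral_sq (fun n => (hY' n).sub (hY n)) hd

lemma norm_exp_mul_I_sub_le (a b : ℝ) :
    ‖Complex.exp (a * Complex.I) - Complex.exp (b * Complex.I)‖ ≤ |a - b| := by
  have e : Complex.exp (a * Complex.I) - Complex.exp (b * Complex.I) =
      Complex.exp (b * Complex.I) * (Complex.exp (Complex.I * ((a - b : ℝ) : ℂ)) - 1) := by
    rw [mul_sub, mul_one, ← Complex.exp_add]
    congr 2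
    push_cast; ring
  rw [e, norm_mul, Complex.norm_exp_ofReal_mul_I, one_mul]
  exact Real.norm_exp_I_mul_ofReal_sub_one_le

lemma integrable_exp_mul_I {Y : Ω → ℝ} (hY : AEMeasurable Y P) :
    Integrable (fun ω => Complex.exp ((Y ω : ℝ) * Complex.I)) P := by
  refine Integrable.of_bound (C := 1) ?_ (ae_of_all _ fun ω => ?_)
  · exact (Complex.measurable_exp.comp_aemeasurable
      ((Complex.measurable_ofReal.comp_aemeasurable hY).mul_const _)).aestronglyMeasurable
  · rw [Complex.norm_exp_ofReal_mul_I]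

/-- The map x ↦ exp(itx) is |t|-Lipschitz, and on a probability space the L¹ distance is at most the
L² distance. This bound makes truncation uniform in `n`. -/
lemma norm_charFun_sub_le {Y Y' : Ω → ℝ} (hY : AEMeasurable Y P) (hY' : AEMeasurable Y' P)
    (hd : MemLp (fun ω => Y ω - Y' ω) 2 P) (t : ℝ) :
    ‖charFun (P.map Y) t - charFun (P.map Y') t‖ ≤
      |t| * (eLpNorm (fun ω => Y ω - Y' ω) 2 P).toReal := by
  rw [charFun_map_real hY, charFun_map_real hY', ← integral_sub
    (integrable_exp_mul_I (hY.const_mul t)) (integrable_exp_mul_I (hY'.const_mul t))]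
  have h1 : ‖∫ ω, Complex.exp ((t * Y ω : ℝ) * Complex.I) -
      Complex.exp ((t * Y' ω : ℝ) * Complex.I) ∂P‖ ≤ ∫ ω, |t| * |Y ω - Y' ω| ∂P := by
    refine norm_integral_le_of_norm_le ((hd.integrable one_le_two).abs.const_mul _)
      (ae_of_all _ fun ω => ?_)
    refine (norm_exp_mul_I_sub_le _ _).trans_eq ?_
    rw [← mul_sub, abs_mul]
  refine h1.trans ?_
  rw [integral_const_mul]
  refine mul_le_mul_of_nonneg_left ?_ (abs_nonneg t)
  have h2 : ∫ ω, |Y ω - Y' ω| ∂P = (eLpNorm (fun ω => Y ω - Y' ω) 1 P).toReal := by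
    rw [eLpNorm_one_eq_lintegral_enorm,
      ← integral_norm_eq_lintegral_enorm hd.1]
    simp only [Real.norm_eq_abs]
  rw [h2]
  exact ENNReal.toReal_mono hd.2.ne
    (eLpNorm_le_eLpNorm_of_exponent_le one_le_two hd.1)

end Convergence

/-! ### Sums of independent variables converging in `L²` -/

section L2Sums

variable {Ω ι : Type*} [MeasurableSpace Ω] {P : Measure Ω} [IsProbabilityMeasure P]

/-- A square summable combination of uncorrelated standardized variables converges in `L²`. -/
lemma exists_isL2Sum {ξ : ι → Ω → ℝ} (hξ : ∀ r, MemLp (ξ r) 2 P) (h0 : ∀ r, ∫ ω, ξ r ω ∂P = 0)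
    (h1 : ∀ r, ∫ ω, ξ r ω ^ 2 ∂P = 1) (hort : ∀ r s, r ≠ s → ∫ ω, ξ r ω * ξ s ω ∂P = 0)
    {c : ι → ℝ} (hc : Summable fun r => c r ^ 2) :
    ∃ W : Ω → ℝ, IsL2Sum P (fun r ω => c r * ξ r ω) W ∧ ∫ ω, W ω ∂P = 0 ∧
      Var[W; P] = ∑' r, c r ^ 2 := by
  let z : ι → Lp ℝ 2 P := fun r => (hξ r).toLp
  have hz : ∀ r, z r =ᵐ[P] ξ r := fun r => (hξ r).coeFn_toLp
  have hinner : ∀ r s, inner ℝ (z r) (z s) = ∫ ω, ξ r ω * ξ s ω ∂P := fun r s => by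
    rw [L2.inner_def]
    refine integral_congr_ae ?_
    filter_upwards [hz r, hz s] with ω h1 h2
    rw [h1, h2, RCLike.inner_apply', conj_trivial]
  have ho : Orthonormal ℝ z := by
    refine ⟨fun r => ?_, fun r s hrs => (hinner r s).trans (hort r s hrs)⟩
    have h2 : ‖z r‖ ^ 2 = 1 := by
      rw [← real_inner_self_eq_norm_sq, hinner]
      simpa only [sq] using h1 r
    nlinarith [norm_nonneg (z r)]
  have hs : Summable fun r => c r • z r := by
    have := (ho.orthogonalFamily).summable_iff_norm_sq_summable c
    exact this.2 (by simpa using hc)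
  obtain ⟨T, hT⟩ := hs
  have hcoe : ∀ s : Finset ι, (fun ω => ∑ r ∈ s, c r * ξ r ω) =ᵐ[P]
      (∑ r ∈ s, c r • z r : Lp ℝ 2 P) := by
    intro s
    have h2 : ∀ᵐ ω ∂P, ∀ r ∈ s, (c r • z r : Lp ℝ 2 P) ω = c r * ξ r ω :=
      (ae_ball_iff s.countable_toSet).2 fun r _ => by
        filter_upwards [Lp.coeFn_smul (c r) (z r), hz r] with ω e1 e2
        rw [e1, Pi.smul_apply, e2, smul_eq_mul]
    filter_upwards [Lp.coeFn_finsetSum (s := s) (fun r => c r • z r), h2] with ω e1 e2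
    rw [e1, Finset.sum_apply]
    exact (Finset.sum_congr rfl e2).symm
  have hWn : ‖T‖ ^ 2 = ∑' r, c r ^ 2 := by
    rw [← real_inner_self_eq_norm_sq]
    have h3 := hT.mapL (innerSL ℝ T)
    simp only [innerSL_apply_apply, inner_smul_right] at h3
    have h4 : ∀ r, inner ℝ T (z r) = c r := fun r => by
      rw [real_inner_comm]
      have h5 := (hT.mapL (innerSL ℝ (z r))).unique (hasSum_single r fun k hk => by
        rw [innerSL_apply_apply, inner_smul_right, ho.2 hk.symm, mul_zero])
      rw [innerSL_apply_apply, innerSL_apply_apply, inner_smul_right,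
        real_inner_self_eq_norm_sq, ho.1 r] at h5
      simpa using h5
    simp only [h4, ← sq] at h3
    exact h3.tsum_eq.symm
  -- The mean is the inner product with the constant `1`, a continuous functional that vanishes on
  -- every term of the series.
  have hmean : ∫ ω, T ω ∂P = 0 := by
    let o : Lp ℝ 2 P := (memLp_const (1 : ℝ)).toLp _
    have ho' : o =ᵐ[P] fun _ => (1 : ℝ) := MemLp.coeFn_toLp _
    have h6 : ∀ u : Lp ℝ 2 P, inner ℝ o u = ∫ ω, u ω ∂P := fun u => by
      rw [L2.inner_def]
      refine integral_congr_ae ?_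
      filter_upwards [ho'] with ω e
      rw [e, RCLike.inner_apply']; simp
    rw [← h6]
    refine (hT.mapL (innerSL ℝ o)).unique ?_
    have h7 : ∀ r, innerSL ℝ o (c r • z r) = 0 := fun r => by
      rw [innerSL_apply_apply, inner_smul_right, h6, integral_congr_ae (hz r), h0, mul_zero]
    simp only [h7]
    exact hasSum_zero
  refine ⟨T, ⟨Lp.memLp T, ?_⟩, hmean, ?_⟩
  · have h8 : ∀ s : Finset ι, eLpNorm (fun ω => ∑ r ∈ s, c r * ξ r ω - T ω) 2 P =
        ‖(∑ r ∈ s, c r • z r) - T‖ₑ := fun s => by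
      rw [Lp.enorm_def]
      refine eLpNorm_congr_ae ?_
      filter_upwards [hcoe s, Lp.coeFn_sub (∑ r ∈ s, c r • z r) T] with ω e1 e2
      rw [e2, Pi.sub_apply, e1]
    simp only [h8]
    have h9 : Tendsto (fun s : Finset ι => ∑ r ∈ s, c r • z r) atTop (𝓝 T) := hT
    have h10 := (tendsto_iff_edist_tendsto_0.1 h9)
    simpa only [edist_eq_enorm_sub] using h10
  · rw [variance_of_integral_eq_zero (Lp.memLp T).aemeasurable hmean, ← hWn]
    have := norm_sq_Lp_two P (Lp.memLp T)
    rw [Lp.toLp_coeFn] at this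
    simpa only [Real.norm_eq_abs, sq_abs] using this.symm

/-- The characteristic function of an `L²` sum of independent variables is a product. -/
lemma hasProd_charFun_of_isL2Sum {Z : ι → Ω → ℝ} {W : Ω → ℝ} (hZ : ∀ r, AEMeasurable (Z r) P)
    (hind : iIndepFun Z P) (hZ2 : ∀ r, MemLp (Z r) 2 P) (hW : IsL2Sum P Z W) (t : ℝ) :
    HasProd (fun r => charFun (P.map (Z r)) t) (charFun (P.map W) t) := by
  have e : ∀ s : Finset ι, ∏ r ∈ s, charFun (P.map (Z r)) t =
      charFun (P.map fun ω => ∑ r ∈ s, Z r ω) t := fun s => by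
    rw [iIndepFun.charFun_map_fun_finsetSum_eq_prod (fun r _ => hZ r) (hind.restrict _),
      Finset.prod_apply]
  change Tendsto (fun s : Finset ι => ∏ r ∈ s, charFun (P.map (Z r)) t) atTop _
  simp only [e]
  rw [tendsto_iff_norm_sub_tendsto_zero]
  have hm : ∀ s : Finset ι, MemLp (fun ω => ∑ r ∈ s, Z r ω) 2 P := fun s =>
    memLp_finsetSum _ fun r _ => hZ2 r
  have hd : ∀ s : Finset ι, MemLp (fun ω => ∑ r ∈ s, Z r ω - W ω) 2 P := fun s =>
    (hm s).sub hW.1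
  refine squeeze_zero (fun _ => norm_nonneg _)
    (fun s => norm_charFun_sub_le (hm s).aemeasurable hW.1.aemeasurable (hd s) t) ?_
  have := (ENNReal.tendsto_toReal_iff (fun s => (hd s).2.ne) ENNReal.zero_ne_top).2 hW.2
  simpa using this.const_mul |t|

end L2Sums

/-! ### Centered squares of standard normal variables -/

section GaussianChaos

/-- Evenness reduces the integral to a half-line Gamma integral, with `Γ(5/2) = (3/4)√π`. It
provides the variance `2` of a centred squared normal variable. -/
lemma integral_pow_four_gaussianReal : ∫ x, x ^ 4 ∂(gaussianReal 0 1) = 3 := by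
  rw [integral_gaussianReal_eq_integral_smul one_ne_zero]
  have e : ∀ x : ℝ, gaussianPDFReal 0 1 x • x ^ 4 =
      (√(2 * Real.pi))⁻¹ * (|x| ^ (4 : ℝ) * Real.exp (-(1 / 2) * |x| ^ (2 : ℝ))) := fun x => by
    simp only [gaussianPDFReal]
    rw [Real.rpow_two, sq_abs, show (4 : ℝ) = ((4 : ℕ) : ℝ) by norm_num,
      Real.rpow_natCast, pow_abs, abs_of_nonneg (by positivity : (0 : ℝ) ≤ x ^ 4), smul_eq_mul]
    rw [show -(x - 0) ^ 2 / (2 * ((1 : NNReal) : ℝ)) = -(1 / 2) * x ^ 2 by push_cast; ring]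
    push_cast
    ring_nf
  simp only [e]
  rw [integral_const_mul, integral_comp_abs (f := fun x : ℝ => x ^ (4 : ℝ) *
    Real.exp (-(1 / 2) * x ^ (2 : ℝ))), integral_rpow_mul_exp_neg_mul_rpow two_pos (by norm_num)
    (by norm_num)]
  have hG : Real.Gamma ((4 + 1) / 2) = 3 / 4 * √Real.pi := by
    rw [show ((4 : ℝ) + 1) / 2 = (1 / 2 + 1) + 1 by norm_num, Real.Gamma_add_one (by norm_num),
      Real.Gamma_add_one (by norm_num), Real.Gamma_one_half_eq]
    ring
  have hp : (1 / 2 : ℝ) ^ (-(4 + 1) / 2 : ℝ) = 4 * √2 := by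
    rw [show (1 / 2 : ℝ) = 2⁻¹ by norm_num, Real.inv_rpow (by norm_num), ← Real.rpow_neg
      (by norm_num), show -(-(4 + 1) / 2 : ℝ) = ((2 : ℕ) : ℝ) + 1 / 2 by norm_num,
      Real.rpow_add two_pos, Real.rpow_natCast, ← Real.sqrt_eq_rpow]
    norm_num
  rw [hG, hp, Real.sqrt_mul (by norm_num)]
  have h1 : √2 * √Real.pi ≠ 0 := by positivity
  field_simp

variable {Ω : Type*} [MeasurableSpace Ω] {P : Measure Ω} {ζ : Ω → ℝ}

lemma integral_comp_of_map_eq {A E : Type*} [MeasurableSpace A] [NormedAddCommGroup E]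
    [NormedSpace ℝ E] {Y : Ω → A} {ρ : Measure A} (hY : Measurable Y) (hρ : P.map Y = ρ)
    {g : A → E} (hg : AEStronglyMeasurable g ρ) : ∫ ω, g (Y ω) ∂P = ∫ x, g x ∂ρ := by
  subst hρ
  exact (integral_map hY.aemeasurable hg).symm

lemma memLp_sq_sub_one_gaussianReal :
    MemLp (fun x : ℝ => (√2)⁻¹ * (x ^ 2 - 1)) 2 (gaussianReal 0 1) := by
  refine MemLp.const_mul (MemLp.sub ?_ (memLp_const 1)) _
  refine (memLp_two_iff_integrable_sq (by fun_prop)).2 ?_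
  have := (memLp_id_gaussianReal (μ := 0) (v := 1) 4).integrable_norm_pow (by norm_num)
  refine this.congr (ae_of_all _ fun x => ?_)
  simp only [id, Real.norm_eq_abs, ← pow_mul]
  exact (Even.pow_abs (by decide) x)

lemma integral_sq_gaussianReal : ∫ x, x ^ 2 ∂(gaussianReal 0 1) = 1 := by
  have := variance_id_gaussianReal (μ := 0) (v := 1)
  rw [variance_of_integral_eq_zero aemeasurable_id (by simp)] at this
  simpa using this

lemma integral_sq_sub_one_gaussianReal :
    ∫ x : ℝ, (√2)⁻¹ * (x ^ 2 - 1) ∂(gaussianReal 0 1) = 0 := by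
  have h2 : Integrable (fun x : ℝ => x ^ 2) (gaussianReal 0 1) := by
    simpa using (memLp_id_gaussianReal (μ := 0) (v := 1) 2).integrable_sq
  rw [integral_const_mul, integral_sub h2 (integrable_const _), integral_sq_gaussianReal]
  simp

lemma integral_sq_sq_sub_one_gaussianReal :
    ∫ x : ℝ, ((√2)⁻¹ * (x ^ 2 - 1)) ^ 2 ∂(gaussianReal 0 1) = 1 := by
  have h2 : Integrable (fun x : ℝ => x ^ 2) (gaussianReal 0 1) := by
    simpa using (memLp_id_gaussianReal (μ := 0) (v := 1) 2).integrable_sq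
  have h4 : Integrable (fun x : ℝ => x ^ 4) (gaussianReal 0 1) := by
    refine ((memLp_id_gaussianReal (μ := 0) (v := 1) 4).integrable_norm_pow
      (by norm_num)).congr (ae_of_all _ fun x => ?_)
    simp only [id, Real.norm_eq_abs]
    exact (Even.pow_abs (by decide) x)
  have e : ∀ x : ℝ, ((√2)⁻¹ * (x ^ 2 - 1)) ^ 2 = 2⁻¹ * (x ^ 4 - (2 * x ^ 2 - 1)) := fun x => by
    rw [mul_pow, inv_pow, Real.sq_sqrt two_pos.le]; ring
  simp only [e]
  rw [integral_const_mul, integral_sub h4 (g := fun x : ℝ => 2 * x ^ 2 - 1)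
    ((h2.const_mul 2).sub (integrable_const _)),
    integral_sub (h2.const_mul 2) (integrable_const _), integral_const_mul,
    integral_pow_four_gaussianReal, integral_sq_gaussianReal]
  norm_num

/-- The characteristic function of `(ζ² - 1) / 2` for a standard normal variable `ζ`. -/
noncomputable def chaosChar (x : ℝ) : ℂ :=
  ∫ y : ℝ, Complex.exp ((x * (1 / 2 * (y ^ 2 - 1)) : ℝ) * Complex.I) ∂(gaussianReal 0 1)

lemma charFun_map_chaos (hζ : Measurable ζ) (hζl : P.map ζ = gaussianReal 0 1) (a t : ℝ) :
    charFun (P.map fun ω => 1 / 2 * a * (ζ ω ^ 2 - 1)) t = chaosChar (a * t) := by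
  rw [charFun_map_real (by fun_prop), chaosChar, ← integral_comp_of_map_eq hζ hζl (by fun_prop)]
  congr 1; ext ω; congr 3; ring

/-- The characteristic function itself contains a square root of `1 - i x`. Squaring avoids the
choice of a branch, and squares suffice because the eigenvalues behind a stochastic area come in
equal couples. -/
lemma chaosChar_sq (x : ℝ) :
    chaosChar x ^ 2 = Complex.exp (-x * Complex.I) / (1 - x * Complex.I) := by
  rw [chaosChar, integral_gaussianReal_eq_integral_smul one_ne_zero]
  have e : ∀ y : ℝ, gaussianPDFReal 0 1 y •
      Complex.exp ((x * (1 / 2 * (y ^ 2 - 1)) : ℝ) * Complex.I) =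
      ((√(2 * Real.pi))⁻¹ : ℝ) * Complex.exp (-(x / 2) * Complex.I) *
        Complex.exp (-((1 - x * Complex.I) / 2) * (y : ℂ) ^ 2) := fun y => by
    simp only [gaussianPDFReal]
    rw [Complex.real_smul, mul_assoc _ _ (Complex.exp (-((1 - x * Complex.I) / 2) * (y : ℂ) ^ 2)),
      ← Complex.exp_add, Complex.ofReal_mul, Complex.ofReal_exp, mul_assoc, ← Complex.exp_add]
    push_cast
    rw [mul_one]
    congr 2
    ring
  simp only [e]
  have hre : 0 < ((1 - x * Complex.I) / 2 : ℂ).re := by simp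
  rw [integral_const_mul, integral_gaussian_complex hre, mul_pow, mul_pow, ← Complex.exp_nat_mul,
    one_div, Complex.cpow_ofNat_inv_pow, ← Complex.ofReal_pow, inv_pow,
    Real.sq_sqrt (by positivity)]
  have hne : (1 - x * Complex.I : ℂ) ≠ 0 := fun h => by simp [h] at hre
  have hpi : (Real.pi : ℂ) ≠ 0 := by exact_mod_cast Real.pi_ne_zero
  have e3 : ((2 : ℕ) : ℂ) * (-(x / 2) * Complex.I) = -x * Complex.I := by push_cast; ring
  rw [e3]
  push_cast
  field_simp

/-- For opposite arguments the phases cancel; what remains is one factor of the product for `1 /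
cosh`. -/
lemma chaosChar_sq_mul_chaosChar_neg_sq (x : ℝ) :
    chaosChar x ^ 2 * chaosChar (-x) ^ 2 = ((1 + x ^ 2 : ℝ) : ℂ)⁻¹ := by
  rw [chaosChar_sq, chaosChar_sq, div_mul_div_comm, ← Complex.exp_add]
  have e1 : -(x : ℂ) * Complex.I + -((-x : ℝ) : ℂ) * Complex.I = 0 := by push_cast; ring
  have e2 : (1 - x * Complex.I) * (1 - ((-x : ℝ) : ℂ) * Complex.I) = ((1 + x ^ 2 : ℝ) : ℂ) := by
    push_cast
    linear_combination -(x : ℂ) ^ 2 * Complex.I_sq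
  rw [e1, e2, Complex.exp_zero, one_div]

variable [IsProbabilityMeasure P]

/-- The variables `(ζ ^ 2 - 1) / √2` are standardized and, by independence, orthogonal, so the
series converges in L². The last conclusion supplies convergence of the infinite products without
any estimate of their factors. -/
lemma exists_isL2Sum_chaos {ι : Type*} {ζ : ι → Ω → ℝ} (hζ : ∀ r, Measurable (ζ r))
    (hind : iIndepFun ζ P) (hl : ∀ r, P.map (ζ r) = gaussianReal 0 1) {c : ι → ℝ}
    (hc : Summable fun r => c r ^ 2) :
    ∃ W : Ω → ℝ, IsL2Sum P (fun r ω => 1 / 2 * c r * (ζ r ω ^ 2 - 1)) W ∧ ∫ ω, W ω ∂P = 0 ∧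
      Var[W; P] = 1 / 2 * ∑' r, c r ^ 2 ∧
      ∀ t : ℝ, HasProd (fun r => chaosChar (c r * t)) (charFun (P.map W) t) := by
  let g : ℝ → ℝ := fun x => (√2)⁻¹ * (x ^ 2 - 1)
  have hg : Measurable g := by fun_prop
  have hmem : ∀ r, MemLp (fun ω => g (ζ r ω)) 2 P := fun r => by
    have := memLp_sq_sub_one_gaussianReal
    rw [← hl r] at this
    exact this.comp_of_map (hζ r).aemeasurable
  have h0 : ∀ r, ∫ ω, g (ζ r ω) ∂P = 0 := fun r => by
    rw [integral_comp_of_map_eq (hζ r) (hl r) hg.aestronglyMeasurable]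
    exact integral_sq_sub_one_gaussianReal
  have h1 : ∀ r, ∫ ω, g (ζ r ω) ^ 2 ∂P = 1 := fun r => by
    rw [integral_comp_of_map_eq (g := fun x => g x ^ 2) (hζ r) (hl r)
      (hg.pow_const 2).aestronglyMeasurable]
    exact integral_sq_sq_sub_one_gaussianReal
  have hort : ∀ r s, r ≠ s → ∫ ω, g (ζ r ω) * g (ζ s ω) ∂P = 0 := fun r s hrs => by
    have := ((hind.indepFun hrs).comp hg hg).integral_fun_mul_eq_mul_integral
      (hmem r).1 (hmem s).1
    simp only [Function.comp] at this
    rw [this, h0, zero_mul]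
  have hsum : Summable fun r => ((√2)⁻¹ * c r) ^ 2 := by
    simp only [mul_pow]
    exact hc.mul_left _
  obtain ⟨W, hW, hW0, hWv⟩ := exists_isL2Sum hmem h0 h1 hort hsum
  have h22 : (√2)⁻¹ * (√2)⁻¹ = (1 / 2 : ℝ) := by
    rw [← mul_inv, Real.mul_self_sqrt two_pos.le, one_div]
  have e : (fun r ω => (√2)⁻¹ * c r * g (ζ r ω)) =
      fun r ω => 1 / 2 * c r * (ζ r ω ^ 2 - 1) := by
    ext r ω
    simp only [g]
    rw [← h22]; ring
  rw [e] at hW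
  refine ⟨W, hW, hW0, ?_, fun t => ?_⟩
  · rw [hWv, ← tsum_mul_left]
    congr 1; ext r
    rw [mul_pow, sq (√2)⁻¹, h22]
  · have hm : ∀ r, Measurable fun ω => 1 / 2 * c r * (ζ r ω ^ 2 - 1) := fun r => by fun_prop
    have hi : iIndepFun (fun r ω => 1 / 2 * c r * (ζ r ω ^ 2 - 1)) P :=
      hind.comp (fun r x => 1 / 2 * c r * (x ^ 2 - 1)) fun r => by fun_prop
    have h2 : ∀ r, MemLp (fun ω => 1 / 2 * c r * (ζ r ω ^ 2 - 1)) 2 P := fun r => by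
      have := (hmem r).const_mul ((√2)⁻¹ * c r)
      exact (congr_fun e r) ▸ this
    have := hasProd_charFun_of_isL2Sum (fun r => (hm r).aemeasurable) hi h2 hW t
    simpa only [charFun_map_chaos (hζ _) (hl _)] using this

end GaussianChaos

/-! ### Symmetrization of ordered double sums -/

section Symmetrization

variable {B : Type*}

/-- `∑_{a < b} F(z_a, z_b)`. -/
def orderedSum {m : ℕ} (F : B → B → ℝ) (z : Fin m → B) : ℝ :=
  ∑ a, ∑ b, if a < b then F (z a) (z b) else 0

lemma sum_ltPairs_eq_orderedSum (F : B → B → ℝ) (z : ℕ → B) (m : ℕ) :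
    ∑ q ∈ ltPairs m, F (z q.1) (z q.2) = orderedSum F fun a : Fin m => z a := by
  rw [ltPairs, Finset.sum_filter, Finset.sum_product, Finset.sum_range]
  refine Finset.sum_congr rfl fun a _ => ?_
  rw [Finset.sum_range]
  rfl

/-- For each unordered pair of indices, the symmetric kernel evaluates `F` in the order of the
times, so the order of the indices disappears; equal times contribute nothing on either side. -/
lemma orderedSum_hatKernel {m : ℕ} (F : B → B → ℝ) (z : Fin m → B) (t : Fin m → unitInterval) :
    orderedSum (hatKernel F) (fun a => (z a, t a)) =
      ∑ a, ∑ b, if t a < t b then F (z a) (z b) else 0 := by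
  have h1 : ∀ a b : Fin m, (if a < b then hatKernel F (z a, t a) (z b, t b) else 0) =
      (if a < b then if t a < t b then F (z a) (z b) else 0 else 0) +
        if a < b then if t b < t a then F (z b) (z a) else 0 else 0 := fun a b => by
    by_cases hab : a < b
    · simp only [if_pos hab, hatKernel]
      rcases lt_trichotomy (t a) (t b) with h | h | h
      · simp [h, h.le.not_gt]
      · simp [h]
      · simp [h, h.le.not_gt]
    · simp [hab]
  simp only [orderedSum, h1, Finset.sum_add_distrib]
  rw [Finset.sum_comm (f := fun a b => if a < b then if t b < t a then F (z b) (z a) else 0 else 0),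
    ← Finset.sum_add_distrib]
  refine Finset.sum_congr rfl fun a _ => ?_
  rw [← Finset.sum_add_distrib]
  refine Finset.sum_congr rfl fun b _ => ?_
  rcases lt_trichotomy a b with h | h | h
  · simp [h, h.le.not_gt]
  · simp [h]
  · simp [h, h.le.not_gt]

/-- When the times are distinct, relabelling the points by increasing time turns the order of times
into the order of indices. -/
lemma orderedSum_hatKernel_of_injective {m : ℕ} (F : B → B → ℝ) (z : Fin m → B)
    {t : Fin m → unitInterval} (ht : Function.Injective t) :
    orderedSum (hatKernel F) (fun a => (z a, t a)) = orderedSum F (z ∘ Tuple.sort t) := by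
  rw [orderedSum_hatKernel, orderedSum]
  have hs : StrictMono (t ∘ Tuple.sort t) :=
    (Tuple.monotone_sort t).strictMono_of_injective (ht.comp (Tuple.sort t).injective)
  rw [← Equiv.sum_comp (Tuple.sort t)]
  refine Finset.sum_congr rfl fun a _ => ?_
  rw [← Equiv.sum_comp (Tuple.sort t)]
  refine Finset.sum_congr rfl fun b _ => ?_
  have : t (Tuple.sort t a) < t (Tuple.sort t b) ↔ a < b := hs.lt_iff_lt
  simp only [this, Function.comp]

lemma ae_ne_unitInterval :
    ∀ᵐ p ∂((volume : Measure unitInterval).prod volume), p.1 ≠ p.2 := by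
  rw [ae_iff]
  have hm : MeasurableSet {p : unitInterval × unitInterval | ¬ p.1 ≠ p.2} := by
    simp only [not_not]
    exact measurableSet_eq_fun measurable_fst measurable_snd
  rw [Measure.measure_prod_null hm]
  refine ae_of_all _ fun x => ?_
  have : Prod.mk x ⁻¹' {p : unitInterval × unitInterval | ¬ p.1 ≠ p.2} = {x} := by
    ext y; simp [eq_comm]
  change volume (Prod.mk x ⁻¹' {p : unitInterval × unitInterval | ¬ p.1 ≠ p.2}) = 0
  rw [this]
  exact measure_singleton x

/-- Two coordinates are independent with an atomless law, so they almost never coincide, and there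
are finitely many pairs of coordinates. -/
lemma ae_injective_pi_unitInterval (m : ℕ) :
    ∀ᵐ t ∂(Measure.pi fun _ : Fin m => (volume : Measure unitInterval)), Function.Injective t := by
  have h : ∀ i j : Fin m, i ≠ j →
      ∀ᵐ t ∂(Measure.pi fun _ : Fin m => (volume : Measure unitInterval)), t i ≠ t j := by
    intro i j hij
    have hind := (iIndepFun_pi (μ := fun _ : Fin m => (volume : Measure unitInterval))
      (X := fun _ => id) fun _ => aemeasurable_id).indepFun hij
    simp only [id] at hind
    have hmap := map_prodMk_of_indepFun (measurable_pi_apply i) (measurable_pi_apply j) hind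
      (measurePreserving_eval (fun _ : Fin m => (volume : Measure unitInterval)) j).map_eq
    rw [(measurePreserving_eval (fun _ : Fin m => (volume : Measure unitInterval)) i).map_eq]
      at hmap
    have h2 := ae_ne_unitInterval
    rw [← hmap] at h2
    exact ae_of_ae_map (f := fun t : Fin m → unitInterval => (t i, t j)) (by fun_prop) h2
  have h3 : ∀ᵐ t ∂(Measure.pi fun _ : Fin m => (volume : Measure unitInterval)),
      ∀ i j : Fin m, i ≠ j → t i ≠ t j := by
    rw [ae_all_iff]; intro i; rw [ae_all_iff]; intro j
    by_cases hij : i = j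
    · exact ae_of_all _ fun _ h => (h hij).elim
    · filter_upwards [h i j hij] with t ht _ using ht
  filter_upwards [h3] with t ht i j hij
  by_contra hne
  exact ht i j hne hij

variable [MeasurableSpace B]

lemma measurable_orderedSum {m : ℕ} {F : B → B → ℝ} (hF : Measurable (Function.uncurry F)) :
    Measurable (orderedSum (m := m) F) := by
  refine Finset.measurable_fun_sum _ fun a _ => Finset.measurable_fun_sum _ fun b _ => ?_
  split_ifs
  · exact hF.comp (((measurable_pi_apply a).prodMk (measurable_pi_apply b) :
      Measurable fun z : Fin m → B => (z a, z b)))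
  · exact measurable_const

lemma measurable_hatKernel {F : B → B → ℝ} (hF : Measurable (Function.uncurry F)) :
    Measurable (Function.uncurry (hatKernel F)) := by
  have h1 : Measurable fun z : (B × unitInterval) × (B × unitInterval) => F z.1.1 z.2.1 :=
    hF.comp (by fun_prop : Measurable fun z : (B × unitInterval) × (B × unitInterval) =>
      (z.1.1, z.2.1))
  have h2 : Measurable fun z : (B × unitInterval) × (B × unitInterval) => F z.2.1 z.1.1 :=
    hF.comp (by fun_prop : Measurable fun z : (B × unitInterval) × (B × unitInterval) =>
      (z.2.1, z.1.1))
  exact Measurable.ite (measurableSet_lt (by fun_prop) (by fun_prop)) h1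
      (Measurable.ite (measurableSet_lt (by fun_prop) (by fun_prop)) h2 measurable_const)

variable {Ω : Type*} [MeasurableSpace Ω] {P : Measure Ω} [IsProbabilityMeasure P]

lemma map_fin_eq_pi {β : Measure B} {Z : ℕ → Ω → B} (hZm : ∀ i, Measurable (Z i))
    (hZi : iIndepFun Z P) (hZβ : ∀ i, P.map (Z i) = β) (m : ℕ) :
    P.map (fun ω (a : Fin m) => Z a ω) = Measure.pi fun _ => β := by
  have h := hZi.precomp (g := fun a : Fin m => (a : ℕ)) Fin.val_injective
  rw [iIndepFun_iff_map_fun_eq_pi_map fun a => (hZm _).aemeasurable] at h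
  simpa only [Function.comp, hZβ] using h

/-- Randomizing the order does not change the law of an ordered double sum. -/
lemma charFun_map_sum_hatKernel {Ω' : Type*} [MeasurableSpace Ω'] {P' : Measure Ω'}
    [IsProbabilityMeasure P'] {β : Measure B} [IsProbabilityMeasure β] {Z : ℕ → Ω → B}
    (hZm : ∀ i, Measurable (Z i)) (hZi : iIndepFun Z P) (hZβ : ∀ i, P.map (Z i) = β)
    {Y : ℕ → Ω' → B × unitInterval} (hYm : ∀ i, Measurable (Y i)) (hYi : iIndepFun Y P')
    (hYβ : ∀ i, P'.map (Y i) = β.prod volume) {F : B → B → ℝ}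
    (hF : Measurable (Function.uncurry F)) (m : ℕ) (s : ℝ) :
    charFun (P.map fun ω => s * ∑ q ∈ ltPairs m, F (Z q.1 ω) (Z q.2 ω)) =
      charFun (P'.map fun ω => s * ∑ q ∈ ltPairs m, hatKernel F (Y q.1 ω) (Y q.2 ω)) := by
  ext τ
  let φ : ℝ → ℂ := fun x => Complex.exp ((τ * (s * x) : ℝ) * Complex.I)
  have hφ : Measurable φ := by fun_prop
  have hFh := measurable_hatKernel hF
  have e1 : ∀ ω, ∑ q ∈ ltPairs m, F (Z q.1 ω) (Z q.2 ω) =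
      orderedSum F fun a : Fin m => Z a ω := fun ω => sum_ltPairs_eq_orderedSum F (Z · ω) m
  have e2 : ∀ ω, ∑ q ∈ ltPairs m, hatKernel F (Y q.1 ω) (Y q.2 ω) =
      orderedSum (hatKernel F) fun a : Fin m => Y a ω := fun ω =>
    sum_ltPairs_eq_orderedSum (hatKernel F) (Y · ω) m
  have mZ : Measurable fun ω (a : Fin m) => Z a ω := measurable_pi_lambda _ fun a => hZm a
  have mY : Measurable fun ω (a : Fin m) => Y a ω := measurable_pi_lambda _ fun a => hYm a
  simp only [e1, e2]
  have m1 : Measurable fun ω => s * orderedSum F fun a : Fin m => Z a ω :=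
    ((measurable_orderedSum hF).comp mZ).const_mul s
  have m2 : Measurable fun ω => s * orderedSum (hatKernel F) fun a : Fin m => Y a ω :=
    ((measurable_orderedSum hFh).comp mY).const_mul s
  rw [charFun_map_real m1.aemeasurable, charFun_map_real m2.aemeasurable]
  change ∫ ω, φ (orderedSum F fun a : Fin m => Z a ω) ∂P =
    ∫ ω, φ (orderedSum (hatKernel F) fun a : Fin m => Y a ω) ∂P'
  rw [integral_comp_of_map_eq (g := fun z => φ (orderedSum F z)) mZ (map_fin_eq_pi hZm hZi hZβ m)
      (hφ.comp (measurable_orderedSum hF)).aestronglyMeasurable,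
    integral_comp_of_map_eq (g := fun z => φ (orderedSum (hatKernel F) z)) mY
      (map_fin_eq_pi hYm hYi hYβ m) (hφ.comp (measurable_orderedSum hFh)).aestronglyMeasurable]
  let βm : Measure (Fin m → B) := Measure.pi fun _ => β
  let Tm : Measure (Fin m → unitInterval) := Measure.pi fun _ => volume
  have mp : MeasurePreserving (MeasurableEquiv.arrowProdEquivProdArrow B unitInterval (Fin m))
      (Measure.pi fun _ => β.prod volume) (βm.prod Tm) :=
    measurePreserving_arrowProdEquivProdArrow B unitInterval (Fin m) (fun _ => β) fun _ => volume
  have hmg : Measurable fun p : (Fin m → B) × (Fin m → unitInterval) =>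
      orderedSum (hatKernel F) fun a => (p.1 a, p.2 a) :=
    (measurable_orderedSum hFh).comp (measurable_pi_lambda _ fun a => by fun_prop)
  have e3 := mp.integral_comp' (fun p : (Fin m → B) × (Fin m → unitInterval) =>
    φ (orderedSum (hatKernel F) fun a => (p.1 a, p.2 a)))
  have e4 : ∫ z, φ (orderedSum (hatKernel F) z) ∂(Measure.pi fun _ : Fin m => β.prod volume) =
      ∫ p, φ (orderedSum (hatKernel F) fun a => (p.1 a, p.2 a)) ∂(βm.prod Tm) := e3
  rw [e4, integral_prod_symm _ (integrable_exp_mul_I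
    ((hmg.const_mul s).const_mul τ).aemeasurable)]
  -- With the times fixed and distinct, sorting is a permutation of the points, which preserves a
  -- product of identical measures.
  have e5 : ∀ᵐ t ∂Tm, ∫ z, φ (orderedSum (hatKernel F) fun a => (z a, t a)) ∂βm =
      ∫ z, φ (orderedSum F z) ∂βm := by
    filter_upwards [ae_injective_pi_unitInterval m] with t ht
    simp only [orderedSum_hatKernel_of_injective F _ ht]
    have mp2 : MeasurePreserving (MeasurableEquiv.piCongrLeft (fun _ : Fin m => B)
        (Tuple.sort t).symm) βm βm :=
      measurePreserving_piCongrLeft (α := fun _ : Fin m => B) (fun _ => β) (Tuple.sort t).symm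
    rw [← mp2.integral_comp' fun z => φ (orderedSum F z)]
    refine integral_congr_ae (ae_of_all _ fun z => ?_)
    change φ (orderedSum F (z ∘ Tuple.sort t)) = _
    congr 2
    ext a
    have := MeasurableEquiv.piCongrLeft_apply_apply (Tuple.sort t).symm (β := fun _ : Fin m => B) z
      (Tuple.sort t a)
    rw [Equiv.symm_apply_apply] at this
    exact this.symm
  rw [integral_congr_ae e5, integral_const, probReal_univ, one_smul]

end Symmetrization

/-! ### Degenerate kernels of finite rank -/

section FiniteRank

set_option linter.unusedSectionVars false

variable {Ω C : Type*} [MeasurableSpace Ω] [MeasurableSpace C] {P : Measure Ω}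
  [IsProbabilityMeasure P] {ρ : Measure C} [IsProbabilityMeasure ρ] {Y : ℕ → Ω → C}

lemma identDistrib_comp {D : Type*} [MeasurableSpace D] (hYm : ∀ i, Measurable (Y i))
    (hYρ : ∀ i, P.map (Y i) = ρ) {g : C → D} (hg : Measurable g) (i j : ℕ) :
    IdentDistrib (fun ω => g (Y i ω)) (fun ω => g (Y j ω)) P P :=
  IdentDistrib.comp (u := g)
    ⟨(hYm i).aemeasurable, (hYm j).aemeasurable, (hYρ i).trans (hYρ j).symm⟩ hg

/-- The central limit theorem for a bounded sequence of orthonormal functions. -/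
lemma tendstoInDistribution_orthonormal_sums {κ : Type*} [Fintype κ]
    (hYm : ∀ i, Measurable (Y i)) (hYi : iIndepFun Y P) (hYρ : ∀ i, P.map (Y i) = ρ)
    {h : κ → C → ℝ} (hm : ∀ r, Measurable (h r)) (h2 : ∀ r, MemLp (h r) 2 ρ)
    (h0 : ∀ r, ∫ y, h r y ∂ρ = 0) (h1 : ∀ r, ∫ y, h r y * h r y ∂ρ = 1)
    (hort : ∀ r s, r ≠ s → ∫ y, h r y * h s y ∂ρ = 0) :
    TendstoInDistribution (fun (n : ℕ) ω => (WithLp.toLp 2 fun r =>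
        (√n)⁻¹ * ∑ k ∈ Finset.range n, h r (Y k ω) : EuclideanSpace ℝ κ)) atTop
      (WithLp.toLp 2) (fun _ => P) (Measure.pi fun _ : κ => gaussianReal 0 1) := by
  classical
  have hVm : ∀ n : ℕ, Measurable fun ω => (WithLp.toLp 2 fun r =>
      (√n)⁻¹ * ∑ k ∈ Finset.range n, h r (Y k ω) : EuclideanSpace ℝ κ) := fun n => by
    refine (WithLp.measurable_toLp 2 (κ → ℝ)).comp (measurable_pi_lambda _ fun r => ?_)
    exact (Finset.measurable_fun_sum _ fun k _ => (hm r).comp (hYm k)).const_mul _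
  refine ⟨fun n => (hVm n).aemeasurable, (WithLp.measurable_toLp 2 _).aemeasurable, ?_⟩
  refine ProbabilityMeasure.tendsto_iff_tendsto_charFun.2 fun θ => ?_
  simp only [ProbabilityMeasure.coe_mk]
  rw [map_pi_eq_stdGaussian, charFun_stdGaussian]
  -- The Cramér–Wold reduction: in the direction `θ` the vector is a normalized sum of the scalar
  -- function `G`, whose variance is `‖θ‖ ^ 2` by orthonormality.
  let G : C → ℝ := fun y => ∑ r, θ r * h r y
  have hG : Measurable G := Finset.measurable_fun_sum _ fun r _ => (hm r).const_mul _
  have hG2 : MemLp G 2 ρ := memLp_finsetSum _ fun r _ => (h2 r).const_mul _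
  have hG0 : ∫ y, G y ∂ρ = 0 := by
    simp only [G]
    rw [integral_finsetSum _ fun r _ => ((h2 r).integrable one_le_two).const_mul _]
    simp [integral_const_mul, h0]
  have hGv : ∫ y, G y ^ 2 ∂ρ = ‖θ‖ ^ 2 := by
    rw [integral_sq_sum_of_orthogonal Finset.univ (fun r _ => (h2 r).const_mul (θ r)) ?_,
      EuclideanSpace.real_norm_sq_eq]
    · refine Finset.sum_congr rfl fun r _ => ?_
      simp only [mul_pow, integral_const_mul]
      simp only [sq (h r _), h1, mul_one]
    · intro r _ s _ hrs
      have e : ∀ y, θ r * h r y * (θ s * h s y) = θ r * θ s * (h r y * h s y) := fun y => by ring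
      simp only [e]
      rw [integral_const_mul, hort r s hrs, mul_zero]
  have hE0 : ∫ ω, G (Y 0 ω) ∂P = 0 := by
    rw [integral_comp_of_map_eq (hYm 0) (hYρ 0) hG.aestronglyMeasurable, hG0]
  have hEv : Var[fun ω => G (Y 0 ω); P] = ‖θ‖ ^ 2 := by
    rw [variance_of_integral_eq_zero (X := fun ω => G (Y 0 ω)) (hG.comp (hYm 0)).aemeasurable hE0,
      integral_comp_of_map_eq (g := fun y => G y ^ 2) (hYm 0) (hYρ 0)
        (hG.pow_const 2).aestronglyMeasurable, hGv]
  have hclt := tendstoInDistribution_inv_sqrt_mul_sum_sub (P := P)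
    (P' := gaussianReal 0 (‖θ‖ ^ 2).toNNReal) (Y := id) (X := fun k ω => G (Y k ω))
    (by rw [hEv]; exact HasLaw.id)
    ((hYρ 0 ▸ hG2).comp_of_map (hYm 0).aemeasurable)
    (hYi.comp (fun _ => G) fun _ => hG) (fun i => identDistrib_comp hYm hYρ hG i 0)
  -- The direction is already built into `G`, so the scalar characteristic function is needed only
  -- at `1`.
  have hc := tendsto_charFun_of_tendstoInDistribution hclt 1
  rw [Measure.map_id, charFun_gaussianReal] at hc
  have e1 : Complex.exp (((1 : ℝ) : ℂ) * ((0 : ℝ) : ℂ) * Complex.I -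
      ((‖θ‖ ^ 2).toNNReal : ℝ) * ((1 : ℝ) : ℂ) ^ 2 / 2) = Complex.exp (-‖θ‖ ^ 2 / 2) := by
    congr 1
    rw [Real.coe_toNNReal _ (by positivity)]
    push_cast; ring
  have hc' := hc
  simp only [e1] at hc'
  refine hc'.congr fun n => ?_
  have hm' : Measurable fun ω => (√n)⁻¹ * (∑ k ∈ Finset.range n, G (Y k ω) -
      n * ∫ ω, G (Y 0 ω) ∂P) :=
    ((Finset.measurable_fun_sum _ fun k _ => hG.comp (hYm k)).sub_const _).const_mul _
  rw [charFun_map_real hm'.aemeasurable, charFun_apply, integral_map (hVm n).aemeasurable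
    (by fun_prop)]
  refine integral_congr_ae (ae_of_all _ fun ω => ?_)
  simp only [hE0, mul_zero, sub_zero, one_mul]
  congr 3
  rw [PiLp.inner_apply]
  simp only [RCLike.inner_apply, conj_trivial, G]
  rw [Finset.sum_comm, Finset.mul_sum]
  refine Finset.sum_congr rfl fun r _ => ?_
  rw [← Finset.mul_sum]
  ring

lemma tendsto_inv_mul_sum_inMeasure (hYm : ∀ i, Measurable (Y i)) (hYi : iIndepFun Y P)
    (hYρ : ∀ i, P.map (Y i) = ρ) {g : C → ℝ} (hg : Measurable g) (hgi : Integrable g ρ) :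
    ∀ᵐ ω ∂P, Tendsto (fun n : ℕ => (n : ℝ)⁻¹ * ∑ k ∈ Finset.range n, g (Y k ω)) atTop
      (𝓝 (∫ y, g y ∂ρ)) := by
  have hi : Integrable (fun ω => g (Y 0 ω)) P := by
    rw [← hYρ 0] at hgi
    exact hgi.comp_measurable (hYm 0)
  have := strong_law_ae_real (fun k ω => g (Y k ω)) hi
    (fun i j hij => (hYi.indepFun hij).comp hg hg) fun i => identDistrib_comp hYm hYρ hg i 0
  rw [integral_comp_of_map_eq (hYm 0) (hYρ 0) hg.aestronglyMeasurable] at this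
  filter_upwards [this] with ω hω
  exact hω.congr fun n => by rw [div_eq_inv_mul]

/-- The limit law of a degenerate `U`-statistic with a kernel of finite rank. -/
lemma tendsto_charFun_finite_rank {κ : Type*} [Fintype κ]
    (hYm : ∀ i, Measurable (Y i)) (hYi : iIndepFun Y P) (hYρ : ∀ i, P.map (Y i) = ρ)
    {h : κ → C → ℝ} (hm : ∀ r, Measurable (h r)) (h2 : ∀ r, MemLp (h r) 2 ρ)
    (h0 : ∀ r, ∫ y, h r y ∂ρ = 0) (h1 : ∀ r, ∫ y, h r y * h r y ∂ρ = 1)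
    (hort : ∀ r s, r ≠ s → ∫ y, h r y * h s y ∂ρ = 0) (c : κ → ℝ) (t : ℝ) :
    Tendsto (fun n : ℕ => charFun (P.map fun ω => (n : ℝ)⁻¹ * ∑ q ∈ ltPairs n,
      ∑ r, c r * (h r (Y q.1 ω) * h r (Y q.2 ω))) t) atTop (𝓝 (∏ r, chaosChar (c r * t))) := by
  -- For each `r`, the sum over `i < j` of `h(Y_i) h(Y_j)` is half the difference between the square
  -- of the sum and the sum of the squares. The former converges in law by the central limit
  -- theorem, the latter to its mean `1` by the law of large numbers.
  have hV := (tendstoInDistribution_orthonormal_sums hYm hYi hYρ hm h2 h0 h1 hort).continuous_comp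
    (g := fun v : EuclideanSpace ℝ κ => ∑ r, 1 / 2 * c r * v r ^ 2) (by fun_prop)
  have hL : TendstoInMeasure P (fun (n : ℕ) ω => ∑ r, -(1 / 2 * c r) *
      ((n : ℝ)⁻¹ * ∑ k ∈ Finset.range n, h r (Y k ω) * h r (Y k ω))) atTop
      (fun _ => ∑ r, -(1 / 2 * c r) * 1) := by
    refine tendstoInMeasure_of_tendsto_ae (fun n => ?_) ?_
    · exact (Finset.measurable_fun_sum _ fun r _ => ((Finset.measurable_fun_sum _ fun k _ =>
        ((hm r).comp (hYm k)).mul ((hm r).comp (hYm k))).const_mul _).const_mul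
          _).aestronglyMeasurable
    · have : ∀ᵐ ω ∂P, ∀ r, Tendsto (fun n : ℕ => (n : ℝ)⁻¹ *
          ∑ k ∈ Finset.range n, h r (Y k ω) * h r (Y k ω)) atTop (𝓝 1) := by
        refine ae_all_iff.2 fun r => ?_
        have := tendsto_inv_mul_sum_inMeasure hYm hYi hYρ (g := fun y => h r y * h r y)
          ((hm r).mul (hm r)) ((h2 r).integrable_mul (h2 r))
        rwa [h1 r] at this
      filter_upwards [this] with ω hω
      exact tendsto_finsetSum _ fun r _ => (hω r).const_mul _
  have hS := hV.add_of_tendstoInMeasure_const hL fun n =>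
    (Finset.measurable_fun_sum _ fun r _ => ((Finset.measurable_fun_sum _ fun k _ =>
        ((hm r).comp (hYm k)).mul ((hm r).comp (hYm k))).const_mul _).const_mul
          _).aemeasurable
  have hc := tendsto_charFun_of_tendstoInDistribution hS t
  have hlim : charFun ((Measure.pi fun _ : κ => gaussianReal 0 1).map fun x : κ → ℝ =>
      ((fun v : EuclideanSpace ℝ κ => ∑ r, 1 / 2 * c r * v r ^ 2) ∘ WithLp.toLp 2) x +
        ∑ r, -(1 / 2 * c r) * 1) t = ∏ r, chaosChar (c r * t) := by
    have e : (fun x : κ → ℝ => ((fun v : EuclideanSpace ℝ κ => ∑ r, 1 / 2 * c r * v r ^ 2) ∘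
        WithLp.toLp 2) x + ∑ r, -(1 / 2 * c r) * 1) =
        fun x => ∑ r, 1 / 2 * c r * (x r ^ 2 - 1) := by
      ext x
      rw [Function.comp, ← Finset.sum_add_distrib]
      refine Finset.sum_congr rfl fun r _ => ?_
      change 1 / 2 * c r * x r ^ 2 + _ = _
      ring
    rw [e]
    have hi := (iIndepFun_pi (μ := fun _ : κ => gaussianReal 0 1)
      (X := fun r x => 1 / 2 * c r * (x ^ 2 - 1)) fun r => by fun_prop)
    rw [iIndepFun.charFun_map_fun_finsetSum_eq_prod (s := Finset.univ)
      (fun r _ => (((measurable_pi_apply r).pow_const 2).sub_const 1 |>.const_mul _).aemeasurable)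
      (hi.restrict _), Finset.prod_apply]
    refine Finset.prod_congr rfl fun r _ => ?_
    exact charFun_map_chaos (measurable_pi_apply r) (measurePreserving_eval _ r).map_eq (c r) t
  rw [hlim] at hc
  refine hc.congr fun n => ?_
  congr 2
  ext ω
  rw [Pi.add_apply, Function.comp, ← Finset.sum_add_distrib]
  have hsq : ∀ r, ∑ q ∈ ltPairs n, c r * (h r (Y q.1 ω) * h r (Y q.2 ω)) =
      1 / 2 * c r * ((∑ k ∈ Finset.range n, h r (Y k ω)) ^ 2 -
        ∑ k ∈ Finset.range n, h r (Y k ω) * h r (Y k ω)) := fun r => by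
    rw [← Finset.mul_sum]
    rw [sum_ltPairs n fun i j => h r (Y i ω) * h r (Y j ω)]
    have : ∀ n : ℕ, ∑ j ∈ Finset.range n, ∑ i ∈ Finset.range j, h r (Y i ω) * h r (Y j ω) =
      1 / 2 * ((∑ k ∈ Finset.range n, h r (Y k ω)) ^ 2 -
        ∑ k ∈ Finset.range n, h r (Y k ω) * h r (Y k ω)) := by
      intro n
      induction n with
      | zero => simp
      | succ n ih =>
        rw [Finset.sum_range_succ, ih, ← Finset.sum_mul,
          Finset.sum_range_succ (fun k => h r (Y k ω)),
          Finset.sum_range_succ (fun k => h r (Y k ω) * h r (Y k ω))]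
        ring
    rw [this]; ring
  rw [Finset.sum_comm, Finset.mul_sum]
  refine Finset.sum_congr rfl fun r _ => ?_
  rw [hsq r]
  have hn : (√(n : ℝ))⁻¹ ^ 2 = (n : ℝ)⁻¹ := by rw [inv_pow, Real.sq_sqrt n.cast_nonneg]
  simp only [mul_pow, hn]
  ring

end FiniteRank

/-! ### Alternating a kernel over pairs of points with a common time -/

section Alternating

variable {S : Type*}

/-- `(x, t)` for `((x, x'), t)`. -/
def firstPoint (y : (S × S) × unitInterval) : S × unitInterval := (y.1.1, y.2)

/-- `(x', t)` for `((x, x'), t)`. -/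
def secondPoint (y : (S × S) × unitInterval) : S × unitInterval := (y.1.2, y.2)

/-- The kernel `K(x, y) - K(x', y) - K(x, y') + K(x', y')` on pairs of points with a time. -/
def altKernel (K : S × unitInterval → S × unitInterval → ℝ) (y z : (S × S) × unitInterval) : ℝ :=
  K (firstPoint y) (firstPoint z) - K (secondPoint y) (firstPoint z)
    - K (firstPoint y) (secondPoint z) + K (secondPoint y) (secondPoint z)

/-- Both points of a pair carry the same time, so selecting the order by time commutes with
alternating over the points. -/
lemma hatKernel_pairKernel (f : S → S → ℝ) :
    hatKernel (pairKernel f) = altKernel (hatKernel f) := by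
  ext ⟨⟨x, x'⟩, t⟩ ⟨⟨y, y'⟩, u⟩
  simp only [hatKernel, altKernel, firstPoint, secondPoint, pairKernel]
  rcases lt_trichotomy t u with h | h | h
  · simp [h]
  · simp [h]
  · simp [h, h.le.not_gt]
    ring

variable [MeasurableSpace S] (ν : Measure S) [IsProbabilityMeasure ν]

lemma measurePreserving_firstPoint : MeasurePreserving (firstPoint (S := S))
    ((ν.prod ν).prod volume) (ν.prod volume) :=
  measurePreserving_fst.prod (MeasurePreserving.id _)

lemma measurePreserving_secondPoint : MeasurePreserving (secondPoint (S := S))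
    ((ν.prod ν).prod volume) (ν.prod volume) :=
  measurePreserving_snd.prod (MeasurePreserving.id _)

lemma measurePreserving_swapPoints :
    MeasurePreserving (fun y : (S × S) × unitInterval => (y.1.swap, y.2))
      ((ν.prod ν).prod volume) ((ν.prod ν).prod volume) :=
  Measure.measurePreserving_swap.prod (MeasurePreserving.id _)

variable {K : S × unitInterval → S × unitInterval → ℝ}

lemma measurable_altKernel (hK : Measurable (Function.uncurry K)) :
    Measurable (Function.uncurry (altKernel K)) := by
  have m1 : Measurable (firstPoint (S := S)) := by unfold firstPoint; fun_prop
  have m2 : Measurable (secondPoint (S := S)) := by unfold secondPoint; fun_prop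
  have h : ∀ {a b : (S × S) × unitInterval → S × unitInterval}, Measurable a → Measurable b →
      Measurable fun p : ((S × S) × unitInterval) × ((S × S) × unitInterval) =>
        K (a p.1) (b p.2) := fun ha hb =>
    hK.comp ((ha.comp measurable_fst).prodMk (hb.comp measurable_snd))
  exact (((h m1 m1).sub (h m2 m1)).sub (h m1 m2)).add (h m2 m2)

/-- The alternating kernel is degenerate, by antisymmetry. -/
lemma integral_altKernel_left (hK : Measurable (Function.uncurry K))
    (z : (S × S) × unitInterval) : ∫ y, altKernel K y z ∂((ν.prod ν).prod volume) = 0 := by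
  have hm : Measurable fun y => altKernel K y z :=
    (measurable_altKernel hK).comp measurable_prodMk_right
  have h := integral_comp_of_map_eq (measurePreserving_swapPoints ν).measurable
    (measurePreserving_swapPoints ν).map_eq (g := fun y => altKernel K y z) hm.aestronglyMeasurable
  have e : ∀ y : (S × S) × unitInterval,
      altKernel K (y.1.swap, y.2) z = -altKernel K y z := fun y => by
    simp only [altKernel, firstPoint, secondPoint, Prod.fst_swap, Prod.snd_swap]; ring
  simp only [e, integral_neg] at h
  linarith

/-- Exchanging the two points of `z` preserves the measure and changes the sign of the kernel.
Neither degeneracy nor integrability of `K` plays a role. -/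
lemma integral_altKernel_right (hK : Measurable (Function.uncurry K))
    (y : (S × S) × unitInterval) : ∫ z, altKernel K y z ∂((ν.prod ν).prod volume) = 0 := by
  have hm : Measurable fun z => altKernel K y z :=
    (measurable_altKernel hK).comp measurable_prodMk_left
  have h := integral_comp_of_map_eq (measurePreserving_swapPoints ν).measurable
    (measurePreserving_swapPoints ν).map_eq (g := fun z => altKernel K y z) hm.aestronglyMeasurable
  have e : ∀ z : (S × S) × unitInterval,
      altKernel K y (z.1.swap, z.2) = -altKernel K y z := fun z => by
    simp only [altKernel, firstPoint, secondPoint, Prod.fst_swap, Prod.snd_swap]; ring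
  simp only [e, integral_neg] at h
  linarith

lemma memLp_comp_points {a b : (S × S) × unitInterval → S × unitInterval}
    (ha : MeasurePreserving a ((ν.prod ν).prod volume) (ν.prod volume))
    (hb : MeasurePreserving b ((ν.prod ν).prod volume) (ν.prod volume))
    (h2 : MemLp (Function.uncurry K) 2
      ((ν.prod (volume : Measure unitInterval)).prod (ν.prod (volume : Measure unitInterval)))) :
    MemLp (fun p : ((S × S) × unitInterval) × ((S × S) × unitInterval) => K (a p.1) (b p.2)) 2
      (((ν.prod ν).prod volume).prod ((ν.prod ν).prod volume)) :=
  h2.comp_measurePreserving (ha.prod hb)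

lemma integral_sq_comp_points {a b : (S × S) × unitInterval → S × unitInterval}
    (ha : MeasurePreserving a ((ν.prod ν).prod volume) (ν.prod volume))
    (hb : MeasurePreserving b ((ν.prod ν).prod volume) (ν.prod volume))
    (hK : Measurable (Function.uncurry K)) :
    ∫ p : ((S × S) × unitInterval) × ((S × S) × unitInterval), K (a p.1) (b p.2) ^ 2
      ∂(((ν.prod ν).prod volume).prod ((ν.prod ν).prod volume)) =
    ∫ p : (S × unitInterval) × (S × unitInterval), K p.1 p.2 ^ 2
      ∂((ν.prod (volume : Measure unitInterval)).prod (ν.prod (volume : Measure unitInterval))) :=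
  integral_comp_of_map_eq (ha.prod hb).measurable (ha.prod hb).map_eq
    (g := fun p : (S × unitInterval) × (S × unitInterval) => K p.1 p.2 ^ 2)
    (hK.pow_const 2).aestronglyMeasurable

lemma memLp_altKernel (h2 : MemLp (Function.uncurry K) 2
      ((ν.prod (volume : Measure unitInterval)).prod (ν.prod (volume : Measure unitInterval)))) :
    MemLp (Function.uncurry (altKernel K)) 2
      (((ν.prod ν).prod volume).prod ((ν.prod ν).prod volume)) := by
  have m1 := measurePreserving_firstPoint ν
  have m2 := measurePreserving_secondPoint ν
  exact (((memLp_comp_points ν m1 m1 h2).sub (memLp_comp_points ν m2 m1 h2)).sub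
    (memLp_comp_points ν m1 m2 h2)).add (memLp_comp_points ν m2 m2 h2)

/-- The square of a signed sum of four terms is at most four times the sum of their squares, and
each term has the same second moment as `K`; hence `16`. -/
lemma integral_sq_altKernel_le (hK : Measurable (Function.uncurry K))
    (h2 : MemLp (Function.uncurry K) 2
      ((ν.prod (volume : Measure unitInterval)).prod (ν.prod (volume : Measure unitInterval)))) :
    ∫ p : ((S × S) × unitInterval) × ((S × S) × unitInterval), altKernel K p.1 p.2 ^ 2
      ∂(((ν.prod ν).prod volume).prod ((ν.prod ν).prod volume)) ≤
    16 * ∫ p : (S × unitInterval) × (S × unitInterval), K p.1 p.2 ^ 2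
      ∂((ν.prod (volume : Measure unitInterval)).prod
        (ν.prod (volume : Measure unitInterval))) := by
  have m1 := measurePreserving_firstPoint ν
  have m2 := measurePreserving_secondPoint ν
  have i11 := (memLp_comp_points ν m1 m1 h2).integrable_sq
  have i21 := (memLp_comp_points ν m2 m1 h2).integrable_sq
  have i12 := (memLp_comp_points ν m1 m2 h2).integrable_sq
  have i22 := (memLp_comp_points ν m2 m2 h2).integrable_sq
  have h := integral_mono (memLp_altKernel ν h2).integrable_sq
    ((((i11.add i21).add i12).add i22).const_mul 4) fun p => by
      change altKernel K p.1 p.2 ^ 2 ≤ 4 * (K (firstPoint p.1) (firstPoint p.2) ^ 2 +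
        K (secondPoint p.1) (firstPoint p.2) ^ 2 + K (firstPoint p.1) (secondPoint p.2) ^ 2 +
        K (secondPoint p.1) (secondPoint p.2) ^ 2)
      simp only [altKernel]
      generalize K (firstPoint p.1) (firstPoint p.2) = a
      generalize K (secondPoint p.1) (firstPoint p.2) = b
      generalize K (firstPoint p.1) (secondPoint p.2) = c
      generalize K (secondPoint p.1) (secondPoint p.2) = d
      nlinarith [sq_nonneg (a + b), sq_nonneg (a + c), sq_nonneg (a - d), sq_nonneg (b - c),
        sq_nonneg (b + d), sq_nonneg (c + d)]
  refine h.trans_eq ?_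
  rw [integral_const_mul, integral_add' ((i11.add i21).add i12) i22,
    integral_add' (i11.add i21) i12,
    integral_add' i11 i21, integral_sq_comp_points ν m1 m1 hK, integral_sq_comp_points ν m2 m1 hK,
    integral_sq_comp_points ν m1 m2 hK, integral_sq_comp_points ν m2 m2 hK]
  ring

end Alternating

/-! ### Eigenfunctions of a degenerate kernel -/

section DegenerateEigenfunctions

set_option linter.unusedSectionVars false

variable {S : Type*} [MeasurableSpace S] {ν : Measure S} [IsProbabilityMeasure ν] {f : S → S → ℝ}

/-- The order of the times only decides which of the two partial integrals of `f` appears. Both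
vanish off a null set of space points, so the exceptional set does not depend on `t`. -/
lemma ae_integral_hatKernel_eq_zero (hdeg : ∀ᵐ x ∂ν, ∫ y, f x y ∂ν = 0)
    (hdeg' : ∀ᵐ y ∂ν, ∫ x, f x y ∂ν = 0) :
    ∀ᵐ q ∂(ν.prod (volume : Measure unitInterval)), ∀ t, ∫ x, hatKernel f (x, t) q ∂ν = 0 := by
  filter_upwards [Measure.quasiMeasurePreserving_fst.ae hdeg,
    Measure.quasiMeasurePreserving_fst.ae hdeg'] with q h1 h2 t
  rcases lt_trichotomy t q.2 with h | h | h
  · simpa [hatKernel, h] using h2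
  · simp [hatKernel, h]
  · simpa [hatKernel, h, h.le.not_gt] using h1

/-- By degeneracy, everything in the range of the operator is orthogonal to functions of time alone,
and an eigenfunction with nonzero eigenvalue lies in the range. Testing against indicators of sets
of times localizes this to almost every `t`. -/
lemma ae_integral_eigenfunction_eq_zero
    (hg : MemLp (Function.uncurry (hatKernel f)) 2
      ((ν.prod (volume : Measure unitInterval)).prod (ν.prod (volume : Measure unitInterval))))
    (hdeg : ∀ᵐ x ∂ν, ∫ y, f x y ∂ν = 0) (hdeg' : ∀ᵐ y ∂ν, ∫ x, f x y ∂ν = 0)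
    {e : Lp ℝ 2 (ν.prod (volume : Measure unitInterval))} {l : ℝ} (hl : l ≠ 0)
    (he : integralOperator _ (hatKernel f) hg e = l • e) :
    ∀ᵐ t ∂(volume : Measure unitInterval), ∫ x, e (x, t) ∂ν = 0 := by
  have hei : Integrable e (ν.prod (volume : Measure unitInterval)) :=
    (Lp.memLp e).integrable one_le_two
  refine Integrable.ae_eq_zero_of_forall_setIntegral_eq_zero hei.integral_prod_right
    fun s hs _ => ?_
  let v : S × unitInterval → ℝ := fun p => s.indicator 1 p.2
  have hv : Measurable v := (measurable_one.indicator hs).comp measurable_snd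
  have hv2 : MemLp v 2 (ν.prod (volume : Measure unitInterval)) := by
    refine MemLp.of_bound hv.aestronglyMeasurable 1 (ae_of_all _ fun p => ?_)
    by_cases hp : p.2 ∈ s <;> simp [v, hp]
  have huv : hv2.toLp v =ᵐ[ν.prod volume] v := hv2.coeFn_toLp
  have h1 : inner ℝ (hv2.toLp v) e = ∫ t in s, ∫ x, e (x, t) ∂ν := by
    rw [L2.inner_def, ← integral_indicator hs]
    have e1 : ∫ p, inner ℝ (hv2.toLp v p) (e p) ∂(ν.prod volume) =
        ∫ p, v p * e p ∂(ν.prod volume) := by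
      refine integral_congr_ae ?_
      filter_upwards [huv] with p hp
      rw [hp, RCLike.inner_apply', conj_trivial]
    rw [e1, integral_prod_symm (fun p => v p * e p) (hv2.integrable_mul (Lp.memLp e))]
    refine integral_congr_ae (ae_of_all _ fun t => ?_)
    by_cases ht : t ∈ s <;> simp [v, ht]
  have h2 : inner ℝ (hv2.toLp v) (integralOperator _ (hatKernel f) hg e) = 0 := by
    rw [inner_integralOperator]
    have hi := integrable_kernel_form hg hv2 (Lp.memLp e)
    have e1 : ∫ p : (S × unitInterval) × (S × unitInterval), (starRingEnd ℝ) (hv2.toLp v p.1) *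
        (hatKernel f p.1 p.2 * e p.2) ∂((ν.prod volume).prod (ν.prod volume)) =
        ∫ p : (S × unitInterval) × (S × unitInterval), (starRingEnd ℝ) (v p.1) *
        (hatKernel f p.1 p.2 * e p.2) ∂((ν.prod volume).prod (ν.prod volume)) := by
      refine integral_congr_ae ?_
      filter_upwards [Measure.quasiMeasurePreserving_fst.ae huv] with p hp
      rw [hp]
    rw [e1, integral_prod_symm _ hi]
    refine integral_eq_zero_of_ae ?_
    filter_upwards [ae_integral_hatKernel_eq_zero hdeg hdeg', hi.prod_left_ae] with q hq hqi
    rw [integral_prod_symm _ hqi]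
    refine integral_eq_zero_of_ae (ae_of_all _ fun t => ?_)
    simp only [v, integral_const_mul, integral_mul_const, hq t, zero_mul, mul_zero, Pi.zero_apply]
  rw [he, inner_smul_right, h1] at h2
  exact (mul_eq_zero.1 h2).resolve_left hl

end DegenerateEigenfunctions

/-! ### The limit law of the alternating statistic in terms of eigenvalues -/

section LimitLaw

set_option linter.unusedSectionVars false

variable {S : Type*} [MeasurableSpace S] {ν : Measure S} [IsProbabilityMeasure ν]

/-- The difference `(e(x, t) - e(x', t)) / √2`. -/
noncomputable def normalizedDiff (e : S × unitInterval → ℝ) (y : (S × S) × unitInterval) : ℝ :=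
  (√2)⁻¹ * (e (firstPoint y) - e (secondPoint y))

lemma memLp_normalizedDiff {e : S × unitInterval → ℝ} (he : MemLp e 2 (ν.prod volume)) :
    MemLp (normalizedDiff e) 2 ((ν.prod ν).prod volume) :=
  ((he.comp_measurePreserving (measurePreserving_firstPoint ν)).sub
    (he.comp_measurePreserving (measurePreserving_secondPoint ν))).const_mul _

lemma measurable_normalizedDiff {e : S × unitInterval → ℝ} (he : Measurable e) :
    Measurable (normalizedDiff e) := by
  unfold normalizedDiff firstPoint secondPoint
  exact ((he.comp (by fun_prop)).sub (he.comp (by fun_prop))).const_mul _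

lemma integral_normalizedDiff {e : S × unitInterval → ℝ} (he : MemLp e 2 (ν.prod volume)) :
    ∫ y, normalizedDiff e y ∂((ν.prod ν).prod volume) = 0 := by
  have m1 := measurePreserving_firstPoint ν
  have m2 := measurePreserving_secondPoint ν
  have i1 : Integrable (fun y => e (firstPoint y)) ((ν.prod ν).prod volume) :=
    (he.comp_measurePreserving m1).integrable one_le_two
  have i2 : Integrable (fun y => e (secondPoint y)) ((ν.prod ν).prod volume) :=
    (he.comp_measurePreserving m2).integrable one_le_two
  simp only [normalizedDiff]
  rw [integral_const_mul, integral_sub i1 i2, integral_comp_of_map_eq m1.measurable m1.map_eq he.1,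
    integral_comp_of_map_eq m2.measurable m2.map_eq he.1, sub_self, mul_zero]

/-- At a fixed time the two points are independent, so the mixed terms vanish as soon as one factor
has mean zero; nothing is needed of `e'`. The two remaining terms each give half of the inner
product. -/
lemma integral_normalizedDiff_mul {e e' : S × unitInterval → ℝ} (he : MemLp e 2 (ν.prod volume))
    (he' : MemLp e' 2 (ν.prod volume))
    (h0 : ∀ᵐ t ∂(volume : Measure unitInterval), ∫ x, e (x, t) ∂ν = 0) :
    ∫ y, normalizedDiff e y * normalizedDiff e' y ∂((ν.prod ν).prod volume) =
      ∫ p, e p * e' p ∂(ν.prod volume) := by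
  have m1 := measurePreserving_firstPoint ν
  have m2 := measurePreserving_secondPoint ν
  have a1 := he.comp_measurePreserving m1
  have a2 := he.comp_measurePreserving m2
  have b1 := he'.comp_measurePreserving m1
  have b2 := he'.comp_measurePreserving m2
  have i11 : Integrable (fun y => e (firstPoint y) * e' (firstPoint y)) ((ν.prod ν).prod volume) :=
    a1.integrable_mul b1
  have i12 : Integrable (fun y => e (firstPoint y) * e' (secondPoint y)) ((ν.prod ν).prod volume) :=
    a1.integrable_mul b2
  have i21 : Integrable (fun y => e (secondPoint y) * e' (firstPoint y)) ((ν.prod ν).prod volume) :=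
    a2.integrable_mul b1
  have i22 : Integrable (fun y => e (secondPoint y) * e' (secondPoint y))
    ((ν.prod ν).prod volume) := a2.integrable_mul b2
  have j11 : ∫ y, e (firstPoint y) * e' (firstPoint y) ∂((ν.prod ν).prod volume) =
      ∫ p, e p * e' p ∂(ν.prod volume) :=
    integral_comp_of_map_eq m1.measurable m1.map_eq (g := fun p => e p * e' p)
      (he.1.mul he'.1)
  have j22 : ∫ y, e (secondPoint y) * e' (secondPoint y) ∂((ν.prod ν).prod volume) =
      ∫ p, e p * e' p ∂(ν.prod volume) :=
    integral_comp_of_map_eq m2.measurable m2.map_eq (g := fun p => e p * e' p)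
      (he.1.mul he'.1)
  have j12 : ∫ y, e (firstPoint y) * e' (secondPoint y) ∂((ν.prod ν).prod volume) = 0 := by
    rw [integral_prod_symm _ i12]
    refine integral_eq_zero_of_ae ?_
    filter_upwards [h0] with t ht
    have := integral_prod_mul (μ := ν) (ν := ν) (fun x => e (x, t)) fun x => e' (x, t)
    simp only [firstPoint, secondPoint, this, ht, zero_mul, Pi.zero_apply]
  have j21 : ∫ y, e (secondPoint y) * e' (firstPoint y) ∂((ν.prod ν).prod volume) = 0 := by
    rw [integral_prod_symm _ i21]
    refine integral_eq_zero_of_ae ?_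
    filter_upwards [h0] with t ht
    have := integral_prod_mul (μ := ν) (ν := ν) (fun x => e' (x, t)) fun x => e (x, t)
    simp only [firstPoint, secondPoint, mul_comm (e _), this, ht, mul_zero, Pi.zero_apply]
  have e1 : ∀ y, normalizedDiff e y * normalizedDiff e' y = 1 / 2 *
      (e (firstPoint y) * e' (firstPoint y) - e (firstPoint y) * e' (secondPoint y) -
        (e (secondPoint y) * e' (firstPoint y) - e (secondPoint y) * e' (secondPoint y))) :=
    fun y => by
      have h22 : (√2)⁻¹ * (√2)⁻¹ = (1 / 2 : ℝ) := by
        rw [← mul_inv, Real.mul_self_sqrt two_pos.le, one_div]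
      simp only [normalizedDiff]
      rw [mul_mul_mul_comm, h22]; ring
  simp only [e1]
  have k1 : Integrable (fun y => e (firstPoint y) * e' (firstPoint y) -
    e (firstPoint y) * e' (secondPoint y)) ((ν.prod ν).prod volume) := i11.sub i12
  have k2 : Integrable (fun y => e (secondPoint y) * e' (firstPoint y) -
    e (secondPoint y) * e' (secondPoint y)) ((ν.prod ν).prod volume) := i21.sub i22
  rw [integral_const_mul, integral_sub k1 k2, integral_sub i11 i12,
    integral_sub i21 i22, j11, j12, j21, j22]
  ring

/-- Alternation sends `e ⊗ e` to the tensor square of the difference of `e` at the two points, which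
is twice that of the normalized difference. -/
lemma altKernel_sub_sum {ι : Type*} (K : S × unitInterval → S × unitInterval → ℝ)
    (F : Finset ι) (c : ι → ℝ) (e : ι → S × unitInterval → ℝ) (y z : (S × S) × unitInterval) :
    altKernel (fun p q => K p q - ∑ r ∈ F, c r * (e r p * e r q)) y z =
      altKernel K y z - 2 * ∑ r ∈ F, c r * (normalizedDiff (e r) y * normalizedDiff (e r) z) := by
  have h22 : (√2)⁻¹ * (√2)⁻¹ = (1 / 2 : ℝ) := by
    rw [← mul_inv, Real.mul_self_sqrt two_pos.le, one_div]
  have h : ∀ r, c r * (normalizedDiff (e r) y * normalizedDiff (e r) z) = 1 / 2 *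
      (c r * (e r (firstPoint y) * e r (firstPoint z)) -
      c r * (e r (secondPoint y) * e r (firstPoint z)) -
      c r * (e r (firstPoint y) * e r (secondPoint z)) +
      c r * (e r (secondPoint y) * e r (secondPoint z))) := fun r => by
    simp only [normalizedDiff]
    rw [mul_mul_mul_comm, h22]; ring
  simp only [h, altKernel, ← Finset.mul_sum, Finset.sum_add_distrib, Finset.sum_sub_distrib]
  ring

variable {ι : Type*} {K : S × unitInterval → S × unitInterval → ℝ}

/-- The remainders of the eigenfunction expansion of a kernel tend to zero in `L²`. -/
lemma tendsto_integral_sq_remainder {A : Type*} [MeasurableSpace A] {m : Measure A}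
    [IsFiniteMeasure m] {K : A → A → ℝ} (hg : MemLp (Function.uncurry K) 2 (m.prod m))
    {e : ι → Lp ℝ 2 m} (he : Orthonormal ℝ e) {c : ι → ℝ}
    (hc : ∀ r, integralOperator m K hg (e r) = c r • e r)
    (hsum : HasSum (fun r => c r ^ 2) (∫ p : A × A, K p.1 p.2 ^ 2 ∂(m.prod m))) :
    (∀ F : Finset ι, MemLp (Function.uncurry fun p q => K p q - ∑ r ∈ F, c r * (e r p * e r q)) 2
      (m.prod m)) ∧
    Tendsto (fun F : Finset ι => ∫ p : A × A,
      (K p.1 p.2 - ∑ r ∈ F, c r * (e r p.1 * e r p.2)) ^ 2 ∂(m.prod m)) atTop (𝓝 0) := by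
  have hn : ‖hg.toLp _‖ ^ 2 = ∫ p : A × A, K p.1 p.2 ^ 2 ∂(m.prod m) := by
    rw [norm_sq_Lp_two]
    simp only [Real.norm_eq_abs, sq_abs, Function.uncurry]
  rw [← hn] at hsum
  rw [integralOperator_eq_kernelOp] at hc
  have hexp := hasSum_eigenfunction_expansion he (l := c) hc (by simpa using hsum)
  have hmem : ∀ F : Finset ι, MemLp (fun p : A × A =>
      K p.1 p.2 - ∑ r ∈ F, c r * (e r p.1 * e r p.2)) 2 (m.prod m) := fun F => by
    refine hg.sub (memLp_finsetSum _ fun r _ => MemLp.const_mul ?_ _)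
    simpa using memLp_tensor (Lp.memLp (e r)) (Lp.memLp (e r))
  refine ⟨hmem, ?_⟩
  have heq : ∀ F : Finset ι, ∫ p : A × A,
      (K p.1 p.2 - ∑ r ∈ F, c r * (e r p.1 * e r p.2)) ^ 2 ∂(m.prod m) =
      ‖hg.toLp _ - ∑ r ∈ F, c r • tensorLp (e r) (e r)‖ ^ 2 := fun F => by
    rw [← Lp.toLp_coeFn (hg.toLp _ - ∑ r ∈ F, c r • tensorLp (e r) (e r)) (Lp.memLp _),
      norm_sq_Lp_two]
    refine integral_congr_ae ?_
    have h2 : ∀ᵐ p ∂(m.prod m), ∀ r ∈ F, (c r • tensorLp (e r) (e r) : Lp ℝ 2 (m.prod m)) p =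
        c r * (e r p.1 * e r p.2) :=
      (ae_ball_iff F.countable_toSet).2 fun r _ => by
        filter_upwards [Lp.coeFn_smul (c r) (tensorLp (e r) (e r)),
          coeFn_tensorLp (e r) (e r)] with p e1 e2
        rw [e1, Pi.smul_apply, e2, smul_eq_mul, conj_trivial]
    filter_upwards [Lp.coeFn_sub (hg.toLp _) (∑ r ∈ F, c r • tensorLp (e r) (e r)),
      hg.coeFn_toLp, Lp.coeFn_finsetSum (s := F) (fun r => c r • tensorLp (e r) (e r)), h2]
      with p e1 e2 e3 e4
    rw [e1, Pi.sub_apply, e2, e3, Finset.sum_apply, Finset.sum_congr rfl e4, Real.norm_eq_abs,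
      sq_abs]
    rfl
  simp only [heq]
  have h3 : Tendsto (fun F : Finset ι => ∑ r ∈ F, c r • tensorLp (e r) (e r)) atTop
    (𝓝 (hg.toLp _)) := hexp
  have h4 := (h3.const_sub (hg.toLp _)).norm.pow 2
  simpa using h4

variable {Ω : Type*} [MeasurableSpace Ω] {P : Measure Ω} [IsProbabilityMeasure P]

/-- The limit law of the `U`-statistic of an alternating kernel. -/
lemma tendsto_charFun_altKernel {Y : ℕ → Ω → (S × S) × unitInterval}
    (hYm : ∀ i, Measurable (Y i)) (hYi : iIndepFun Y P)
    (hYρ : ∀ i, P.map (Y i) = (ν.prod ν).prod volume) (hK : Measurable (Function.uncurry K))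
    (hg : MemLp (Function.uncurry K) 2
      ((ν.prod (volume : Measure unitInterval)).prod (ν.prod (volume : Measure unitInterval))))
    {e : ι → Lp ℝ 2 (ν.prod (volume : Measure unitInterval))} (he : Orthonormal ℝ e) {c : ι → ℝ}
    (hc : ∀ r, integralOperator _ K hg (e r) = c r • e r)
    (h0 : ∀ r, ∀ᵐ t ∂(volume : Measure unitInterval), ∫ x, e r (x, t) ∂ν = 0)
    (hsum : HasSum (fun r => c r ^ 2) (∫ p : (S × unitInterval) × (S × unitInterval),
      K p.1 p.2 ^ 2 ∂((ν.prod volume).prod (ν.prod volume)))) {t : ℝ} {z : ℂ}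
    (hz : HasProd (fun r => chaosChar (c r * t)) z) :
    Tendsto (fun n : ℕ => charFun (P.map fun ω => (1 / 2 * (n : ℝ)⁻¹) *
      ∑ q ∈ ltPairs n, altKernel K (Y q.1 ω) (Y q.2 ω)) t) atTop (𝓝 z) := by
  classical
  obtain ⟨hmem, hrem⟩ := tendsto_integral_sq_remainder hg he hc hsum
  have hem : ∀ r, Measurable (e r) := fun r => (Lp.stronglyMeasurable (e r)).measurable
  have hort := orthonormal_iff_ite.1 he
  have hin : ∀ r s, ∫ y, normalizedDiff (e r) y * normalizedDiff (e s) y ∂((ν.prod ν).prod volume)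
      = inner ℝ (e r) (e s) := fun r s => by
    rw [integral_normalizedDiff_mul (Lp.memLp _) (Lp.memLp _) (h0 r), L2.inner_def]
    refine integral_congr_ae (ae_of_all _ fun p => ?_)
    simp only [RCLike.inner_apply', conj_trivial]
  let δ : Finset ι → ℝ := fun F => ∫ p : (S × unitInterval) × (S × unitInterval),
    (K p.1 p.2 - ∑ r ∈ F, c r * (e r p.1 * e r p.2)) ^ 2 ∂((ν.prod volume).prod (ν.prod volume))
  let full : ℕ → Ω → ℝ := fun n ω => (1 / 2 * (n : ℝ)⁻¹) *
      ∑ q ∈ ltPairs n, altKernel K (Y q.1 ω) (Y q.2 ω)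
  -- The prefactor loses its `1 / 2` because alternating a tensor square produces a factor `2`.
  let trunc : Finset ι → ℕ → Ω → ℝ := fun F n ω => (n : ℝ)⁻¹ * ∑ q ∈ ltPairs n,
    ∑ r : F, c r * (normalizedDiff (e r) (Y q.1 ω) * normalizedDiff (e r) (Y q.2 ω))
  have htrunc : ∀ F : Finset ι, Tendsto (fun n => charFun (P.map (trunc F n)) t) atTop
      (𝓝 (∏ r ∈ F, chaosChar (c r * t))) := fun F => by
    have := tendsto_charFun_finite_rank (κ := F) hYm hYi hYρ
      (h := fun r => normalizedDiff (e r)) (fun r => measurable_normalizedDiff (hem r))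
      (fun r => memLp_normalizedDiff (Lp.memLp _)) (fun r => integral_normalizedDiff (Lp.memLp _))
      (fun r => by rw [hin, hort, if_pos rfl])
      (fun r s hrs => by rw [hin, hort, if_neg fun h => hrs (Subtype.ext h)]) (fun r => c r) t
    rwa [Finset.prod_coe_sort F fun r => chaosChar (c r * t)] at this
  -- The difference is the statistic of the alternated remainder kernel. That kernel is degenerate,
  -- so its terms are orthogonal and the bound does not depend on `n`.
  have hclose : ∀ (F : Finset ι) (n : ℕ), ‖charFun (P.map (full n)) t -
      charFun (P.map (trunc F n)) t‖ ≤ |t| * √(2 * δ F) := fun F n => by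
    let D : S × unitInterval → S × unitInterval → ℝ := fun p q =>
      K p q - ∑ r ∈ F, c r * (e r p * e r q)
    have hD : Measurable (Function.uncurry D) :=
      hK.sub (Finset.measurable_fun_sum _ fun r _ =>
        (((hem r).comp measurable_fst).mul ((hem r).comp measurable_snd)).const_mul _)
    have hDm := memLp_altKernel ν (hmem F)
    have hpair : ∀ q ∈ ltPairs n, MeasurePreserving (fun ω => (Y q.1 ω, Y q.2 ω)) P
        (((ν.prod ν).prod volume).prod ((ν.prod ν).prod volume)) := fun q hq =>
      map_pair_of_iIndepFun hYm hYi hYρ (mem_ltPairs.1 hq).1.ne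
    have hKm : ∀ q ∈ ltPairs n, MemLp (fun ω => altKernel K (Y q.1 ω) (Y q.2 ω)) 2 P :=
      fun q hq => (memLp_altKernel ν hg).comp_measurePreserving (hpair q hq)
    have hfull : MemLp (full n) 2 P := (memLp_finsetSum _ hKm).const_mul _
    have hdiff : (fun ω => full n ω - trunc F n ω) = fun ω => ∑ q ∈ ltPairs n,
        (1 / 2 * (n : ℝ)⁻¹) * altKernel D (Y q.1 ω) (Y q.2 ω) := by
      ext ω
      simp only [full, trunc, D, altKernel_sub_sum, ← Finset.mul_sum]
      rw [Finset.sum_sub_distrib, ← Finset.mul_sum, mul_sub]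
      congr 1
      rw [← mul_assoc, show 1 / 2 * (n : ℝ)⁻¹ * 2 = (n : ℝ)⁻¹ by ring]
      congr 1
      refine Finset.sum_congr rfl fun q _ => ?_
      exact Finset.sum_coe_sort F fun r =>
        c r * (normalizedDiff (e r) (Y q.1 ω) * normalizedDiff (e r) (Y q.2 ω))
    have hdm : MemLp (fun ω => full n ω - trunc F n ω) 2 P := by
      rw [hdiff]
      exact memLp_finsetSum _ fun q hq => (hDm.comp_measurePreserving (hpair q hq)).const_mul _
    have htm : MemLp (trunc F n) 2 P := by
      have := hfull.sub hdm
      refine this.ae_eq (ae_of_all _ fun ω => ?_)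
      simp
    refine (norm_charFun_sub_le hfull.aemeasurable htm.aemeasurable hdm t).trans ?_
    refine mul_le_mul_of_nonneg_left ?_ (abs_nonneg t)
    rw [toReal_eLpNorm_two hdm]
    refine Real.sqrt_le_sqrt ?_
    have hsq : ∫ ω, (full n ω - trunc F n ω) ^ 2 ∂P = ∫ ω, (∑ q ∈ ltPairs n,
        (1 / 2 * (n : ℝ)⁻¹) * altKernel D (Y q.1 ω) (Y q.2 ω)) ^ 2 ∂P := by
      refine integral_congr_ae (ae_of_all _ fun ω => ?_)
      exact congrArg (· ^ 2) (congr_fun hdiff ω)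
    rw [hsq, integral_sq_sum_degenerate hYm hYi hYρ (measurable_altKernel hD) hDm
      (ae_of_all _ (integral_altKernel_right ν hD)) (ae_of_all _ (integral_altKernel_left ν hD))
      (ltPairs n) (fun q hq => (mem_ltPairs.1 hq).1) fun _ => 1 / 2 * (n : ℝ)⁻¹]
    have h16 := integral_sq_altKernel_le ν hD (hmem F)
    have hδ : ∫ p : (S × unitInterval) × (S × unitInterval), D p.1 p.2 ^ 2
      ∂((ν.prod volume).prod (ν.prod volume)) = δ F := rfl
    rw [hδ] at h16
    have hδ0 : 0 ≤ δ F := integral_nonneg fun _ => sq_nonneg _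
    -- There are `n (n - 1) / 2` pairs of weight `1 / (4 n²)`; together with the factor `16` this
    -- yields `2 * δ F`.
    have hw : ∑ q ∈ ltPairs n, (1 / 2 * (n : ℝ)⁻¹) ^ 2 ≤ 1 / 8 := by
      rw [Finset.sum_const, nsmul_eq_mul, card_ltPairs]
      rcases Nat.eq_zero_or_pos n with rfl | hn
      · norm_num
      · have hn' : (0 : ℝ) < n := by exact_mod_cast hn
        rw [mul_pow, inv_pow, div_mul_eq_mul_div, div_le_div_iff₀ (by norm_num) (by norm_num)]
        have : (n : ℝ) * (n - 1) * ((n : ℝ) ^ 2)⁻¹ ≤ 1 := by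
          rw [← div_eq_mul_inv, div_le_one (by positivity)]
          nlinarith
        nlinarith
    calc _ ≤ 1 / 8 * (16 * δ F) := mul_le_mul hw h16 (integral_nonneg fun _ => sq_nonneg _)
          (by norm_num)
      _ = 2 * δ F := by ring
  have hb : Tendsto (fun F => |t| * √(2 * δ F)) atTop (𝓝 0) := by
    have := ((hrem.const_mul 2).sqrt).const_mul |t|
    simpa using this
  rw [Metric.tendsto_atTop]
  intro ε hε
  have h1 := hb.eventually (gt_mem_nhds (show 0 < ε / 3 by positivity))
  have h2 : ∀ᶠ F in atTop, dist (∏ r ∈ F, chaosChar (c r * t)) z < ε / 3 :=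
    (Metric.tendsto_nhds.1 hz) (ε / 3) (by positivity)
  -- The truncation is fixed before `n`, which the uniform bound permits.
  obtain ⟨F, hF1, hF2⟩ := (h1.and h2).exists
  obtain ⟨N, hN⟩ := (Metric.tendsto_atTop.1 (htrunc F)) (ε / 3) (by positivity)
  refine ⟨N, fun n hn => ?_⟩
  have h3 := hN n hn
  have h4 : dist (charFun (P.map (full n)) t) (charFun (P.map (trunc F n)) t) < ε / 3 := by
    rw [dist_eq_norm]
    exact (hclose F n).trans_lt hF1
  calc dist (charFun (P.map (full n)) t) z ≤ _ := dist_triangle4 _ _ _ _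
    _ < ε / 3 + ε / 3 + ε / 3 := add_lt_add (add_lt_add h4 h3) hF2
    _ = ε := by ring

end LimitLaw

/-! ### The limit law of the bi-alternating statistic -/

section BiAltLimit

set_option linter.unusedSectionVars false

variable {Ω S : Type*} [MeasurableSpace Ω] [MeasurableSpace S]
  {P : Measure Ω} [IsProbabilityMeasure P] {ν : Measure S} [IsProbabilityMeasure ν]
  {X : ℕ → Ω → S} {f : S → S → ℝ}

/-- Symmetrization in time preserves the `L²` norm of a kernel. -/
lemma integral_sq_hatKernel (hf : Measurable (Function.uncurry f))
    (hf2 : MemLp (Function.uncurry f) 2 (ν.prod ν)) :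
    ∫ p : (S × unitInterval) × (S × unitInterval), hatKernel f p.1 p.2 ^ 2
      ∂((ν.prod (volume : Measure unitInterval)).prod (ν.prod (volume : Measure unitInterval))) =
    ∫ p : S × S, f p.1 p.2 ^ 2 ∂(ν.prod ν) := by
  let M : Measure ((S × unitInterval) × (S × unitInterval)) :=
    (ν.prod (volume : Measure unitInterval)).prod (ν.prod (volume : Measure unitInterval))
  -- `a + b` is the square of the symmetrized kernel, and `a + c` that of `f` at distinct times.
  -- Exchanging the points carries `a` to `b`, and reversing both times carries `a` to `c`, so the
  -- three integrals agree.
  let a : (S × unitInterval) × (S × unitInterval) → ℝ := fun p =>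
    if p.1.2 < p.2.2 then f p.1.1 p.2.1 ^ 2 else 0
  let b : (S × unitInterval) × (S × unitInterval) → ℝ := fun p =>
    if p.2.2 < p.1.2 then f p.2.1 p.1.1 ^ 2 else 0
  let c : (S × unitInterval) × (S × unitInterval) → ℝ := fun p =>
    if p.2.2 < p.1.2 then f p.1.1 p.2.1 ^ 2 else 0
  have mp : MeasurePreserving (fun z : (S × unitInterval) × (S × unitInterval) => (z.1.1, z.2.1))
      M (ν.prod ν) := measurePreserving_fst.prod measurePreserving_fst
  have mpt : MeasurePreserving (fun z : (S × unitInterval) × (S × unitInterval) => (z.1.2, z.2.2))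
      M ((volume : Measure unitInterval).prod volume) :=
    measurePreserving_snd.prod measurePreserving_snd
  have msw : MeasurePreserving Prod.swap M M := Measure.measurePreserving_swap
  have mσ : MeasurePreserving (fun z : (S × unitInterval) × (S × unitInterval) =>
      ((z.1.1, unitInterval.symm z.1.2), (z.2.1, unitInterval.symm z.2.2))) M M :=
    ((MeasurePreserving.id ν).prod unitInterval.measurePreserving_symm).prod
      ((MeasurePreserving.id ν).prod unitInterval.measurePreserving_symm)
  have hm1 : Measurable fun z : (S × unitInterval) × (S × unitInterval) => f z.1.1 z.2.1 ^ 2 :=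
    (hf.comp mp.measurable).pow_const 2
  have hi1 : Integrable (fun z : (S × unitInterval) × (S × unitInterval) => f z.1.1 z.2.1 ^ 2) M :=
    (hf2.comp_measurePreserving mp).integrable_sq
  have ha : Measurable a :=
    Measurable.ite (measurableSet_lt (by fun_prop) (by fun_prop)) hm1 measurable_const
  have hai : Integrable a M := by
    refine hi1.mono ha.aestronglyMeasurable (ae_of_all _ fun z => ?_)
    simp only [a]
    split_ifs
    · exact le_rfl
    · rw [norm_zero]; exact norm_nonneg _
  have eb : b = a ∘ Prod.swap := rfl
  have ec : c = a ∘ fun z : (S × unitInterval) × (S × unitInterval) =>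
      ((z.1.1, unitInterval.symm z.1.2), (z.2.1, unitInterval.symm z.2.2)) := by
    ext z
    simp [a, c]
  have hbi : Integrable b M := eb ▸ msw.integrable_comp_of_integrable hai
  have hci : Integrable c M := ec ▸ mσ.integrable_comp_of_integrable hai
  have hb : ∫ z, b z ∂M = ∫ z, a z ∂M :=
    integral_comp_of_map_eq msw.measurable msw.map_eq ha.aestronglyMeasurable
  have hc : ∫ z, c z ∂M = ∫ z, a z ∂M := by
    rw [ec]
    exact integral_comp_of_map_eq mσ.measurable mσ.map_eq ha.aestronglyMeasurable
  have e1 : ∀ p : (S × unitInterval) × (S × unitInterval),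
      hatKernel f p.1 p.2 ^ 2 = a p + b p := fun p => by
    simp only [hatKernel, a, b]
    rcases lt_trichotomy p.1.2 p.2.2 with h | h | h
    · simp [h, h.le.not_gt]
    · simp [h]
    · simp [h, h.le.not_gt]
  have e2 : ∀ᵐ p ∂M, a p + c p = f p.1.1 p.2.1 ^ 2 := by
    filter_upwards [mpt.quasiMeasurePreserving.ae ae_ne_unitInterval] with p hp
    simp only [a, c]
    rcases lt_trichotomy p.1.2 p.2.2 with h | h | h
    · simp [h, h.le.not_gt]
    · exact (hp h).elim
    · simp [h, h.le.not_gt]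
  change ∫ p, hatKernel f p.1 p.2 ^ 2 ∂M = _
  simp only [e1]
  rw [integral_add hai hbi, hb, ← hc, add_comm, hc, ← hc, add_comm, hc]
  nth_rewrite 2 [← hc]
  rw [← integral_add hai hci, integral_congr_ae e2]
  exact integral_comp_of_map_eq mp.measurable mp.map_eq (g := fun p : S × S => f p.1 p.2 ^ 2)
    (hf.pow_const 2).aestronglyMeasurable

lemma sum_pairKernel_eq (m : ℕ) (ω : Ω) :
    ∑ q ∈ ltPairs m, pairKernel f (X (2 * q.1) ω, X (2 * q.1 + 1) ω)
      (X (2 * q.2) ω, X (2 * q.2 + 1) ω) =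
    biAltU X f (2 * m) ω + ∑ k ∈ Finset.range m, f (X (2 * k) ω) (X (2 * k + 1) ω) := by
  rw [biAltU_two_mul, sum_ltPairs m fun k l => pairKernel f (X (2 * k) ω, X (2 * k + 1) ω)
      (X (2 * l) ω, X (2 * l + 1) ω)]
  ring

lemma linVar_nonneg (n : ℕ) : 0 ≤ linVar ν f n :=
  add_nonneg (variance_nonneg _ _) (variance_nonneg _ _)

/-- Only the parity of `n` matters, so the values at `0` and `1` bound all others. -/
lemma linVar_le (n : ℕ) : linVar ν f n ≤ linVar ν f 0 + linVar ν f 1 := by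
  have h0 := linVar_nonneg (ν := ν) (f := f) 0
  have h1 := linVar_nonneg (ν := ν) (f := f) 1
  rcases Nat.even_or_odd' n with ⟨m, rfl | rfl⟩
  · have : linVar ν f (2 * m) = linVar ν f 0 := (linVar_even m).trans (linVar_even 0).symm
    linarith
  · have : linVar ν f (2 * m + 1) = linVar ν f 1 := (linVar_odd m).trans (linVar_odd 0).symm
    linarith

/-- For even `n` nothing is dropped; for odd `n` the difference consists of the `n - 1` orthogonal
terms that contain the last variable. -/
lemma integral_sq_biAltU_sub (hXm : ∀ i, Measurable (X i)) (hXi : iIndepFun X P)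
    (hXν : ∀ i, P.map (X i) = ν) (hf : Measurable (Function.uncurry f))
    (hf2 : MemLp (Function.uncurry f) 2 (ν.prod ν)) (n : ℕ) :
    ∫ ω, (biAltU X (hoeffding12 ν f) n ω - biAltU X (hoeffding12 ν f) (2 * (n / 2)) ω) ^ 2 ∂P ≤
      n * Var[fun ω => hoeffding12 ν f (X 0 ω) (X 1 ω); P] := by
  have hsub : ltPairs (2 * (n / 2)) ⊆ ltPairs n := fun q hq => by
    rw [mem_ltPairs] at hq ⊢; omega
  have e : ∀ ω, biAltU X (hoeffding12 ν f) n ω - biAltU X (hoeffding12 ν f) (2 * (n / 2)) ω =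
      ∑ q ∈ ltPairs n \ ltPairs (2 * (n / 2)),
        (-1 : ℝ) ^ (q.1 + q.2) * hoeffding12 ν f (X q.1 ω) (X q.2 ω) := fun ω => by
    rw [biAltU_eq_sum_ltPairs, biAltU_eq_sum_ltPairs, ← Finset.sum_sdiff hsub]
    ring
  simp only [e]
  rw [integral_sq_sum_hoeffding12 hXm hXi hXν hf hf2 _
    (fun q hq => (mem_ltPairs.1 (Finset.mem_sdiff.1 hq).1).1) fun q => (-1) ^ (q.1 + q.2)]
  refine mul_le_mul_of_nonneg_right ?_ (variance_nonneg _ _)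
  have h1 : ∀ q : ℕ × ℕ, ((-1 : ℝ) ^ (q.1 + q.2)) ^ 2 = 1 := fun q => by
    rw [← pow_mul, mul_comm, pow_mul]; simp
  simp only [h1, Finset.sum_const, nsmul_eq_mul, mul_one]
  rw [Finset.card_sdiff_of_subset hsub, Nat.cast_sub (Finset.card_le_card hsub), card_ltPairs,
    card_ltPairs]
  rcases Nat.even_or_odd' n with ⟨m, rfl | rfl⟩
  · rw [show 2 * m / 2 = m by omega, sub_self]; positivity
  · rw [show (2 * m + 1) / 2 = m by omega]
    push_cast
    have : (0 : ℝ) ≤ m := m.cast_nonneg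
    nlinarith

/-- The statistic is close in `L²` to the alternating sum over pairs of blocks. -/
lemma integral_sq_biAltU_sub_pairs_le (hXm : ∀ i, Measurable (X i)) (hXi : iIndepFun X P)
    (hXν : ∀ i, P.map (X i) = ν) (hf : Measurable (Function.uncurry f))
    (hf2 : MemLp (Function.uncurry f) 2 (ν.prod ν)) {n : ℕ} (hn : 2 ≤ n) :
    ∫ ω, ((n : ℝ)⁻¹ * (biAltU X f n ω - ∫ ω, biAltU X f n ω ∂P) -
      1 / 2 * ((n / 2 : ℕ) : ℝ)⁻¹ * ∑ q ∈ ltPairs (n / 2), pairKernel (hoeffding12 ν f)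
        (X (2 * q.1) ω, X (2 * q.1 + 1) ω) (X (2 * q.2) ω, X (2 * q.2 + 1) ω)) ^ 2 ∂P ≤
      4 * (3 * Var[fun ω => hoeffding12 ν f (X 0 ω) (X 1 ω); P] +
        (linVar ν f 0 + linVar ν f 1)) * (n : ℝ)⁻¹ := by
  have h12 := memLp_hoeffding12 ν hf hf2
  set m := n / 2 with hm
  set V := Var[fun ω => hoeffding12 ν f (X 0 ω) (X 1 ω); P] with hV
  have hV0 : 0 ≤ V := variance_nonneg _ _
  -- The four errors come from replacing the scale `n` by `2 * m`, from an unpaired last variable,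
  -- from the terms inside the blocks and from the linear part. Each has second moment of order
  -- `n⁻¹`.
  let r1 : Ω → ℝ := fun ω => ((n : ℝ)⁻¹ - 1 / 2 * (m : ℝ)⁻¹) * biAltU X (hoeffding12 ν f) (2 * m) ω
  let r2 : Ω → ℝ := fun ω => (n : ℝ)⁻¹ * (biAltU X (hoeffding12 ν f) n ω -
    biAltU X (hoeffding12 ν f) (2 * m) ω)
  let r3 : Ω → ℝ := fun ω => 1 / 2 * (m : ℝ)⁻¹ *
    ∑ k ∈ Finset.range m, hoeffding12 ν f (X (2 * k) ω) (X (2 * k + 1) ω)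
  let r4 : Ω → ℝ := fun ω => (n : ℝ)⁻¹ * linPart ν X f n ω
  have hU := memLp_biAltU hXm hXi hXν h12
  have m1 : MemLp r1 2 P := (hU (2 * m)).const_mul _
  have m2 : MemLp r2 2 P := ((hU n).sub (hU (2 * m))).const_mul _
  have m3 : MemLp r3 2 P := (memLp_finsetSum _ fun k _ =>
    memLp_kernel_comp hXm hXi hXν h12 (by omega)).const_mul _
  have m4 : MemLp r4 2 P := (memLp_linPart hXm hXν hf hf2 n).const_mul _
  have hn0 : (0 : ℝ) < n := by exact_mod_cast (by omega : 0 < n)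
  have hm0 : (0 : ℝ) < m := by exact_mod_cast (by omega : 0 < m)
  have hmn : (2 : ℝ) * m ≤ n := by exact_mod_cast (by omega : 2 * m ≤ n)
  have hmn' : (n : ℝ) ≤ 2 * m + 1 := by exact_mod_cast (by omega : n ≤ 2 * m + 1)
  have hm1 : (1 : ℝ) ≤ m := by exact_mod_cast (by omega : 1 ≤ m)
  have e : ∀ ω, (n : ℝ)⁻¹ * (biAltU X f n ω - ∫ ω, biAltU X f n ω ∂P) -
      1 / 2 * (m : ℝ)⁻¹ * ∑ q ∈ ltPairs m, pairKernel (hoeffding12 ν f)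
        (X (2 * q.1) ω, X (2 * q.1 + 1) ω) (X (2 * q.2) ω, X (2 * q.2 + 1) ω) =
      r1 ω + r2 ω - r3 ω - r4 ω := fun ω => by
    rw [biAltU_sub_integral hXm hXi hXν hf hf2, sum_pairKernel_eq]
    simp only [r1, r2, r3, r4]
    ring
  simp only [e]
  have b1 : ∫ ω, r1 ω ^ 2 ∂P ≤ V * (n : ℝ)⁻¹ := by
    simp only [r1, mul_pow]
    rw [integral_const_mul, integral_sq_biAltU_hoeffding12 hXm hXi hXν hf hf2, ← hV]
    -- The numerator `n - 2 * m` is `0` or `1`, so the change of scale is of order `n⁻²`.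
    have h1 : (n : ℝ)⁻¹ - 1 / 2 * (m : ℝ)⁻¹ = -((n - 2 * m) / (n * (2 * m))) := by
      field_simp; ring
    have h2 : ((n - 2 * m) / (n * (2 * m)) : ℝ) ≤ 1 / (n * (2 * m)) := by
      gcongr; linarith
    have h3 : (0 : ℝ) ≤ (n - 2 * m) / (n * (2 * m)) :=
      div_nonneg (by linarith) (by positivity)
    rw [h1, neg_sq]
    push_cast
    calc ((n - 2 * m) / (n * (2 * m)) : ℝ) ^ 2 * (2 * m * (2 * m - 1) / 2 * V)
        ≤ (1 / (n * (2 * m))) ^ 2 * (2 * m * (2 * m) / 2 * V) := by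
          have h6 : (0 : ℝ) ≤ 2 * m - 1 := by linarith
          refine mul_le_mul (pow_le_pow_left₀ h3 h2 2) ?_
            (mul_nonneg (div_nonneg (mul_nonneg (by positivity) h6) zero_le_two) hV0)
            (by positivity)
          gcongr
          linarith
      _ = V * (n : ℝ)⁻¹ * (1 / 2 * (n : ℝ)⁻¹) := by field_simp
      _ ≤ V * (n : ℝ)⁻¹ * 1 := by
          gcongr
          have : (n : ℝ)⁻¹ ≤ 1 := inv_le_one_of_one_le₀ (by linarith)
          linarith
      _ = _ := mul_one _
  have b2 : ∫ ω, r2 ω ^ 2 ∂P ≤ V * (n : ℝ)⁻¹ := by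
    simp only [r2, mul_pow]
    rw [integral_const_mul]
    have := integral_sq_biAltU_sub hXm hXi hXν hf hf2 n
    calc _ ≤ (n : ℝ)⁻¹ ^ 2 * (n * V) := by gcongr
      _ = V * (n : ℝ)⁻¹ := by field_simp
  have b3 : ∫ ω, r3 ω ^ 2 ∂P ≤ V * (n : ℝ)⁻¹ := by
    have hinj : Set.InjOn (fun k : ℕ => (2 * k, 2 * k + 1)) (Finset.range m : Set ℕ) :=
      fun a _ b _ h => by simp at h; omega
    have e3 : ∀ ω, r3 ω = ∑ q ∈ (Finset.range m).image (fun k : ℕ => (2 * k, 2 * k + 1)),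
        (1 / 2 * (m : ℝ)⁻¹) * hoeffding12 ν f (X q.1 ω) (X q.2 ω) := fun ω => by
      rw [Finset.sum_image hinj, ← Finset.mul_sum]
    simp only [e3]
    rw [integral_sq_sum_hoeffding12 hXm hXi hXν hf hf2 _ (fun q hq => by
      obtain ⟨k, _, rfl⟩ := Finset.mem_image.1 hq
      exact Nat.lt_succ_self _) fun _ => 1 / 2 * (m : ℝ)⁻¹, Finset.sum_const,
      Finset.card_image_of_injOn hinj, Finset.card_range, nsmul_eq_mul, ← hV, mul_comm V]
    refine mul_le_mul_of_nonneg_right ?_ hV0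
    rw [show (m : ℝ) * (1 / 2 * (m : ℝ)⁻¹) ^ 2 = (4 * m : ℝ)⁻¹ by field_simp; norm_num]
    exact inv_anti₀ hn0 (by linarith)
  have b4 : ∫ ω, r4 ω ^ 2 ∂P ≤ (linVar ν f 0 + linVar ν f 1) * (n : ℝ)⁻¹ := by
    simp only [r4, mul_pow]
    rw [integral_const_mul, integral_sq_linPart hXm hXi hXν hf hf2]
    have h0 := linVar_nonneg (ν := ν) (f := f) n
    have h1 := linVar_le (ν := ν) (f := f) n
    calc (n : ℝ)⁻¹ ^ 2 * ((n / 2 : ℕ) * linVar ν f n)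
        ≤ (n : ℝ)⁻¹ ^ 2 * (n * (linVar ν f 0 + linVar ν f 1)) := by
          gcongr
          exact Nat.div_le_self n 2
      _ = _ := by field_simp
  have hs : ∫ ω, (r1 ω + r2 ω - r3 ω - r4 ω) ^ 2 ∂P ≤
      ∫ ω, 4 * (r1 ω ^ 2 + r2 ω ^ 2 + r3 ω ^ 2 + r4 ω ^ 2) ∂P := by
    refine integral_mono (((m1.add m2).sub m3).sub m4).integrable_sq
      ((((m1.integrable_sq.add m2.integrable_sq).add m3.integrable_sq).add
        m4.integrable_sq).const_mul 4) fun ω => ?_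
    change (r1 ω + r2 ω - r3 ω - r4 ω) ^ 2 ≤ 4 * (r1 ω ^ 2 + r2 ω ^ 2 + r3 ω ^ 2 + r4 ω ^ 2)
    nlinarith [sq_nonneg (r1 ω - r2 ω), sq_nonneg (r1 ω + r3 ω), sq_nonneg (r1 ω + r4 ω),
      sq_nonneg (r2 ω + r3 ω), sq_nonneg (r2 ω + r4 ω), sq_nonneg (r3 ω - r4 ω)]
  refine hs.trans ?_
  have i1 := m1.integrable_sq
  have i2 := m2.integrable_sq
  have i3 := m3.integrable_sq
  have i4 := m4.integrable_sq
  have i12 : Integrable (fun ω => r1 ω ^ 2 + r2 ω ^ 2) P := i1.add i2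
  have i123 : Integrable (fun ω => r1 ω ^ 2 + r2 ω ^ 2 + r3 ω ^ 2) P := i12.add i3
  rw [integral_const_mul, integral_add i123 i4, integral_add i12 i3, integral_add i1 i2]
  linarith

lemma memLp_pairKernel_comp (hXm : ∀ i, Measurable (X i)) (hXi : iIndepFun X P)
    (hXν : ∀ i, P.map (X i) = ν) (hf2 : MemLp (Function.uncurry f) 2 (ν.prod ν)) {k l : ℕ}
    (hkl : k < l) : MemLp (fun ω => pairKernel f (X (2 * k) ω, X (2 * k + 1) ω)
      (X (2 * l) ω, X (2 * l + 1) ω)) 2 P := by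
  have h : ∀ i j, i ≠ j → MemLp (fun ω => f (X i ω) (X j ω)) 2 P :=
    fun i j hij => memLp_kernel_comp hXm hXi hXν hf2 hij
  exact (((h (2 * k) (2 * l) (by omega)).sub (h (2 * k + 1) (2 * l) (by omega))).sub
    (h (2 * k) (2 * l + 1) (by omega))).add (h (2 * k + 1) (2 * l + 1) (by omega))

variable {Ω' : Type*} [MeasurableSpace Ω'] {P' : Measure Ω'} [IsProbabilityMeasure P'] {ι : Type*}

/-- If eigenvalues exhaust the `L²` norm of the symmetrized kernel, they determine the limit law
of the bi-alternating `U`-statistic. -/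
theorem tendstoInDistribution_biAltU (hXm : ∀ i, Measurable (X i)) (hXi : iIndepFun X P)
    (hXν : ∀ i, P.map (X i) = ν) (hf : Measurable (Function.uncurry f))
    (hf2 : MemLp (Function.uncurry f) 2 (ν.prod ν))
    (hg : MemLp (Function.uncurry (hatKernel (hoeffding12 ν f))) 2
      ((ν.prod (volume : Measure unitInterval)).prod (ν.prod (volume : Measure unitInterval))))
    {e : ι → Lp ℝ 2 (ν.prod (volume : Measure unitInterval))} (he : Orthonormal ℝ e) {c : ι → ℝ}
    (hc0 : ∀ r, c r ≠ 0) (hc : ∀ r, integralOperator _ (hatKernel (hoeffding12 ν f)) hg (e r) =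
      c r • e r)
    (hsum : HasSum (fun r => c r ^ 2) Var[fun ω => hoeffding12 ν f (X 0 ω) (X 1 ω); P])
    {W : Ω' → ℝ} (hW : AEMeasurable W P')
    (hprod : ∀ t : ℝ, HasProd (fun r => chaosChar (c r * t)) (charFun (P'.map W) t)) :
    TendstoInDistribution (fun (n : ℕ) ω => (n : ℝ)⁻¹ * (biAltU X f n ω - ∫ ω, biAltU X f n ω ∂P))
      atTop W (fun _ => P) P' := by
  have h12 := memLp_hoeffding12 ν hf hf2
  have hm12 := measurable_hoeffding12 ν hf
  let Z : ℕ → Ω → S × S := fun k ω => (X (2 * k) ω, X (2 * k + 1) ω)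
  have hZm : ∀ k, Measurable (Z k) := fun k => (hXm _).prodMk (hXm _)
  have hZi : iIndepFun Z P := iIndepFun_pairs hXm hXi
  have hZβ : ∀ k, P.map (Z k) = ν.prod ν := fun k =>
    (map_pair_of_iIndepFun hXm hXi hXν (by omega)).map_eq
  let ρ : Measure ((S × S) × unitInterval) := (ν.prod ν).prod volume
  -- `Ω` need not carry independent uniform times, so the timed pairs live on a separate product
  -- space; only laws are compared.
  let P₀ : Measure (ℕ → (S × S) × unitInterval) := Measure.infinitePi fun _ => ρ
  let Y : ℕ → (ℕ → (S × S) × unitInterval) → (S × S) × unitInterval := fun k ω => ω k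
  have hYm : ∀ k, Measurable (Y k) := fun k => measurable_pi_apply k
  have hYi : iIndepFun Y P₀ := iIndepFun_infinitePi (X := fun _ x => x) fun _ => measurable_id
  have hYρ : ∀ k, P₀.map (Y k) = ρ := fun k => Measure.infinitePi_map_eval (fun _ => ρ) k
  have hpk : Measurable (Function.uncurry (pairKernel (hoeffding12 ν f))) := by
    have h : ∀ {a b : S × S → S}, Measurable a → Measurable b →
        Measurable fun p : (S × S) × (S × S) => hoeffding12 ν f (a p.1) (b p.2) := fun ha hb =>
      hm12.comp ((ha.comp measurable_fst).prodMk (hb.comp measurable_snd))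
    exact (((h measurable_fst measurable_fst).sub (h measurable_snd measurable_fst)).sub
      (h measurable_fst measurable_snd)).add (h measurable_snd measurable_snd)
  rw [variance_hoeffding12 hXm hXi hXν hf hf2, ← integral_sq_hatKernel hm12 h12] at hsum
  let A : ℕ → Ω → ℝ := fun m ω => 1 / 2 * (m : ℝ)⁻¹ *
    ∑ q ∈ ltPairs m, pairKernel (hoeffding12 ν f) (Z q.1 ω) (Z q.2 ω)
  have hA2 : ∀ m, MemLp (A m) 2 P := fun m => by
    have hB : MemLp (fun ω => ∑ q ∈ ltPairs m, pairKernel (hoeffding12 ν f) (Z q.1 ω) (Z q.2 ω))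
        2 P := memLp_finsetSum _ fun q hq =>
      memLp_pairKernel_comp hXm hXi hXν h12 (mem_ltPairs.1 hq).1
    exact hB.const_mul _
  have hAt : ∀ t, Tendsto (fun m => charFun (P.map (A m)) t) atTop (𝓝 (charFun (P'.map W) t)) := by
    intro t
    have h := tendsto_charFun_altKernel (P := P₀) hYm hYi hYρ (measurable_hatKernel hm12) hg he hc
      (fun r => ae_integral_eigenfunction_eq_zero hg (integral_hoeffding12_right hf hf2)
        (integral_hoeffding12_left hf hf2) (hc0 r) (hc r)) hsum (hprod t)
    refine h.congr fun m => ?_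
    rw [← hatKernel_pairKernel, charFun_map_sum_hatKernel hZm hZi hZβ hYm hYi hYρ hpk]
  have hhalf : Tendsto (fun n : ℕ => n / 2) atTop atTop :=
    Nat.tendsto_div_const_atTop two_ne_zero
  have hdist : TendstoInDistribution (fun n => A (n / 2)) atTop W (fun _ => P) P' :=
    tendstoInDistribution_of_tendsto_charFun (fun n => (hA2 _).aemeasurable) hW
      fun t => (hAt t).comp hhalf
  refine hdist.of_integral_sq_sub (fun n => hA2 _) (fun n => ?_) ?_
  · exact ((memLp_biAltU hXm hXi hXν hf2 n).sub (memLp_const _)).const_mul _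
  · have hlim := (tendsto_inv_atTop_nhds_zero_nat (𝕜 := ℝ)).const_mul
      (4 * (3 * Var[fun ω => hoeffding12 ν f (X 0 ω) (X 1 ω); P] +
        (linVar ν f 0 + linVar ν f 1)))
    rw [mul_zero] at hlim
    refine squeeze_zero' (Eventually.of_forall fun n => integral_nonneg fun _ => sq_nonneg _)
      ?_ hlim
    filter_upwards [eventually_ge_atTop 2] with n hn
    exact integral_sq_biAltU_sub_pairs_le hXm hXi hXν hf hf2 hn

end BiAltLimit

/-! ### Symmetric kernels -/

section SymmetricKernels

set_option linter.unusedSectionVars false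

variable {S : Type*} [MeasurableSpace S] {ν : Measure S} [IsProbabilityMeasure ν] {f : S → S → ℝ}

lemma hoeffding12_swap_of_symmetric (hs : ∀ᵐ p ∂(ν.prod ν), f p.1 p.2 = f p.2 p.1) :
    ∀ᵐ p ∂(ν.prod ν), hoeffding12 ν f p.1 p.2 = hoeffding12 ν f p.2 p.1 := by
  have h1 : ∀ᵐ x ∂ν, hoeffding1 ν f x = hoeffding2 ν f x := by
    filter_upwards [Measure.ae_ae_of_ae_prod hs] with x hx
    rw [hoeffding1, hoeffding2, integral_congr_ae hx]
  filter_upwards [hs, Measure.quasiMeasurePreserving_fst.ae h1,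
    Measure.quasiMeasurePreserving_snd.ae h1] with p e1 e2 e3
  rw [hoeffding12, hoeffding12, e1, e2, e3]
  ring

lemma ae_ne_time : ∀ᵐ p ∂((ν.prod (volume : Measure unitInterval)).prod
    (ν.prod (volume : Measure unitInterval))), p.1.2 ≠ p.2.2 :=
  (measurePreserving_snd.prod measurePreserving_snd :
    MeasurePreserving (Prod.map Prod.snd Prod.snd) ((ν.prod (volume : Measure unitInterval)).prod
      (ν.prod (volume : Measure unitInterval))) (volume.prod volume)).quasiMeasurePreserving.ae
        ae_ne_unitInterval

lemma measurePreserving_points :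
    MeasurePreserving (fun z : (S × unitInterval) × (S × unitInterval) => (z.1.1, z.2.1))
      ((ν.prod (volume : Measure unitInterval)).prod (ν.prod (volume : Measure unitInterval)))
      (ν.prod ν) :=
  measurePreserving_fst.prod measurePreserving_fst

lemma hatKernel_ae_eq_of_symmetric (hs : ∀ᵐ p ∂(ν.prod ν), f p.1 p.2 = f p.2 p.1) :
    ∀ᵐ p ∂((ν.prod (volume : Measure unitInterval)).prod (ν.prod (volume : Measure unitInterval))),
      hatKernel f p.1 p.2 = f p.1.1 p.2.1 := by
  filter_upwards [ae_ne_time, measurePreserving_points.quasiMeasurePreserving.ae hs] with p h1 h2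
  rcases lt_trichotomy p.1.2 p.2.2 with h | h | h
  · simp [hatKernel, h]
  · exact (h1 h).elim
  · simp only [hatKernel, h, h.le.not_gt, if_true, if_false]
    exact h2.symm

lemma hatKernel_comm (p q : S × unitInterval) : hatKernel f p q = hatKernel f q p := by
  simp only [hatKernel]
  rcases lt_trichotomy p.2 q.2 with h | h | h
  · simp [h, h.le.not_gt]
  · simp [h]
  · simp [h, h.le.not_gt]

variable (ν) in
/-- Functions on `S` as functions on `S × [0,1]`. -/
noncomputable def constInTime :
    Lp ℝ 2 ν →ₗᵢ[ℝ] Lp ℝ 2 (ν.prod (volume : Measure unitInterval)) :=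
  Lp.compMeasurePreservingₗᵢ ℝ Prod.fst measurePreserving_fst

lemma coeFn_constInTime (φ : Lp ℝ 2 ν) :
    constInTime ν φ =ᵐ[ν.prod (volume : Measure unitInterval)] fun p => φ p.1 :=
  Lp.coeFn_compMeasurePreserving φ measurePreserving_fst

/-- When neither the kernel nor the function involves time, time integrates out with total mass one,
so the two operators are intertwined. -/
lemma integralOperator_constInTime (h2 : MemLp (Function.uncurry f) 2 (ν.prod ν))
    (hg : MemLp (Function.uncurry fun p q : S × unitInterval => f p.1 q.1) 2
      ((ν.prod (volume : Measure unitInterval)).prod (ν.prod (volume : Measure unitInterval))))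
    (φ : Lp ℝ 2 ν) :
    integralOperator _ (fun p q : S × unitInterval => f p.1 q.1) hg (constInTime ν φ) =
      constInTime ν (integralOperator ν f h2 φ) := by
  refine Lp.ext ?_
  have h1 : ∀ᵐ p ∂(ν.prod (volume : Measure unitInterval)),
      integralOperator ν f h2 φ p.1 = ∫ y, f p.1 y * φ y ∂ν :=
    Measure.quasiMeasurePreserving_fst.ae (integralOperator_apply_ae ν f h2 φ)
  have h3 : ∀ᵐ p ∂(ν.prod (volume : Measure unitInterval)), MemLp (f p.1) 2 ν :=
    Measure.quasiMeasurePreserving_fst.ae (ae_memLp_section ν h2)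
  filter_upwards [integralOperator_apply_ae _ _ hg (constInTime ν φ), h1, h3,
    coeFn_constInTime (integralOperator ν f h2 φ)] with p e1 e2 e3 e4
  rw [e1, e4, e2]
  have e5 : ∫ q, f p.1 q.1 * constInTime ν φ q ∂(ν.prod (volume : Measure unitInterval)) =
      ∫ q : S × unitInterval, f p.1 q.1 * φ q.1 ∂(ν.prod volume) := by
    refine integral_congr_ae ?_
    filter_upwards [coeFn_constInTime φ] with q hq
    rw [hq]
  rw [e5]
  have hp : MeasurePreserving Prod.fst (ν.prod (volume : Measure unitInterval)) ν :=
    measurePreserving_fst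
  exact integral_comp_of_map_eq hp.measurable hp.map_eq (g := fun y => f p.1 y * φ y)
    (e3.1.mul (Lp.aestronglyMeasurable φ))

/-- The value of the operator at `(x, t)` does not involve `t`. Joint measurability of `f` makes `h`
measurable on `S`, and its square integrability descends from the product space. -/
lemma exists_integralOperator_eq_constInTime
    (hg : MemLp (Function.uncurry fun p q : S × unitInterval => f p.1 q.1) 2
      ((ν.prod (volume : Measure unitInterval)).prod (ν.prod (volume : Measure unitInterval))))
    (hf : Measurable (Function.uncurry f))
    (ψ : Lp ℝ 2 (ν.prod (volume : Measure unitInterval))) :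
    ∃ φ, integralOperator _ (fun p q : S × unitInterval => f p.1 q.1) hg ψ = constInTime ν φ := by
  let h : S → ℝ := fun x => ∫ q, f x q.1 * ψ q ∂(ν.prod (volume : Measure unitInterval))
  have hhm : Measurable h := by
    have : StronglyMeasurable (Function.uncurry fun (x : S) (q : S × unitInterval) =>
        f x q.1 * ψ q) := by
      refine Measurable.stronglyMeasurable ?_
      exact (hf.comp (measurable_fst.prodMk (measurable_fst.comp measurable_snd))).mul
        ((Lp.stronglyMeasurable ψ).measurable.comp measurable_snd)
    exact this.integral_prod_right.measurable
  have hp : MeasurePreserving Prod.fst (ν.prod (volume : Measure unitInterval)) ν :=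
    measurePreserving_fst
  have hh2 : MemLp h 2 ν := by
    have h1 : MemLp (fun p : S × unitInterval => h p.1) 2 (ν.prod volume) :=
      memLp_integral_kernel _ hg ψ
    rw [← hp.map_eq]
    exact (memLp_map_measure_iff hhm.aestronglyMeasurable hp.measurable.aemeasurable).2 h1
  refine ⟨hh2.toLp h, Lp.ext ?_⟩
  filter_upwards [integralOperator_apply_ae _ _ hg ψ, coeFn_constInTime (hh2.toLp h),
    Measure.quasiMeasurePreserving_fst.ae hh2.coeFn_toLp] with p e1 e2 e3
  rw [e1, e2, e3]

/-- For `s ≠ 0` an eigenfunction is `s⁻¹` times its image and hence constant in time, so the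
eigenspaces correspond under `constInTime`. At `s = 0` this breaks down: functions with mean zero in
time are annihilated. -/
lemma eigenMultiplicity_constInTime (hf : Measurable (Function.uncurry f))
    (h2 : MemLp (Function.uncurry f) 2 (ν.prod ν))
    (hg : MemLp (Function.uncurry fun p q : S × unitInterval => f p.1 q.1) 2
      ((ν.prod (volume : Measure unitInterval)).prod (ν.prod (volume : Measure unitInterval))))
    {s : ℝ} (hs : s ≠ 0) :
    eigenMultiplicity (integralOperator _ (fun p q : S × unitInterval => f p.1 q.1) hg) s =
      eigenMultiplicity (integralOperator ν f h2) s := by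
  have hinj : Function.Injective (constInTime ν).toLinearMap := (constInTime ν).injective
  have e : Module.End.eigenspace (integralOperator _ (fun p q : S × unitInterval => f p.1 q.1) hg :
      Lp ℝ 2 (ν.prod (volume : Measure unitInterval)) →ₗ[ℝ] Lp ℝ 2 (ν.prod volume)) s =
      (Module.End.eigenspace (integralOperator ν f h2 : Lp ℝ 2 ν →ₗ[ℝ] Lp ℝ 2 ν) s).map
        (constInTime ν).toLinearMap := by
    ext ψ
    rw [Submodule.mem_map, Module.End.mem_eigenspace_iff]
    constructor
    · intro hψ
      obtain ⟨φ, hφ⟩ := exists_integralOperator_eq_constInTime hg hf ψ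
      have h1 : ψ = constInTime ν (s⁻¹ • φ) := by
        rw [map_smul, ← hφ]
        change ψ = s⁻¹ • (integralOperator _ _ hg : Lp ℝ 2 (ν.prod (volume : Measure unitInterval))
          →ₗ[ℝ] Lp ℝ 2 (ν.prod volume)) ψ
        rw [hψ, smul_smul, inv_mul_cancel₀ hs, one_smul]
      refine ⟨s⁻¹ • φ, ?_, h1.symm⟩
      rw [Module.End.mem_eigenspace_iff]
      apply hinj
      change constInTime ν (integralOperator ν f h2 (s⁻¹ • φ)) = constInTime ν (s • s⁻¹ • φ)
      rw [← integralOperator_constInTime h2 hg, map_smul (constInTime ν) s, ← h1]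
      exact hψ
    · rintro ⟨φ, hφ, rfl⟩
      rw [Module.End.mem_eigenspace_iff] at hφ
      change integralOperator _ _ hg (constInTime ν φ) = s • constInTime ν φ
      rw [integralOperator_constInTime h2 hg, ← map_smul]
      exact congrArg _ hφ
  rw [eigenMultiplicity, eigenMultiplicity, e]
  exact congrArg _ (LinearEquiv.rank_eq (Submodule.equivMapOfInjective _ hinj _)).symm

lemma listsNonzeroEigenvalues_congr {E F : Type*} [NormedAddCommGroup E] [NormedSpace ℝ E]
    [NormedAddCommGroup F] [NormedSpace ℝ F] {T : E →L[ℝ] E} {T' : F →L[ℝ] F}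
    (h : ∀ s : ℝ, s ≠ 0 → eigenMultiplicity T s = eigenMultiplicity T' s) {R : ℕ∞}
    (c : SeqIndex R → ℝ) : ListsNonzeroEigenvalues T c ↔ ListsNonzeroEigenvalues T' c := by
  refine and_congr_right fun _ => forall_congr' fun s => ?_
  by_cases hs : s = 0
  · simp [hs]
  · rw [h s hs]

lemma listsNonzeroEigenvalues_hatKernel_iff (hf : Measurable (Function.uncurry f))
    (h2 : MemLp (Function.uncurry f) 2 (ν.prod ν))
    (hg : MemLp (Function.uncurry (hatKernel f)) 2
      ((ν.prod (volume : Measure unitInterval)).prod (ν.prod (volume : Measure unitInterval))))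
    (hs : ∀ᵐ p ∂(ν.prod ν), f p.1 p.2 = f p.2 p.1) {R : ℕ∞} (c : SeqIndex R → ℝ) :
    ListsNonzeroEigenvalues (integralOperator _ (hatKernel f) hg) c ↔
      ListsNonzeroEigenvalues (integralOperator ν f h2) c := by
  have hg' : MemLp (Function.uncurry fun p q : S × unitInterval => f p.1 q.1) 2
      ((ν.prod (volume : Measure unitInterval)).prod (ν.prod (volume : Measure unitInterval))) :=
    h2.comp_measurePreserving measurePreserving_points
  rw [integralOperator_congr hg hg' (hatKernel_ae_eq_of_symmetric hs)]
  exact listsNonzeroEigenvalues_congr (fun s h0 => eigenMultiplicity_constInTime hf h2 hg' h0) c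

end SymmetricKernels

/-! ### Lévy's stochastic area -/

section StochasticArea

/-- The frequency `(2k + 1) π`. -/
noncomputable def oddFreq (k : ℤ) : ℝ := (2 * k + 1) * Real.pi

lemma oddFreq_ne_zero (k : ℤ) : oddFreq k ≠ 0 := by
  refine mul_ne_zero ?_ Real.pi_ne_zero
  exact_mod_cast (by omega : 2 * k + 1 ≠ 0)

lemma oddFreq_neg (n : ℕ) : oddFreq (-(n + 1)) = -oddFreq n := by
  simp only [oddFreq]; push_cast; ring

/-- The even terms account for a quarter of `ζ(2) = π²/6`; the odd ones are the remaining three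
quarters. -/
lemma hasSum_inv_odd_sq : HasSum (fun n : ℕ => 1 / (2 * (n : ℝ) + 1) ^ 2) (Real.pi ^ 2 / 8) := by
  have he : HasSum (fun n : ℕ => 1 / ((2 * n : ℕ) : ℝ) ^ 2) (Real.pi ^ 2 / 24) := by
    have := hasSum_zeta_two.mul_left (1 / 4)
    rw [show 1 / 4 * (Real.pi ^ 2 / 6) = Real.pi ^ 2 / 24 by ring] at this
    refine this.congr_fun fun n => ?_
    push_cast
    rw [mul_pow]
    ring
  have hs : Summable fun n : ℕ => 1 / ((2 * n + 1 : ℕ) : ℝ) ^ 2 :=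
    hasSum_zeta_two.summable.comp_injective (i := fun n : ℕ => 2 * n + 1)
      fun a b h => by simpa using h
  have h := (he.even_add_odd (f := fun n : ℕ => 1 / (n : ℝ) ^ 2) hs.hasSum).unique hasSum_zeta_two
  have h2 : ∑' n : ℕ, 1 / ((2 * n + 1 : ℕ) : ℝ) ^ 2 = Real.pi ^ 2 / 8 := by linarith
  have h3 := h2 ▸ hs.hasSum
  exact_mod_cast h3

lemma sq_two_div_oddFreq (n : ℕ) :
    (2 / oddFreq n) ^ 2 = 4 / Real.pi ^ 2 * (1 / (2 * (n : ℝ) + 1) ^ 2) := by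
  have e : oddFreq n = (2 * (n : ℝ) + 1) * Real.pi := by simp only [oddFreq, Int.cast_natCast]
  rw [e, div_pow, mul_pow, div_mul_div_comm]
  ring

/-- The frequencies with negative index are the opposites of the others, and each half contributes
`1 / 2`. The total `1` is responsible for the unit variance of the stochastic area. -/
lemma hasSum_sq_inv_oddFreq : HasSum (fun k : ℤ => (2 / oddFreq k) ^ 2) 1 := by
  have h : HasSum (fun n : ℕ => (2 / oddFreq n) ^ 2) (1 / 2) := by
    have := hasSum_inv_odd_sq.mul_left (4 / Real.pi ^ 2)
    have e : 4 / Real.pi ^ 2 * (Real.pi ^ 2 / 8) = 1 / 2 := by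
      have := Real.pi_ne_zero
      field_simp; norm_num
    rw [e] at this
    simpa only [sq_two_div_oddFreq] using this
  have h' : HasSum (fun n : ℕ => (2 / oddFreq (-(n + 1))) ^ 2) (1 / 2) := by
    simpa only [oddFreq_neg, div_neg, neg_sq] using h
  have h3 := HasSum.of_nat_of_neg_add_one (f := fun k : ℤ => (2 / oddFreq k) ^ 2) h h'
  rwa [add_halves] at h3

lemma prod_range_two_mul {M : Type*} [CommMonoid M] (a : ℕ → M) (m : ℕ) :
    ∏ i ∈ Finset.range (2 * m), a i =
      (∏ k ∈ Finset.range m, a (2 * k)) * ∏ k ∈ Finset.range m, a (2 * k + 1) := by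
  induction m with
  | zero => simp
  | succ m ih =>
    rw [show 2 * (m + 1) = 2 * m + 1 + 1 by ring, Finset.prod_range_succ, Finset.prod_range_succ,
      ih,
      Finset.prod_range_succ, Finset.prod_range_succ, mul_mul_mul_comm, mul_assoc]

/-- The product formula for the hyperbolic cosine. -/
lemma tendsto_prod_cosh (y : ℝ) :
    Tendsto (fun n : ℕ => ∏ j ∈ Finset.range n, ((1 + (2 * y / oddFreq j) ^ 2 : ℝ) : ℂ)) atTop
      (𝓝 (Real.cosh y : ℂ)) := by
  have hpi : (Real.pi : ℂ) ≠ 0 := by exact_mod_cast Real.pi_ne_zero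
  rcases eq_or_ne y 0 with rfl | hy
  · simp
  -- Here `cosh y = cos (π z) = sin (2 π z) / (2 sin (π z))`. In the quotient of Euler products
  -- truncated at `2 * n` and `n`, the factors with even denominators cancel and the odd frequencies
  -- remain. The case `y = 0` was split off because the denominator would vanish.
  set z : ℂ := Complex.I * y / Real.pi with hz
  have hz2 : z ^ 2 = -(y ^ 2 / Real.pi ^ 2) := by
    rw [hz, div_pow, mul_pow, Complex.I_sq]; ring
  have hpz : Real.pi * z = Complex.I * y := by rw [hz]; field_simp
  have h1 := Complex.tendsto_euler_sin_prod z
  have h2 := (Complex.tendsto_euler_sin_prod (2 * z)).comp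
    (tendsto_id.const_mul_atTop' (two_pos : (0 : ℕ) < 2))
  have hsin : Complex.sin (Real.pi * z) ≠ 0 := by
    rw [hpz, mul_comm, Complex.sin_mul_I]
    refine mul_ne_zero ?_ Complex.I_ne_zero
    exact_mod_cast fun h => hy (Real.sinh_eq_zero.1 h)
  have h3 := h2.div (h1.const_mul 2) (mul_ne_zero two_ne_zero hsin)
  have hlim : Complex.sin (Real.pi * (2 * z)) / (2 * Complex.sin (Real.pi * z)) =
      (Real.cosh y : ℂ) := by
    rw [show (Real.pi : ℂ) * (2 * z) = 2 * (Real.pi * z) by ring, Complex.sin_two_mul,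
      mul_div_cancel_left₀ _ (mul_ne_zero two_ne_zero hsin), hpz, mul_comm, Complex.cos_mul_I,
      Complex.ofReal_cosh]
  rw [hlim] at h3
  refine h3.congr' ?_
  have hne : ∀ᶠ n in atTop, (Real.pi * z * ∏ j ∈ Finset.range n,
      ((1 : ℂ) - z ^ 2 / ((j : ℂ) + 1) ^ 2)) ≠ 0 := h1.eventually_ne hsin
  filter_upwards [hne] with n hn
  change Real.pi * (2 * z) * (∏ j ∈ Finset.range (2 * n),
    ((1 : ℂ) - (2 * z) ^ 2 / ((j : ℂ) + 1) ^ 2)) / (2 * (Real.pi * z * ∏ j ∈ Finset.range n,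
      ((1 : ℂ) - z ^ 2 / ((j : ℂ) + 1) ^ 2))) = _
  rw [prod_range_two_mul]
  have e1 : ∀ k : ℕ, (1 : ℂ) - (2 * z) ^ 2 / (((2 * k + 1 : ℕ) : ℂ) + 1) ^ 2 =
      1 - z ^ 2 / ((k : ℂ) + 1) ^ 2 := fun k => by
    have : ((k : ℂ) + 1) ≠ 0 := by exact_mod_cast Nat.succ_ne_zero k
    push_cast
    rw [show (2 * (k : ℂ) + 1 + 1) = 2 * (k + 1) by ring, mul_pow, mul_pow]
    field_simp
  have e2 : ∀ k : ℕ, (1 : ℂ) - (2 * z) ^ 2 / (((2 * k : ℕ) : ℂ) + 1) ^ 2 =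
      ((1 + (2 * y / oddFreq k) ^ 2 : ℝ) : ℂ) := fun k => by
    have : (2 * (k : ℂ) + 1) ≠ 0 := by exact_mod_cast Nat.succ_ne_zero (2 * k)
    rw [mul_pow, hz2]
    simp only [oddFreq]
    push_cast
    field_simp
    ring
  simp only [e1, e2]
  rw [div_eq_iff (mul_ne_zero two_ne_zero hn)]
  ring

lemma map_family_infinitePi (ι : Type*) :
    (∀ r : ι, Measurable fun x : ι → ℝ => x r) ∧
    iIndepFun (fun (r : ι) (x : ι → ℝ) => x r) (Measure.infinitePi fun _ : ι => gaussianReal 0 1) ∧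
    ∀ r : ι, (Measure.infinitePi fun _ : ι => gaussianReal 0 1).map (fun x => x r) =
      gaussianReal 0 1 :=
  ⟨fun r => measurable_pi_apply r, iIndepFun_infinitePi (X := fun _ x => x) fun _ => measurable_id,
    fun r => Measure.infinitePi_map_eval (fun _ => gaussianReal 0 1) r⟩

/-- Square summable coefficients define a Gaussian chaos of order two. -/
lemma exists_chaos {ι : Type*} {c : ι → ℝ} (hc : Summable fun r => c r ^ 2) :
    ∃ W : (ι → ℝ) → ℝ, MemLp W 2 (Measure.infinitePi fun _ : ι => gaussianReal 0 1) ∧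
      ∫ x, W x ∂(Measure.infinitePi fun _ : ι => gaussianReal 0 1) = 0 ∧
      Var[W; Measure.infinitePi fun _ : ι => gaussianReal 0 1] = 1 / 2 * ∑' r, c r ^ 2 ∧
      ∀ t : ℝ, HasProd (fun r => chaosChar (c r * t))
        (charFun ((Measure.infinitePi fun _ : ι => gaussianReal 0 1).map W) t) := by
  obtain ⟨h1, h2, h3⟩ := map_family_infinitePi ι
  obtain ⟨W, hW, h4, h5, h6⟩ := exists_isL2Sum_chaos h1 h2 h3 hc
  exact ⟨W, hW.1, h4, h5, h6⟩

lemma hasSum_bool {ι : Type*} {a : ι → ℝ} {s : ℝ} (h : HasSum a s) :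
    HasSum (fun p : ι × Bool => a p.1) (2 * s) := by
  have h2 := HasSum.sum (f := fun p : ι ⊕ ι => Sum.elim a a p) h h
  rw [← two_mul] at h2
  let e : ι × Bool ≃ ι ⊕ ι := (Equiv.prodComm _ _).trans (Equiv.boolProdEquivSum ι)
  rw [← e.hasSum_iff] at h2
  refine h2.congr_fun fun p => ?_
  rcases p with ⟨i, _ | _⟩ <;> rfl

/-- Unconditional convergence is inherited from a chaos variable with these coefficients. The value
is then found by regrouping: the two copies of each frequency give squares, and the indices `n` and
`-(n + 1)` give opposite frequencies whose phases cancel. -/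
lemma hasProd_chaosChar_oddFreq (y : ℝ) :
    HasProd (fun p : ℤ × Bool => chaosChar (2 / oddFreq p.1 * y)) ((1 / Real.cosh y : ℝ) : ℂ) := by
  have hs : Summable fun p : ℤ × Bool => (2 / oddFreq p.1) ^ 2 :=
    (hasSum_bool hasSum_sq_inv_oddFreq).summable
  obtain ⟨W, -, -, -, hW⟩ := exists_chaos hs
  have h1 := hW y
  have h2 : HasProd (fun k : ℤ => chaosChar (2 / oddFreq k * y) ^ 2) _ :=
    h1.prod_fiberwise fun k => by
      have := hasProd_fintype fun _ : Bool => chaosChar (2 / oddFreq k * y)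
      simpa [sq] using this
  have h3 := h2.nat_mul_neg_add_one
  have e : ∀ n : ℕ, chaosChar (2 / oddFreq n * y) ^ 2 * chaosChar (2 / oddFreq (-(n + 1)) * y) ^ 2 =
      (((1 + (2 * y / oddFreq n) ^ 2 : ℝ) : ℂ))⁻¹ := fun n => by
    rw [oddFreq_neg, div_neg, neg_mul, chaosChar_sq_mul_chaosChar_neg_sq]
    congr 3
    ring
  simp only [e] at h3
  have h4 := h3.tendsto_prod_nat
  have h5 := (tendsto_prod_cosh y).inv₀ (by exact_mod_cast (Real.cosh_pos y).ne')
  have h6 := tendsto_nhds_unique (h4.congr fun n => by rw [Finset.prod_inv_distrib]) h5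
  rw [h6] at h1
  convert h1 using 1
  push_cast
  rw [one_div]

/-- The chaos with every coefficient `2 / oddFreq k` taken twice has the required characteristic
function, and its variance is `1 / 2 * (2 * 1) = 1`. -/
lemma exists_isStochasticAreaLaw : ∃ ρ : Measure ℝ, IsStochasticAreaLaw ρ ∧
    MemLp id 2 ρ ∧ ∫ x, x ∂ρ = 0 ∧ ∫ x, x ^ 2 ∂ρ = 1 := by
  have hs := hasSum_bool hasSum_sq_inv_oddFreq
  obtain ⟨W, hW, hW0, hWv, hWc⟩ := exists_chaos hs.summable
  have hm := hW.aemeasurable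
  refine ⟨_, ⟨Measure.isProbabilityMeasure_map hm, fun t =>
    (hWc t).unique (hasProd_chaosChar_oddFreq t)⟩, ?_, ?_, ?_⟩
  · exact (memLp_map_measure_iff aestronglyMeasurable_id hm).2 hW
  · rw [integral_map hm (by fun_prop)]
    exact hW0
  · rw [integral_map hm (by fun_prop)]
    rw [variance_of_integral_eq_zero hm hW0, hs.tsum_eq] at hWv
    rw [hWv]; norm_num

lemma IsStochasticAreaLaw.eq {ρ ρ' : Measure ℝ} (h : IsStochasticAreaLaw ρ)
    (h' : IsStochasticAreaLaw ρ') : ρ = ρ' := by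
  have := h.1
  have := h'.1
  refine Measure.ext_of_charFun ?_
  ext t
  rw [h.2, h'.2]

/-- The characteristic function determines the law, so the moments can be read off from the chaos
realization. -/
lemma IsStochasticAreaLaw.moments {ρ : Measure ℝ} (h : IsStochasticAreaLaw ρ) :
    MemLp id 2 ρ ∧ ∫ x, x ∂ρ = 0 ∧ ∫ x, x ^ 2 ∂ρ = 1 := by
  obtain ⟨ρ', h', hm⟩ := exists_isStochasticAreaLaw
  rw [h.eq h']
  exact hm

variable {Ω : Type*} [MeasurableSpace Ω] {P : Measure Ω} [IsProbabilityMeasure P]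

/-- Square summable combinations of independent stochastic areas. -/
lemma exists_isL2Sum_stochasticArea {ι : Type*} {η : ι → Ω → ℝ} (hη : ∀ r, Measurable (η r))
    (hind : iIndepFun η P) (hl : ∀ r, IsStochasticAreaLaw (P.map (η r))) {c : ι → ℝ}
    (hc : Summable fun r => c r ^ 2) :
    ∃ W : Ω → ℝ, IsL2Sum P (fun r ω => c r * η r ω) W ∧
      Var[W; P] = ∑' r, c r ^ 2 ∧
      ∀ t : ℝ, HasProd (fun r => ((1 / Real.cosh (c r * t) : ℝ) : ℂ)) (charFun (P.map W) t) := by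
  have hmem : ∀ r, MemLp (η r) 2 P := fun r =>
    (memLp_map_measure_iff aestronglyMeasurable_id (hη r).aemeasurable).1 (hl r).moments.1
  have h0 : ∀ r, ∫ ω, η r ω ∂P = 0 := fun r => by
    rw [integral_comp_of_map_eq (g := fun x => x) (hη r) rfl (by fun_prop)]
    exact (hl r).moments.2.1
  have h1 : ∀ r, ∫ ω, η r ω ^ 2 ∂P = 1 := fun r => by
    rw [integral_comp_of_map_eq (g := fun x => x ^ 2) (hη r) rfl (by fun_prop)]
    exact (hl r).moments.2.2
  have hort : ∀ r s, r ≠ s → ∫ ω, η r ω * η s ω ∂P = 0 := fun r s hrs => by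
    rw [(hind.indepFun hrs).integral_fun_mul_eq_mul_integral (hmem r).1 (hmem s).1, h0, zero_mul]
  obtain ⟨W, hW, hW0, hWv⟩ := exists_isL2Sum hmem h0 h1 hort hc
  refine ⟨W, hW, hWv, fun t => ?_⟩
  have hi : iIndepFun (fun r ω => c r * η r ω) P :=
    hind.comp (fun r x => c r * x) fun r => by fun_prop
  have := hasProd_charFun_of_isL2Sum (fun r => ((hη r).const_mul (c r)).aemeasurable) hi
    (fun r => (hmem r).const_mul (c r)) hW t
  refine this.congr_fun fun r => ?_
  rw [charFun_map_mul_comp (hη r).aemeasurable, (hl r).2]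

/-- A combination of stochastic areas as a Gaussian chaos of order two. -/
lemma hasProd_chaosChar_of_stochasticArea {ι : Type*} {c : ι → ℝ} {t : ℝ} {z : ℂ}
    (hc : Summable fun p : ι × (ℤ × Bool) => (c p.1 * (2 / oddFreq p.2.1)) ^ 2)
    (hz : HasProd (fun r => ((1 / Real.cosh (c r * t) : ℝ) : ℂ)) z) :
    HasProd (fun p : ι × (ℤ × Bool) => chaosChar (c p.1 * (2 / oddFreq p.2.1) * t)) z := by
  obtain ⟨W, -, -, -, hW⟩ := exists_chaos hc
  have h1 := hW t
  have h2 := h1.prod_fiberwise fun q => by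
    have := hasProd_chaosChar_oddFreq (c q * t)
    refine this.congr_fun fun p => ?_
    congr 1
    ring
  rwa [h2.unique hz] at h1

end StochasticArea

/-! ### Complex conjugation and real parts on `L²` -/

section ComplexConjugation

open scoped ComplexConjugate

variable {A : Type*} [MeasurableSpace A] {m : Measure A}

lemma inner_star_star_Lp (u v : Lp ℂ 2 m) : inner ℂ (star u) (star v) = inner ℂ v u := by
  rw [L2.inner_def, L2.inner_def]
  refine integral_congr_ae ?_
  filter_upwards [Lp.coeFn_star u, Lp.coeFn_star v] with x hu hv
  rw [hu, hv]
  simp [mul_comm]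

lemma norm_star_Lp (u : Lp ℂ 2 m) : ‖star u‖ = ‖u‖ := by
  have h := inner_star_star_Lp u u
  rw [inner_self_eq_norm_sq_to_K, inner_self_eq_norm_sq_to_K] at h
  have h2 : ‖star u‖ ^ 2 = ‖u‖ ^ 2 := by exact_mod_cast h
  exact (pow_left_inj₀ (norm_nonneg _) (norm_nonneg _) two_ne_zero).1 h2

lemma star_smul_Lp (c : ℂ) (u : Lp ℂ 2 m) : star (c • u) = conj c • star u := by
  refine Lp.ext ?_
  filter_upwards [Lp.coeFn_star (c • u), Lp.coeFn_smul c u, Lp.coeFn_smul (conj c) (star u),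
    Lp.coeFn_star u] with x h1 h2 h3 h4
  rw [h1, h3, Pi.star_apply, Pi.smul_apply, h2, h4]
  simp

lemma star_add_Lp (u v : Lp ℂ 2 m) : star (u + v) = star u + star v := by
  refine Lp.ext ?_
  filter_upwards [Lp.coeFn_star (u + v), Lp.coeFn_add u v, Lp.coeFn_add (star u) (star v),
    Lp.coeFn_star u, Lp.coeFn_star v] with x h1 h2 h3 h4 h5
  rw [h1, h3, Pi.star_apply, Pi.add_apply, h2, h4, h5]
  simp

/-- The real part of an element of `L²`. -/
noncomputable def reLp (u : Lp ℂ 2 m) : Lp ℝ 2 m :=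
  (Lp.memLp u).re.toLp _

lemma coeFn_reLp (u : Lp ℂ 2 m) : reLp u =ᵐ[m] fun x => (u x).re :=
  MemLp.coeFn_toLp _

lemma reLp_ofReal_smul (l : ℝ) (u : Lp ℂ 2 m) : reLp ((l : ℂ) • u) = l • reLp u := by
  refine Lp.ext ?_
  filter_upwards [coeFn_reLp ((l : ℂ) • u), Lp.coeFn_smul (l : ℂ) u, Lp.coeFn_smul l (reLp u),
    coeFn_reLp u] with x h1 h2 h3 h4
  rw [h1, h3, Pi.smul_apply, h2, h4]
  simp

/-- Pointwise, `Re a * Re b` is half the real part of `conj a * b + a * b`; the second product is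
the pairing with the conjugate of `u`. -/
lemma inner_reLp (u v : Lp ℂ 2 m) :
    inner ℝ (reLp u) (reLp v) = 1 / 2 * (inner ℂ u v + inner ℂ (star u) v).re := by
  have h1 := L2.integrable_inner (𝕜 := ℂ) u v
  have h2 := L2.integrable_inner (𝕜 := ℂ) (star u) v
  rw [L2.inner_def, L2.inner_def, L2.inner_def, ← integral_add h1 h2]
  refine Eq.trans ?_ (congrArg (1 / 2 * ·) (integral_re (𝕜 := ℂ) (h1.add h2)))
  rw [← integral_const_mul]
  refine integral_congr_ae ?_
  filter_upwards [coeFn_reLp u, coeFn_reLp v, Lp.coeFn_star u] with x h3 h4 h5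
  rw [h3, h4, h5]
  simp
  ring

variable [IsFiniteMeasure m] {g : A → A → ℝ}

lemma integralOperator_ofReal_star
    (hg' : MemLp (Function.uncurry fun x y => (g x y : ℂ)) 2 (m.prod m)) (u : Lp ℂ 2 m) :
    integralOperator m (fun x y => (g x y : ℂ)) hg' (star u) =
      star (integralOperator m (fun x y => (g x y : ℂ)) hg' u) := by
  refine Lp.ext ?_
  filter_upwards [integralOperator_apply_ae m _ hg' (star u), integralOperator_apply_ae m _ hg' u,
    Lp.coeFn_star (integralOperator m (fun x y => (g x y : ℂ)) hg' u)] with x h1 h2 h3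
  rw [h1, h3, Pi.star_apply, h2]
  change _ = conj _
  rw [← integral_conj]
  refine integral_congr_ae ?_
  filter_upwards [Lp.coeFn_star u] with y hy
  rw [hy]
  simp

lemma integralOperator_reLp (hg : MemLp (Function.uncurry g) 2 (m.prod m))
    (hg' : MemLp (Function.uncurry fun x y => (g x y : ℂ)) 2 (m.prod m)) (u : Lp ℂ 2 m) :
    integralOperator m g hg (reLp u) =
      reLp (integralOperator m (fun x y => (g x y : ℂ)) hg' u) := by
  refine Lp.ext ?_
  filter_upwards [integralOperator_apply_ae m _ hg (reLp u), integralOperator_apply_ae m _ hg' u,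
    coeFn_reLp (integralOperator m (fun x y => (g x y : ℂ)) hg' u), ae_memLp_section m hg']
    with x h1 h2 h3 h4
  rw [h1, h3, h2]
  refine Eq.trans ?_ (integral_re (𝕜 := ℂ) (h4.integrable_mul (Lp.memLp u)))
  refine integral_congr_ae ?_
  filter_upwards [coeFn_reLp u] with y hy
  rw [hy]
  simp

/-- Real and imaginary parts of complex eigenfunctions of a real kernel. -/
lemma exists_orthonormal_real_eigenvectors (hg : MemLp (Function.uncurry g) 2 (m.prod m))
    (hg' : MemLp (Function.uncurry fun x y => (g x y : ℂ)) 2 (m.prod m)) {κ : Type*}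
    {Φ : κ → Lp ℂ 2 m} (hΦ : Orthonormal ℂ Φ) (hΦ' : ∀ r s, inner ℂ (star (Φ r)) (Φ s) = 0)
    {l : κ → ℝ}
    (hl : ∀ r, integralOperator m (fun x y => (g x y : ℂ)) hg' (Φ r) = (l r : ℂ) • Φ r) :
    ∃ e : κ × Bool → Lp ℝ 2 m, Orthonormal ℝ e ∧
      ∀ p, integralOperator m g hg (e p) = l p.1 • e p := by
  classical
  -- Taking real parts after multiplication by `√2` and `√2 i` gives the real part and minus the
  -- imaginary part. Orthogonality to the conjugates makes these orthogonal with half the squared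
  -- norm each, which `√2` restores.
  let z : Bool → ℂ := fun b => √2 * if b then 1 else Complex.I
  have h2 : ((√2 : ℝ) : ℂ) * (√2 : ℝ) = 2 := by
    rw [← Complex.ofReal_mul, Real.mul_self_sqrt (by norm_num)]; simp
  refine ⟨fun p => reLp (z p.2 • Φ p.1), ?_, fun p => ?_⟩
  · rw [orthonormal_iff_ite] at hΦ ⊢
    rintro ⟨r, b⟩ ⟨s, b'⟩
    simp only
    rw [inner_reLp, star_smul_Lp, inner_smul_left, inner_smul_right, inner_smul_left,
      inner_smul_right, hΦ', hΦ]
    by_cases hrs : r = s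
    · have e : ∀ a a' : ℂ, conj ((√2 : ℝ) * a) * ((√2 : ℝ) * a') = 2 * (conj a * a') :=
        fun a a' => by
          rw [map_mul, Complex.conj_ofReal, ← h2]; ring
      rw [mul_zero, mul_zero, add_zero, hrs, if_pos rfl, mul_one, e]
      cases b <;> cases b' <;> simp
    · simp [hrs]
  · simp only
    rw [integralOperator_reLp hg hg', map_smul, hl, smul_comm, reLp_ofReal_smul]

end ComplexConjugation

/-! ### Real antisymmetric kernels -/

section RealAntisymmetric

open scoped ComplexConjugate

set_option linter.unusedSectionVars false

variable {A : Type*} [MeasurableSpace A] {m : Measure A} [IsFiniteMeasure m] {g : A → A → ℝ}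

lemma adjoint_integralOperator_of_antisymm
    (hg' : MemLp (Function.uncurry fun x y => (g x y : ℂ)) 2 (m.prod m))
    (ha : ∀ᵐ p ∂(m.prod m), g p.1 p.2 = -g p.2 p.1) :
    ContinuousLinearMap.adjoint (integralOperator m (fun x y => (g x y : ℂ)) hg') =
      -integralOperator m (fun x y => (g x y : ℂ)) hg' := by
  have hn : MemLp (Function.uncurry fun x y => -(g x y : ℂ)) 2 (m.prod m) := hg'.neg
  rw [adjoint_integralOperator hg' hn,
    integralOperator_eq_kernelOp, integralOperator_eq_kernelOp, ← kernelOpL_apply,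
    ← kernelOpL_apply, ← map_neg]
  · congr 1
  · filter_upwards [ha] with p hp
    rw [hp]
    simp

lemma inner_eq_zero_of_ne_imaginary_eigenvalue {E : Type*} [NormedAddCommGroup E]
    [InnerProductSpace ℂ E] [CompleteSpace E] {T : E →L[ℂ] E}
    (hT : ContinuousLinearMap.adjoint T = -T) {s t : ℝ} (hst : s ≠ t) {u v : E}
    (hu : T u = (Complex.I * s) • u) (hv : T v = (Complex.I * t) • v) : inner ℂ u v = 0 := by
  have h : inner ℂ (ContinuousLinearMap.adjoint T u) v = inner ℂ u (T v) :=
    ContinuousLinearMap.adjoint_inner_left T v u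
  rw [hT, neg_apply, hu, hv, inner_neg_left, inner_smul_left, inner_smul_right,
    map_mul, Complex.conj_I, Complex.conj_ofReal] at h
  have h2 : Complex.I * ((s : ℂ) - t) * inner ℂ u v = 0 := by linear_combination h
  refine (mul_eq_zero.1 h2).resolve_left (mul_ne_zero Complex.I_ne_zero (sub_ne_zero.2 ?_))
  exact_mod_cast hst

lemma exists_listsPositiveImaginaryEigenvalues
    (hg' : MemLp (Function.uncurry fun x y => (g x y : ℂ)) 2 (m.prod m))
    (ha : ∀ᵐ p ∂(m.prod m), g p.1 p.2 = -g p.2 p.1) :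
    ∃ (Q : ℕ∞) (c : SeqIndex Q → ℝ), ListsPositiveImaginaryEigenvalues
      (integralOperator m (fun x y => (g x y : ℂ)) hg') c := by
  have hT := adjoint_integralOperator_of_antisymm hg' ha
  rw [integralOperator_eq_kernelOp] at hT ⊢
  have hz : ∀ s : ℝ, 0 < s → Complex.I * s ≠ 0 := fun s hs =>
    mul_ne_zero Complex.I_ne_zero (by exact_mod_cast hs.ne')
  exact exists_eigenvalue_listing _ (fun s => Complex.I * s) (0 < ·)
    (fun s hs => finiteDimensional_eigenspace_kernelOp _ (hz s hs))
    (countable_eigenvalues _ _ _ hz fun s t _ _ hst u v hu hv =>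
      inner_eq_zero_of_ne_imaginary_eigenvalue hT hst hu hv)

lemma star_mem_span_range_star {ι : Type*} {φ : ι → Lp ℂ 2 m} {w : Lp ℂ 2 m}
    (hw : w ∈ Submodule.span ℂ (Set.range φ)) :
    star w ∈ Submodule.span ℂ (Set.range fun r => star (φ r)) := by
  induction hw using Submodule.span_induction with
  | mem x hx =>
    obtain ⟨r, rfl⟩ := hx
    exact Submodule.subset_span ⟨r, rfl⟩
  | zero =>
    rw [← zero_smul ℂ (0 : Lp ℂ 2 m), star_smul_Lp, map_zero, zero_smul]
    exact Submodule.zero_mem _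
  | add x y _ _ hx hy => rw [star_add_Lp]; exact Submodule.add_mem _ hx hy
  | smul a x _ hx => rw [star_smul_Lp]; exact Submodule.smul_mem _ _ hx

lemma orthonormal_sumElim_star {ι : Type*} {φ : ι → Lp ℂ 2 m} (h : Orthonormal ℂ φ)
    (h' : ∀ r s, inner ℂ (star (φ r)) (φ s) = 0) :
    Orthonormal ℂ (Sum.elim φ fun r => star (φ r)) := by
  refine ⟨?_, ?_⟩
  · rintro (r | r)
    · exact h.1 r
    · exact (norm_star_Lp (φ r)).trans (h.1 r)
  · rintro (r | r) (s | s) hrs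
    · simp only [Sum.elim_inl]
      exact h.2 (ne_of_apply_ne Sum.inl hrs)
    · simp only [Sum.elim_inl, Sum.elim_inr]
      rw [← inner_conj_symm, h', map_zero]
    · simp only [Sum.elim_inl, Sum.elim_inr]
      exact h' r s
    · simp only [Sum.elim_inr]
      rw [inner_star_star_Lp]
      exact h.2 (ne_of_apply_ne Sum.inr hrs.symm)

lemma integralOperator_star_of_imaginary_eigenvalue
    (hg' : MemLp (Function.uncurry fun x y => (g x y : ℂ)) 2 (m.prod m)) {s : ℝ} {u : Lp ℂ 2 m}
    (hu : integralOperator m (fun x y => (g x y : ℂ)) hg' u = (Complex.I * s) • u) :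
    integralOperator m (fun x y => (g x y : ℂ)) hg' (star u) =
      (Complex.I * (-s : ℝ)) • star u := by
  rw [integralOperator_ofReal_star hg', hu, star_smul_Lp]
  simp

/-- Multiplication by `-i` makes the operator symmetric. As the kernel is real, conjugation maps
eigenvectors for `c r` to eigenvectors for `-c r`, so Parseval's identity counts each square twice;
hence the `1 / 2`. -/
lemma hasSum_sq_imaginary_eigenvalues {ι : Type*} {φ : ι → Lp ℂ 2 m} {c : ι → ℝ}
    (hg' : MemLp (Function.uncurry fun x y => (g x y : ℂ)) 2 (m.prod m))
    (ha : ∀ᵐ p ∂(m.prod m), g p.1 p.2 = -g p.2 p.1) (hφ : Orthonormal ℂ φ)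
    (hφ' : ∀ r s, inner ℂ (star (φ r)) (φ s) = 0) (hc : ∀ r, 0 < c r)
    (hcφ : ∀ r, integralOperator m (fun x y => (g x y : ℂ)) hg' (φ r) = (Complex.I * c r) • φ r)
    (hspan : ∀ s : ℝ, 0 < s → ∀ u, integralOperator m (fun x y => (g x y : ℂ)) hg' u =
      (Complex.I * s) • u → u ∈ Submodule.span ℂ (Set.range φ)) :
    HasSum (fun r => c r ^ 2) (1 / 2 * ∫ p, g p.1 p.2 ^ 2 ∂(m.prod m)) := by
  have hT := adjoint_integralOperator_of_antisymm hg' ha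
  obtain ⟨T, hTdef⟩ : ∃ T, T = integralOperator m (fun x y => (g x y : ℂ)) hg' := ⟨_, rfl⟩
  have hstar : ∀ (s : ℝ) (u : Lp ℂ 2 m), T u = (Complex.I * s) • u →
      T (star u) = (Complex.I * (-s : ℝ)) • star u := fun s u hu => by
    rw [hTdef] at hu ⊢
    exact integralOperator_star_of_imaginary_eigenvalue hg' hu
  obtain ⟨G, hGdef⟩ : ∃ G : Lp ℂ 2 (m.prod m), G = (-Complex.I) • hg'.toLp _ := ⟨_, rfl⟩
  have hG : kernelOp G = (-Complex.I) • T := by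
    rw [hGdef, hTdef, ← kernelOpL_apply, map_smul, kernelOpL_apply,
      ← integralOperator_eq_kernelOp]
  rw [← hTdef] at hT
  simp only [← hTdef] at hcφ hspan
  have hnorm : ‖G‖ ^ 2 = ∫ p, g p.1 p.2 ^ 2 ∂(m.prod m) := by
    rw [hGdef, norm_smul, norm_neg, Complex.norm_I, one_mul, norm_sq_Lp_two]
    simp only [Function.uncurry, Complex.norm_real, Real.norm_eq_abs, sq_abs]
  clear hTdef hGdef
  have hsym : (kernelOp G).IsSymmetric := fun u v => by
    change inner ℂ (kernelOp G u) v = inner ℂ u (kernelOp G v)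
    rw [hG, smul_apply, smul_apply, inner_smul_left, inner_smul_right,
      ← ContinuousLinearMap.adjoint_inner_right, hT, neg_apply, inner_neg_right]
    simp
  have hΨ := orthonormal_sumElim_star hφ hφ'
  have hIs : ∀ (s : ℝ) (u : Lp ℂ 2 m), T u = (Complex.I * s) • u → kernelOp G u = (s : ℂ) • u :=
    fun s u hu => by
      rw [hG, smul_apply, hu, smul_smul, ← mul_assoc, neg_mul, Complex.I_mul_I, neg_neg, one_mul]
  have hIs' : ∀ (s : ℝ) (u : Lp ℂ 2 m), kernelOp G u = (s : ℂ) • u → T u = (Complex.I * s) • u :=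
    fun s u hu => by
      rw [hG, smul_apply] at hu
      rw [mul_smul, ← hu, smul_smul, mul_neg, Complex.I_mul_I, neg_neg, one_smul]
  have hl : ∀ r, kernelOp G (Sum.elim φ (fun r => star (φ r)) r) =
      ((Sum.elim c (fun r => -c r) r : ℝ) : ℂ) • Sum.elim φ (fun r => star (φ r)) r := by
    rintro (r | r)
    · exact hIs _ _ (hcφ r)
    · exact hIs _ _ (hstar _ _ (hcφ r))
  have hl0 : ∀ r, ((Sum.elim c (fun r => -c r) r : ℝ) : ℂ) ≠ 0 := by
    rintro (r | r)
    · exact Complex.ofReal_ne_zero.2 (hc r).ne'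
    · exact Complex.ofReal_ne_zero.2 (neg_neg_of_pos (hc r)).ne
  have hr1 : Submodule.span ℂ (Set.range φ) ≤
      Submodule.span ℂ (Set.range (Sum.elim φ fun r => star (φ r))) := by
    rw [Set.Sum.elim_range]
    exact Submodule.span_mono Set.subset_union_left
  have hr2 : Submodule.span ℂ (Set.range fun r => star (φ r)) ≤
      Submodule.span ℂ (Set.range (Sum.elim φ fun r => star (φ r))) := by
    rw [Set.Sum.elim_range]
    exact Submodule.span_mono Set.subset_union_right
  have hsp : ∀ s : ℂ, s ≠ 0 →
      Module.End.eigenspace (kernelOp G : Lp ℂ 2 m →ₗ[ℂ] Lp ℂ 2 m) s ≤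
        Submodule.span ℂ (Set.range (Sum.elim φ fun r => star (φ r))) := by
    intro s hs u hu
    rcases eq_or_ne u 0 with rfl | hu0
    · exact Submodule.zero_mem _
    have hreal := hsym.conj_eigenvalue_eq_self
      (Module.End.hasEigenvalue_of_hasEigenvector ⟨hu, hu0⟩)
    obtain ⟨x, rfl⟩ := Complex.conj_eq_iff_real.1 hreal
    have hTu := hIs' x u (Module.End.mem_eigenspace_iff.1 hu)
    -- An eigenvector for a negative eigenvalue is the conjugate of one for a positive eigenvalue,
    -- which the family already spans.
    rcases (Complex.ofReal_ne_zero.1 hs).lt_or_gt with hx | hx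
    · have hm := star_mem_span_range_star (hspan (-x) (by linarith) _ (hstar x u hTu))
      rw [star_star] at hm
      exact hr2 hm
    · exact hr1 (hspan x hx u hTu)
  have hsum := hasSum_sq_eigenvalues hsym hΨ hl0 hl hsp
  rw [hnorm] at hsum
  simp only [Complex.norm_real, Real.norm_eq_abs, sq_abs] at hsum
  have e1 : ((fun r => Sum.elim c (fun r => -c r) r ^ 2) ∘ Sum.inl) = fun r => c r ^ 2 := by
    ext r; simp only [Function.comp_apply, Sum.elim_inl]
  have e2 : ((fun r => Sum.elim c (fun r => -c r) r ^ 2) ∘ Sum.inr) = fun r => c r ^ 2 := by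
    ext r; simp only [Function.comp_apply, Sum.elim_inr, neg_sq]
  have hs1 := hsum.summable.comp_injective Sum.inl_injective
  rw [e1] at hs1
  have h5 := HasSum.sum (e1.symm ▸ hs1.hasSum) (e2.symm ▸ hs1.hasSum)
  rw [e1, e2] at h5
  have h7 : ∑' r, c r ^ 2 = 1 / 2 * ∫ p, g p.1 p.2 ^ 2 ∂(m.prod m) := by
    linarith [h5.unique hsum]
  rw [← h7]
  exact hs1.hasSum

lemma ListsPositiveImaginaryEigenvalues.exists_orthonormal
    (hg' : MemLp (Function.uncurry fun x y => (g x y : ℂ)) 2 (m.prod m))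
    (ha : ∀ᵐ p ∂(m.prod m), g p.1 p.2 = -g p.2 p.1) {Q : ℕ∞} {c : SeqIndex Q → ℝ}
    (hc : ListsPositiveImaginaryEigenvalues
      (integralOperator m (fun x y => (g x y : ℂ)) hg') c) :
    ∃ φ : SeqIndex Q → Lp ℂ 2 m, Orthonormal ℂ φ ∧
      (∀ r s, inner ℂ (star (φ r)) (φ s) = 0) ∧
      (∀ r, integralOperator m (fun x y => (g x y : ℂ)) hg' (φ r) =
        (Complex.I * c r) • φ r) ∧
      HasSum (fun r => c r ^ 2) (1 / 2 * ∫ p, g p.1 p.2 ^ 2 ∂(m.prod m)) := by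
  have hT := adjoint_integralOperator_of_antisymm hg' ha
  have hfin : ∀ s : ℝ, 0 < s → FiniteDimensional ℂ (Module.End.eigenspace
      (integralOperator m (fun x y => (g x y : ℂ)) hg' : Lp ℂ 2 m →ₗ[ℂ] Lp ℂ 2 m)
      (Complex.I * s)) := fun s hs => by
    rw [integralOperator_eq_kernelOp]
    exact finiteDimensional_eigenspace_kernelOp _
      (mul_ne_zero Complex.I_ne_zero (by exact_mod_cast hs.ne'))
  obtain ⟨φ, h1, h2, h3⟩ := exists_orthonormal_eigenvectors _ (fun s => Complex.I * s) (0 < ·) c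
    hc.1 hc.2 hfin fun s t _ _ hst u v hu hv =>
      inner_eq_zero_of_ne_imaginary_eigenvalue hT hst hu hv
  -- Conjugates belong to the eigenvalues `-i c r`, which differ from every `i c s` because all `c`
  -- are positive.
  have hcross : ∀ r s, inner ℂ (star (φ r)) (φ s) = 0 := fun r s =>
    inner_eq_zero_of_ne_imaginary_eigenvalue hT
      (by linarith [hc.1 r, hc.1 s] : -c r < c s).ne
      (integralOperator_star_of_imaginary_eigenvalue hg' (h2 r)) (h2 s)
  exact ⟨φ, h1, hcross, h2, hasSum_sq_imaginary_eigenvalues hg' ha h1 hcross hc.1 h2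
    fun s hs u hu => h3 s hs (Module.End.mem_eigenspace_iff.2 hu)⟩

end RealAntisymmetric

/-! ### The kernel `\hat f` of an antisymmetric kernel -/

section HatAntisymmetric

open scoped ComplexConjugate

set_option linter.unusedSectionVars false

lemma integral_unitInterval (F : ℝ → ℂ) : ∫ t : unitInterval, F t = ∫ t in (0 : ℝ)..1, F t := by
  rw [intervalIntegral.integral_of_le zero_le_one, ← integral_Icc_eq_integral_Ioc]
  exact integral_subtype measurableSet_Icc F

/-- The exponentials `exp (-i (2k + 1) π t)`. -/
noncomputable def oddExp (k : ℤ) (t : ℝ) : ℂ := Complex.exp (-(Complex.I * oddFreq k) * t)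

lemma continuous_oddExp (k : ℤ) : Continuous (oddExp k) := by
  unfold oddExp; fun_prop

lemma conj_oddExp (k : ℤ) (t : ℝ) : conj (oddExp k t) =
    Complex.exp (Complex.I * oddFreq k * t) := by
  rw [oddExp, ← Complex.exp_conj]
  simp

lemma norm_oddExp (k : ℤ) (t : ℝ) : ‖oddExp k t‖ = 1 := by
  rw [oddExp, show -(Complex.I * oddFreq k) * t = ((-(oddFreq k * t) : ℝ) : ℂ) * Complex.I by
    push_cast; ring, Complex.norm_exp_ofReal_mul_I]

lemma oddExp_zero (k : ℤ) : oddExp k 0 = 1 := by simp [oddExp]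

lemma oddExp_one (k : ℤ) : oddExp k 1 = -1 := by
  rw [oddExp, oddFreq]
  have e : -(Complex.I * (((2 * k + 1) * Real.pi : ℝ) : ℂ)) * ((1 : ℝ) : ℂ) =
      -(Real.pi * Complex.I) + (-k : ℤ) * (2 * Real.pi * Complex.I) := by
    push_cast; ring
  rw [e, Complex.exp_add, Complex.exp_int_mul_two_pi_mul_I, Complex.exp_neg, Complex.exp_pi_mul_I]
  norm_num

/-- Two odd frequencies differ by an integer multiple of `2π`, so for `k ≠ l` the integrand runs
through full periods. -/
lemma integral_conj_oddExp_mul (k l : ℤ) :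
    ∫ t : unitInterval, conj (oddExp k t) * oddExp l t = if k = l then 1 else 0 := by
  rw [integral_unitInterval fun t => conj (oddExp k t) * oddExp l t]
  split_ifs with h
  · subst h
    have e : ∀ t : ℝ, conj (oddExp k t) * oddExp k t = 1 := fun t => by
      rw [Complex.conj_mul', norm_oddExp]; simp
    simp [e]
  · have e : ∀ t : ℝ, conj (oddExp k t) * oddExp l t =
        Complex.exp (((k - l : ℤ) * (2 * Real.pi * Complex.I)) * t) := fun t => by
      rw [conj_oddExp, oddExp, ← Complex.exp_add, oddFreq, oddFreq]
      congr 1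
      push_cast
      ring
    have hc : ((k - l : ℤ) * (2 * Real.pi * Complex.I) : ℂ) ≠ 0 :=
      mul_ne_zero (by exact_mod_cast sub_ne_zero.2 h) Complex.two_pi_I_ne_zero
    simp only [e]
    rw [integral_exp_mul_complex hc, Complex.ofReal_one, mul_one, Complex.exp_int_mul_two_pi_mul_I]
    simp

lemma integral_oddExp (k : ℤ) (a b : ℝ) :
    ∫ u in a..b, oddExp k u = Complex.I / oddFreq k * (oddExp k b - oddExp k a) := by
  have h : (oddFreq k : ℂ) ≠ 0 := by exact_mod_cast oddFreq_ne_zero k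
  simp only [oddExp]
  rw [integral_exp_mul_complex (neg_ne_zero.2 (mul_ne_zero Complex.I_ne_zero h)), div_eq_iff
    (neg_ne_zero.2 (mul_ne_zero Complex.I_ne_zero h))]
  field_simp
  rw [Complex.I_sq]
  ring

/-- The sign of `u - t`. -/
noncomputable def timeSign (t u : ℝ) : ℝ := if u ≤ t then -1 else 1

/-- After splitting at `t`, the boundary terms at `0` and `1` cancel because `oddExp k` takes
opposite values there. This antiperiodicity is what singles out the odd multiples of π. -/
lemma integral_timeSign_mul_oddExp (k : ℤ) (t : unitInterval) :
    ∫ u : unitInterval, (timeSign t u : ℂ) * oddExp k u =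
      -(2 * Complex.I / oddFreq k) * oddExp k t := by
  obtain ⟨t, ht0, ht1⟩ := t
  have hi : ∀ a b, IntervalIntegrable (oddExp k) volume a b := fun a b =>
    (continuous_oddExp k).intervalIntegrable a b
  have h1 : Set.EqOn (fun u => -oddExp k u) (fun u => (timeSign t u : ℂ) * oddExp k u)
      (Set.uIoc 0 t) := fun u hu => by
    rw [Set.uIoc_of_le ht0] at hu
    simp [timeSign, hu.2]
  have h2 : Set.EqOn (oddExp k) (fun u => (timeSign t u : ℂ) * oddExp k u) (Set.uIoc t 1) :=
    fun u hu => by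
      rw [Set.uIoc_of_le ht1] at hu
      simp [timeSign, hu.1.not_ge]
  rw [integral_unitInterval fun u => (timeSign t u : ℂ) * oddExp k u,
    ← intervalIntegral.integral_add_adjacent_intervals ((hi 0 t).neg.congr h1)
      ((hi t 1).congr h2), ← intervalIntegral.integral_congr_ae (ae_of_all _ h1),
    ← intervalIntegral.integral_congr_ae (ae_of_all _ h2), intervalIntegral.integral_neg,
      integral_oddExp,
    integral_oddExp, oddExp_zero, oddExp_one]
  ring

variable {S : Type*} [MeasurableSpace S] {ν : Measure S} [IsProbabilityMeasure ν] {f : S → S → ℝ}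

lemma memLp_mul_oddExp (φ : Lp ℂ 2 ν) (k : ℤ) :
    MemLp (fun p : S × unitInterval => φ p.1 * oddExp k p.2) 2
      (ν.prod (volume : Measure unitInterval)) := by
  have h : MemLp (fun p : S × unitInterval => φ p.1) 2 (ν.prod (volume : Measure unitInterval)) :=
    (Lp.memLp φ).comp_measurePreserving measurePreserving_fst
  refine h.mono (h.1.mul ?_) (ae_of_all _ fun p => ?_)
  · exact ((continuous_oddExp k).measurable.comp
      (measurable_subtype_coe.comp measurable_snd)).aestronglyMeasurable
  · rw [norm_mul, norm_oddExp, mul_one]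

/-- The function `φ(x) exp (-i (2k + 1) π t)` on `S × [0,1]`. -/
noncomputable def mulOddExp (φ : Lp ℂ 2 ν) (k : ℤ) :
    Lp ℂ 2 (ν.prod (volume : Measure unitInterval)) :=
  (memLp_mul_oddExp φ k).toLp _

lemma coeFn_mulOddExp (φ : Lp ℂ 2 ν) (k : ℤ) :
    mulOddExp φ k =ᵐ[ν.prod (volume : Measure unitInterval)] fun p => φ p.1 * oddExp k p.2 :=
  MemLp.coeFn_toLp _

lemma inner_mulOddExp (φ ψ : Lp ℂ 2 ν) (k l : ℤ) :
    inner ℂ (mulOddExp φ k) (mulOddExp ψ l) = inner ℂ φ ψ * if k = l then 1 else 0 := by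
  rw [← integral_conj_oddExp_mul, L2.inner_def, L2.inner_def, ← integral_prod_mul]
  refine integral_congr_ae ?_
  filter_upwards [coeFn_mulOddExp φ k, coeFn_mulOddExp ψ l] with p h1 h2
  rw [h1, h2]
  simp only [RCLike.inner_apply', map_mul]
  ring

/-- The inner product factorizes, and only the space factor vanishes: the time factor equals one
when `l = -(k + 1)`. -/
lemma inner_star_mulOddExp {φ ψ : Lp ℂ 2 ν} (h : inner ℂ (star φ) ψ = 0) (k l : ℤ) :
    inner ℂ (star (mulOddExp φ k)) (mulOddExp ψ l) = 0 := by
  have e : inner ℂ (star (mulOddExp φ k)) (mulOddExp ψ l) =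
      inner ℂ (star φ) ψ * ∫ t : unitInterval, oddExp k t * oddExp l t := by
    rw [L2.inner_def, L2.inner_def, ← integral_prod_mul]
    refine integral_congr_ae ?_
    filter_upwards [coeFn_mulOddExp φ k, coeFn_mulOddExp ψ l, Lp.coeFn_star (mulOddExp φ k),
      Measure.quasiMeasurePreserving_fst.ae (Lp.coeFn_star φ)] with p h1 h2 h3 h4
    rw [h3, h4, Pi.star_apply, Pi.star_apply, h1, h2]
    simp only [RCLike.inner_apply', map_mul, RCLike.star_def, RCLike.conj_conj]
    ring
  rw [e, h, zero_mul]

lemma hatKernel_ae_eq_of_antisymmetric (ha : ∀ᵐ p ∂(ν.prod ν), f p.1 p.2 = -f p.2 p.1) :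
    ∀ᵐ p ∂((ν.prod (volume : Measure unitInterval)).prod (ν.prod (volume : Measure unitInterval))),
      hatKernel f p.1 p.2 = timeSign p.1.2 p.2.2 * f p.1.1 p.2.1 := by
  filter_upwards [ae_ne_time, measurePreserving_points.quasiMeasurePreserving.ae ha] with p h1 h2
  rcases lt_trichotomy p.1.2 p.2.2 with h | h | h
  · have h' : ¬ ((p.2.2 : ℝ) ≤ p.1.2) := not_le.2 (by exact_mod_cast h)
    simp [hatKernel, timeSign, h, h']
  · exact (h1 h).elim
  · have h' : (p.2.2 : ℝ) ≤ p.1.2 := by exact_mod_cast h.le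
    simp only [hatKernel, timeSign, h, h.le.not_gt, if_true, if_false, h']
    linarith

/-- For an antisymmetric kernel the operator splits into a space and a time factor, with eigenvalues
`i c` and `-2i / oddFreq k`; their product is real. -/
lemma integralOperator_hatKernel_mulOddExp
    (hg' : MemLp (Function.uncurry fun p q => (hatKernel f p q : ℂ)) 2
      ((ν.prod (volume : Measure unitInterval)).prod (ν.prod (volume : Measure unitInterval))))
    (h2 : MemLp (Function.uncurry fun x y => (f x y : ℂ)) 2 (ν.prod ν))
    (ha : ∀ᵐ p ∂(ν.prod ν), f p.1 p.2 = -f p.2 p.1) {φ : Lp ℂ 2 ν} {c : ℝ}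
    (hφ : integralOperator ν (fun x y => (f x y : ℂ)) h2 φ = (Complex.I * c) • φ) (k : ℤ) :
    integralOperator _ (fun p q => (hatKernel f p q : ℂ)) hg' (mulOddExp φ k) =
      ((c * (2 / oddFreq k) : ℝ) : ℂ) • mulOddExp φ k := by
  have h1 : ∀ᵐ x ∂ν, ∫ y, (f x y : ℂ) * φ y ∂ν = Complex.I * c * φ x := by
    filter_upwards [integralOperator_apply_ae ν _ h2 φ, Lp.coeFn_smul (Complex.I * (c : ℂ)) φ]
      with x e1 e2
    rw [← e1, hφ, e2, Pi.smul_apply, smul_eq_mul]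
  refine Lp.ext ?_
  filter_upwards [integralOperator_apply_ae _ _ hg' (mulOddExp φ k),
    Lp.coeFn_smul ((c * (2 / oddFreq k) : ℝ) : ℂ) (mulOddExp φ k), coeFn_mulOddExp φ k,
    Measure.ae_ae_of_ae_prod (hatKernel_ae_eq_of_antisymmetric ha),
    Measure.quasiMeasurePreserving_fst.ae h1] with p e1 e2 e3 e4 e5
  rw [e1, e2, Pi.smul_apply, e3]
  have e6 : ∫ q, (hatKernel f p q : ℂ) * mulOddExp φ k q ∂(ν.prod (volume : Measure unitInterval)) =
      ∫ q : S × unitInterval, ((f p.1 q.1 : ℂ) * φ q.1) * ((timeSign p.2 q.2 : ℂ) * oddExp k q.2)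
        ∂(ν.prod (volume : Measure unitInterval)) := by
    refine integral_congr_ae ?_
    filter_upwards [e4, coeFn_mulOddExp φ k] with q h3 h4
    rw [h3, h4]
    push_cast
    ring
  rw [e6, integral_prod_mul (fun y => (f p.1 y : ℂ) * φ y)
    (fun u : unitInterval => (timeSign p.2 u : ℂ) * oddExp k u), e5, integral_timeSign_mul_oddExp,
    smul_eq_mul]
  push_cast
  linear_combination (-2 * (c : ℂ) / oddFreq k * φ p.1 * oddExp k p.2) * Complex.I_sq

/-- The eigenfunctions of `\hat f` obtained from those of an antisymmetric kernel `f`. -/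
lemma exists_orthonormal_hatKernel_of_antisymmetric
    (hg : MemLp (Function.uncurry (hatKernel f)) 2
      ((ν.prod (volume : Measure unitInterval)).prod (ν.prod (volume : Measure unitInterval))))
    (h2 : MemLp (Function.uncurry fun x y => (f x y : ℂ)) 2 (ν.prod ν))
    (ha : ∀ᵐ p ∂(ν.prod ν), f p.1 p.2 = -f p.2 p.1) {Q : ℕ∞} {c : SeqIndex Q → ℝ}
    (hc : ListsPositiveImaginaryEigenvalues
      (integralOperator ν (fun x y => (f x y : ℂ)) h2) c) :
    ∃ e : SeqIndex Q × (ℤ × Bool) → Lp ℝ 2 (ν.prod (volume : Measure unitInterval)),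
      Orthonormal ℝ e ∧
      (∀ p, integralOperator _ (hatKernel f) hg (e p) = (c p.1 * (2 / oddFreq p.2.1)) • e p) ∧
      HasSum (fun p : SeqIndex Q × (ℤ × Bool) => (c p.1 * (2 / oddFreq p.2.1)) ^ 2)
        (∫ p, f p.1 p.2 ^ 2 ∂(ν.prod ν)) ∧
      HasSum (fun r => c r ^ 2) (1 / 2 * ∫ p, f p.1 p.2 ^ 2 ∂(ν.prod ν)) := by
  obtain ⟨φ, h3, h4, h5, h6⟩ := hc.exists_orthonormal h2 ha
  have hg' : MemLp (Function.uncurry fun p q => (hatKernel f p q : ℂ)) 2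
      ((ν.prod (volume : Measure unitInterval)).prod (ν.prod (volume : Measure unitInterval))) :=
    hg.ofReal
  have hΦ : Orthonormal ℂ fun p : SeqIndex Q × ℤ => mulOddExp (φ p.1) p.2 := by
    classical
    rw [orthonormal_iff_ite] at h3 ⊢
    rintro ⟨r, k⟩ ⟨s, l⟩
    simp only
    rw [inner_mulOddExp, h3]
    by_cases h : r = s <;> by_cases h' : k = l <;> simp [h, h']
  obtain ⟨e, he1, he2⟩ := exists_orthonormal_real_eigenvectors hg hg' hΦ
    (fun p q => inner_star_mulOddExp (h4 _ _) _ _) (l := fun p => c p.1 * (2 / oddFreq p.2))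
    fun p => integralOperator_hatKernel_mulOddExp hg' h2 ha (h5 p.1) p.2
  refine ⟨fun p => e ((p.1, p.2.1), p.2.2), he1.comp _ ?_, fun p => he2 _, ?_, h6⟩
  · rintro ⟨r, k, b⟩ ⟨s, l, b'⟩ h
    simpa [and_assoc] using h
  -- The squares sum to half the squared norm from the space factor times `2` from the time factor.
  -- The family thus exhausts the norm, and no separate completeness argument is needed.
  · have h7 := hasSum_bool hasSum_sq_inv_oddFreq
    have h8 := h6.mul h7
      (h6.summable.mul_of_nonneg h7.summable (fun r => sq_nonneg _) fun p => sq_nonneg _)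
    rw [show 1 / 2 * (∫ p, f p.1 p.2 ^ 2 ∂(ν.prod ν)) * (2 * 1) = ∫ p, f p.1 p.2 ^ 2 ∂(ν.prod ν) by
      ring] at h8
    simpa only [mul_pow] using h8

lemma hoeffding12_swap_of_antisymmetric (ha : ∀ᵐ p ∂(ν.prod ν), f p.1 p.2 = -f p.2 p.1) :
    kernelMean ν f = 0 ∧ ∀ᵐ p ∂(ν.prod ν), hoeffding12 ν f p.1 p.2 = -hoeffding12 ν f p.2 p.1 := by
  have h0 : kernelMean ν f = 0 := by
    have h : kernelMean ν f = -kernelMean ν f := by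
      conv_rhs => rw [kernelMean, ← integral_prod_swap, ← integral_neg]
      exact integral_congr_ae ha
    linarith
  have h1 : ∀ᵐ x ∂ν, hoeffding1 ν f x = -hoeffding2 ν f x := by
    filter_upwards [Measure.ae_ae_of_ae_prod ha] with x hx
    rw [hoeffding1, hoeffding2, h0, integral_congr_ae hx, integral_neg]
    ring
  refine ⟨h0, ?_⟩
  filter_upwards [ha, Measure.quasiMeasurePreserving_fst.ae h1,
    Measure.quasiMeasurePreserving_snd.ae h1] with p e1 e2 e3
  rw [hoeffding12, hoeffding12, e1, e2, e3, h0]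
  ring

end HatAntisymmetric

/-! ### Real symmetric kernels given pointwise -/

section SymmetricIntegralOperator

variable {A : Type*} [MeasurableSpace A] {m : Measure A} [IsFiniteMeasure m] {g : A → A → ℝ}

lemma isSelfAdjoint_integralOperator (hg : MemLp (Function.uncurry g) 2 (m.prod m))
    (hs : ∀ᵐ p ∂(m.prod m), g p.1 p.2 = g p.2 p.1) : IsSelfAdjoint (integralOperator m g hg) := by
  rw [ContinuousLinearMap.isSelfAdjoint_iff']
  exact adjoint_integralOperator hg hg hs

lemma exists_listsNonzeroEigenvalues_integralOperator
    (hg : MemLp (Function.uncurry g) 2 (m.prod m))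
    (hs : ∀ᵐ p ∂(m.prod m), g p.1 p.2 = g p.2 p.1) :
    ∃ (R : ℕ∞) (c : SeqIndex R → ℝ), ListsNonzeroEigenvalues (integralOperator m g hg) c := by
  have h := (isSelfAdjoint_integralOperator hg hs).isSymmetric
  rw [integralOperator_eq_kernelOp] at h ⊢
  exact exists_listsNonzeroEigenvalues h

lemma ListsNonzeroEigenvalues.exists_orthonormal_integralOperator
    (hg : MemLp (Function.uncurry g) 2 (m.prod m))
    (hs : ∀ᵐ p ∂(m.prod m), g p.1 p.2 = g p.2 p.1) {R : ℕ∞} {c : SeqIndex R → ℝ}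
    (hc : ListsNonzeroEigenvalues (integralOperator m g hg) c) :
    ∃ e : SeqIndex R → Lp ℝ 2 m, Orthonormal ℝ e ∧
      (∀ r, integralOperator m g hg (e r) = c r • e r) ∧
      HasSum (fun r => c r ^ 2) (∫ p, g p.1 p.2 ^ 2 ∂(m.prod m)) := by
  have h := (isSelfAdjoint_integralOperator hg hs).isSymmetric
  rw [integralOperator_eq_kernelOp] at h hc ⊢
  obtain ⟨e, h1, h2, h3⟩ := hc.exists_orthonormal h
  rw [norm_sq_Lp_two] at h3
  simp only [Function.uncurry, Real.norm_eq_abs, sq_abs] at h3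
  exact ⟨e, h1, h2, h3⟩

end SymmetricIntegralOperator

/-! ### Moments and limits of the bi-alternating statistic -/

section BiAltMoments

set_option linter.unusedSectionVars false

variable {Ω S : Type*} [MeasurableSpace Ω] [MeasurableSpace S]
  {P : Measure Ω} [IsProbabilityMeasure P] {ν : Measure S} [IsProbabilityMeasure ν]
  {X : ℕ → Ω → S} {f : S → S → ℝ}

lemma isBigO_integral_biAltU (hXm : ∀ i, Measurable (X i)) (hXi : iIndepFun X P)
    (hXν : ∀ i, P.map (X i) = ν) (hf : Measurable (Function.uncurry f))
    (hf2 : MemLp (Function.uncurry f) 2 (ν.prod ν)) :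
    (fun n => ∫ ω, biAltU X f n ω ∂P) =O[atTop] fun n => (n : ℝ) := by
  refine IsBigO.of_bound |kernelMean ν f| (Eventually.of_forall fun n => ?_)
  rw [integral_biAltU hXm hXi hXν hf hf2, norm_mul, norm_neg, Real.norm_natCast,
    Real.norm_natCast, Real.norm_eq_abs, mul_comm]
  gcongr
  exact Nat.div_le_self n 2

lemma isBigO_variance_biAltU_sub (hXm : ∀ i, Measurable (X i)) (hXi : iIndepFun X P)
    (hXν : ∀ i, P.map (X i) = ν) (hf : Measurable (Function.uncurry f))
    (hf2 : MemLp (Function.uncurry f) 2 (ν.prod ν)) :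
    (fun n : ℕ => Var[biAltU X f n; P] -
      1 / 2 * (n : ℝ) ^ 2 * Var[fun ω => hoeffding12 ν f (X 0 ω) (X 1 ω); P]) =O[atTop]
        fun n => (n : ℝ) := by
  set V := Var[fun ω => hoeffding12 ν f (X 0 ω) (X 1 ω); P] with hV
  have hV0 : 0 ≤ V := variance_nonneg _ _
  refine IsBigO.of_bound (V + (linVar ν f 0 + linVar ν f 1)) (Eventually.of_forall fun n => ?_)
  have h0 := linVar_nonneg (ν := ν) (f := f) n
  have h1 := linVar_le (ν := ν) (f := f) n
  have h2 : ((n / 2 : ℕ) : ℝ) ≤ n := by exact_mod_cast Nat.div_le_self n 2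
  have h3 : (0 : ℝ) ≤ (n / 2 : ℕ) := Nat.cast_nonneg _
  have h4 : (0 : ℝ) ≤ n := Nat.cast_nonneg _
  have h5 : ((n / 2 : ℕ) : ℝ) * linVar ν f n ≤ n * (linVar ν f 0 + linVar ν f 1) :=
    mul_le_mul h2 h1 h0 h4
  have h6 : 0 ≤ ((n / 2 : ℕ) : ℝ) * linVar ν f n := mul_nonneg h3 h0
  have h7 : 0 ≤ n * V := mul_nonneg h4 hV0
  rw [variance_biAltU hXm hXi hXν hf hf2, Real.norm_natCast, Real.norm_eq_abs, abs_le]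
  constructor <;> nlinarith

lemma integral_sq_biAltU_le (hXm : ∀ i, Measurable (X i)) (hXi : iIndepFun X P)
    (hXν : ∀ i, P.map (X i) = ν) (hf : Measurable (Function.uncurry f))
    (hf2 : MemLp (Function.uncurry f) 2 (ν.prod ν)) (n : ℕ) :
    ∫ ω, biAltU X f n ω ^ 2 ∂P ≤ (Var[fun ω => hoeffding12 ν f (X 0 ω) (X 1 ω); P] +
      (linVar ν f 0 + linVar ν f 1) + kernelMean ν f ^ 2) * (n : ℝ) ^ 2 := by
  have hv := variance_eq_sub (memLp_biAltU hXm hXi hXν hf2 n)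
  rw [variance_biAltU hXm hXi hXν hf hf2, integral_biAltU hXm hXi hXν hf hf2] at hv
  simp only [Pi.pow_apply] at hv
  set V := Var[fun ω => hoeffding12 ν f (X 0 ω) (X 1 ω); P] with hV
  have hV0 : 0 ≤ V := variance_nonneg _ _
  have h0 := linVar_nonneg (ν := ν) (f := f) n
  have h1 := linVar_le (ν := ν) (f := f) n
  have h2 : ((n / 2 : ℕ) : ℝ) ≤ n := by exact_mod_cast Nat.div_le_self n 2
  have h3 : (0 : ℝ) ≤ (n / 2 : ℕ) := Nat.cast_nonneg _
  have h4 : (n : ℝ) ≤ n ^ 2 := by exact_mod_cast Nat.le_self_pow two_ne_zero n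
  have h5 : ((n / 2 : ℕ) : ℝ) * linVar ν f n ≤ n ^ 2 * (linVar ν f 0 + linVar ν f 1) :=
    mul_le_mul (h2.trans h4) h1 h0 (sq_nonneg _)
  have h6 : (n : ℝ) * (n - 1) / 2 * V ≤ n ^ 2 * V :=
    mul_le_mul_of_nonneg_right (by nlinarith [(Nat.cast_nonneg n : (0 : ℝ) ≤ n)]) hV0
  have h7 : (-((n / 2 : ℕ) : ℝ) * kernelMean ν f) ^ 2 ≤ n ^ 2 * kernelMean ν f ^ 2 := by
    rw [mul_pow, neg_sq]
    gcongr
  linarith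

lemma tendstoInMeasure_inv_choose_mul_biAltU (hXm : ∀ i, Measurable (X i)) (hXi : iIndepFun X P)
    (hXν : ∀ i, P.map (X i) = ν) (hf : Measurable (Function.uncurry f))
    (hf2 : MemLp (Function.uncurry f) 2 (ν.prod ν)) :
    TendstoInMeasure P (fun n ω => ((n.choose 2 : ℕ) : ℝ)⁻¹ * biAltU X f n ω) atTop
      (fun _ => 0) := by
  refine tendstoInMeasure_zero_of_integral_sq
    (fun n => (memLp_biAltU hXm hXi hXν hf2 n).const_mul _) ?_
  obtain ⟨K, hK⟩ : ∃ K, ∀ n : ℕ, ∫ ω, biAltU X f n ω ^ 2 ∂P ≤ K * (n : ℝ) ^ 2 :=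
    ⟨_, integral_sq_biAltU_le hXm hXi hXν hf hf2⟩
  have hlim : Tendsto (fun n : ℕ => 16 * K * ((n : ℝ)⁻¹ ^ 2)) atTop (𝓝 0) := by
    simpa using ((tendsto_inv_atTop_nhds_zero_nat (𝕜 := ℝ)).pow 2).const_mul (16 * K)
  refine squeeze_zero' (Eventually.of_forall fun n => integral_nonneg fun ω => sq_nonneg _) ?_ hlim
  filter_upwards [eventually_ge_atTop 2] with n hn
  have hn' : (2 : ℝ) ≤ n := by exact_mod_cast hn
  have hpos : (0 : ℝ) < (n : ℝ) ^ 2 / 4 := by positivity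
  -- For `n ≥ 2` the binomial coefficient is at least `n² / 4`; its square, of order `n⁴`, beats the
  -- second moment `O(n²)`.
  have hc : ((n.choose 2 : ℕ) : ℝ)⁻¹ ≤ ((n : ℝ) ^ 2 / 4)⁻¹ := by
    refine inv_anti₀ hpos ?_
    rw [Nat.cast_choose_two]
    nlinarith
  simp only [mul_pow]
  rw [integral_const_mul]
  calc ((n.choose 2 : ℕ) : ℝ)⁻¹ ^ 2 * ∫ ω, biAltU X f n ω ^ 2 ∂P
      ≤ ((n : ℝ) ^ 2 / 4)⁻¹ ^ 2 * (K * (n : ℝ) ^ 2) := by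
        refine mul_le_mul ?_ (hK n) (integral_nonneg fun ω => sq_nonneg _) (sq_nonneg _)
        gcongr
    _ = 16 * K * ((n : ℝ)⁻¹ ^ 2) := by
        field_simp
        ring

/-! ### The case of a vanishing second order component -/

lemma linPart_parity (m : ℕ) {b : ℕ} (hb : b < 2) (ω : Ω) :
    linPart ν X f (2 * m + b) ω = ∑ k ∈ Finset.range m,
      (linEven b (hoeffding1 ν f) (X (2 * k) ω) +
        linOdd b (hoeffding1 ν f) (hoeffding2 ν f) (X (2 * k + 1) ω)) := by
  have h : (2 * m + b) / 2 = m := by omega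
  have he : Even (2 * m + b) ↔ Even b := by simp [Nat.even_add]
  simp only [linPart, linEven, linOdd, h, he]

lemma linVar_parity (m b : ℕ) : linVar ν f (2 * m + b) = linVar ν f b := by
  have he : Even (2 * m + b) ↔ Even b := by simp [Nat.even_add]
  unfold linVar linEven linOdd
  simp only [he]

/-- Converts the normalization by the number of blocks into the one by the number of variables. -/
lemma tendsto_sqrt_two_mul_sqrt_div (b : ℕ) :
    Tendsto (fun m : ℕ => √2 * √(m : ℝ) / √((2 * m + b : ℕ) : ℝ)) atTop (𝓝 1) := by
  have h1 : Tendsto (fun m : ℕ => 2 * (m : ℝ) / ((2 * m + b : ℕ) : ℝ)) atTop (𝓝 1) := by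
    have h2 : Tendsto (fun m : ℕ => 2 / (2 + (b : ℝ) * (m : ℝ)⁻¹)) atTop (𝓝 1) := by
      have := ((tendsto_inv_atTop_nhds_zero_nat (𝕜 := ℝ)).const_mul (b : ℝ)).const_add 2
      have h3 := (tendsto_const_nhds (x := (2 : ℝ))).div this (by norm_num)
      rw [mul_zero, add_zero, div_self two_ne_zero] at h3
      exact h3
    refine h2.congr' ?_
    filter_upwards [eventually_ge_atTop 1] with m hm
    have : (m : ℝ) ≠ 0 := by exact_mod_cast (by omega : m ≠ 0)
    push_cast
    field_simp
  have h := h1.sqrt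
  rw [Real.sqrt_one] at h
  refine h.congr fun m => ?_
  rw [Real.sqrt_div (by positivity), Real.sqrt_mul (by norm_num)]

lemma tendstoInDistribution_linPart (hXm : ∀ i, Measurable (X i)) (hXi : iIndepFun X P)
    (hXν : ∀ i, P.map (X i) = ν) (hf : Measurable (Function.uncurry f))
    (hf2 : MemLp (Function.uncurry f) 2 (ν.prod ν)) {b : ℕ} (hb : b < 2) :
    TendstoInDistribution
      (fun (m : ℕ) ω => (√((2 * m + b : ℕ) : ℝ))⁻¹ * -linPart ν X f (2 * m + b) ω) atTop id
      (fun _ => P) (gaussianReal 0 (1 / 2 * linVar ν f b).toNNReal) := by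
  let h : S × S → ℝ := fun z => linEven b (hoeffding1 ν f) z.1 +
    linOdd b (hoeffding1 ν f) (hoeffding2 ν f) z.2
  have hh : Measurable h :=
    ((measurable_linEven b (measurable_hoeffding1 ν hf)).comp measurable_fst).add
      ((measurable_linOdd b (measurable_hoeffding1 ν hf) (measurable_hoeffding2 ν hf)).comp
        measurable_snd)
  -- There are `m` blocks for about `2 * m` variables, which explains `√2`; the sign is that of the
  -- linear part in the decomposition.
  let a : ℝ := -(√2)⁻¹
  have ha2 : a ^ 2 = 1 / 2 := by
    simp only [a, neg_sq, inv_pow]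
    rw [Real.sq_sqrt (by norm_num)]
    norm_num
  let Z : ℕ → Ω → ℝ := fun k ω => a * h (X (2 * k) ω, X (2 * k + 1) ω)
  have hZ2 : MemLp (Z 0) 2 P := (memLp_linPart_term hXm hXν hf hf2 b 0).const_mul a
  have hZ0 : P[Z 0] = 0 := by
    have := integral_linPart_term hXm hXν hf hf2 b 0
    change ∫ ω, a * h (X (2 * 0) ω, X (2 * 0 + 1) ω) ∂P = 0
    rw [integral_const_mul]
    exact mul_eq_zero_of_right _ this
  have hZv : Var[Z 0; P] = 1 / 2 * linVar ν f b := by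
    rw [← variance_linPart_term hXm hXi hXν hf hf2 b 0, ← ha2, ← variance_const_mul]
  have hpair : ∀ k, MeasurePreserving (fun ω => (X (2 * k) ω, X (2 * k + 1) ω)) P (ν.prod ν) :=
    fun k => map_pair_of_iIndepFun hXm hXi hXν (by omega)
  have hid : ∀ k, IdentDistrib (Z k) (Z 0) P P := fun k => by
    have hg : Measurable fun z => a * h z := hh.const_mul a
    refine ⟨(hg.comp (hpair k).measurable).aemeasurable,
      (hg.comp (hpair 0).measurable).aemeasurable, ?_⟩
    change P.map ((fun z => a * h z) ∘ _) = P.map ((fun z => a * h z) ∘ _)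
    rw [← Measure.map_map hg (hpair k).measurable, ← Measure.map_map hg (hpair 0).measurable,
      (hpair k).map_eq, (hpair 0).map_eq]
  have hind : iIndepFun Z P := (iIndepFun_linPart_term (ν := ν) hXm hXi hf b).comp
    (fun _ x => a * x) fun _ => by fun_prop
  have hlaw : HasLaw (id : ℝ → ℝ) (gaussianReal 0 Var[Z 0; P].toNNReal)
      (gaussianReal 0 (1 / 2 * linVar ν f b).toNNReal) := by
    rw [hZv]
    exact HasLaw.id
  have hclt := (tendstoInDistribution_inv_sqrt_mul_sum_sub hlaw hZ2 hind hid).mul_of_tendsto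
    (tendsto_sqrt_two_mul_sqrt_div b)
  have e1 : (fun ω : ℝ => 1 * id ω) = id := by ext; simp
  rw [e1] at hclt
  refine hclt.congr (fun m => ae_of_all _ fun ω => ?_) ae_eq_rfl
  simp only [hZ0, mul_zero, sub_zero]
  rw [linPart_parity m hb]
  simp only [Z]
  rw [← Finset.mul_sum]
  rcases Nat.eq_zero_or_pos m with rfl | hm
  · simp
  · have h1 : √(m : ℝ) ≠ 0 := by positivity
    have h2 : √(2 : ℝ) ≠ 0 := by positivity
    simp only [a, h]
    field_simp

/-- The centred statistic and minus its linear part differ by the degenerate part, whose second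
moment is zero. -/
lemma tendstoInDistribution_biAltU_of_hoeffding12_eq_zero (hXm : ∀ i, Measurable (X i))
    (hXi : iIndepFun X P) (hXν : ∀ i, P.map (X i) = ν) (hf : Measurable (Function.uncurry f))
    (hf2 : MemLp (Function.uncurry f) 2 (ν.prod ν))
    (hV : Var[fun ω => hoeffding12 ν f (X 0 ω) (X 1 ω); P] = 0) {b : ℕ} (hb : b < 2) :
    TendstoInDistribution
      (fun (m : ℕ) ω => (√((2 * m + b : ℕ) : ℝ))⁻¹ *
        (biAltU X f (2 * m + b) ω - ∫ ω, biAltU X f (2 * m + b) ω ∂P)) atTop id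
      (fun _ => P) (gaussianReal 0 (1 / 2 * linVar ν f b).toNNReal) := by
  refine (tendstoInDistribution_linPart hXm hXi hXν hf hf2 hb).of_integral_sq_sub
    (fun m => (memLp_linPart hXm hXν hf hf2 _).neg.const_mul _)
    (fun m => ((memLp_biAltU hXm hXi hXν hf2 _).sub (memLp_const _)).const_mul _) ?_
  have e : ∀ m : ℕ, ∫ ω, ((√((2 * m + b : ℕ) : ℝ))⁻¹ *
      (biAltU X f (2 * m + b) ω - ∫ ω, biAltU X f (2 * m + b) ω ∂P) -
      (√((2 * m + b : ℕ) : ℝ))⁻¹ * -linPart ν X f (2 * m + b) ω) ^ 2 ∂P = 0 := fun m => by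
    have e2 : ∀ ω, ((√((2 * m + b : ℕ) : ℝ))⁻¹ *
      (biAltU X f (2 * m + b) ω - ∫ ω, biAltU X f (2 * m + b) ω ∂P) -
      (√((2 * m + b : ℕ) : ℝ))⁻¹ * -linPart ν X f (2 * m + b) ω) ^ 2 =
        (√((2 * m + b : ℕ) : ℝ))⁻¹ ^ 2 * biAltU X (hoeffding12 ν f) (2 * m + b) ω ^ 2 :=
      fun ω => by
        rw [biAltU_sub_integral hXm hXi hXν hf hf2]
        ring
    simp only [e2]
    rw [integral_const_mul, integral_sq_biAltU_hoeffding12 hXm hXi hXν hf hf2, hV, mul_zero,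
      mul_zero]
  simp only [e]
  exact tendsto_const_nhds

/-- The `m` blocks fall short of `(2 * m + b) / 2` by `b / 2`, so the error does not depend on `m`.
-/
lemma variance_biAltU_sub_of_hoeffding12_eq_zero (hXm : ∀ i, Measurable (X i))
    (hXi : iIndepFun X P) (hXν : ∀ i, P.map (X i) = ν) (hf : Measurable (Function.uncurry f))
    (hf2 : MemLp (Function.uncurry f) 2 (ν.prod ν))
    (hV : Var[fun ω => hoeffding12 ν f (X 0 ω) (X 1 ω); P] = 0) {b : ℕ} (hb : b < 2) (m : ℕ) :
    Var[biAltU X f (2 * m + b); P] - (2 * m + b : ℕ) * (1 / 2 * linVar ν f b) =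
      -(b * (1 / 2 * linVar ν f b)) := by
  have h : (2 * m + b) / 2 = m := by omega
  rw [variance_biAltU hXm hXi hXν hf hf2, hV, h, linVar_parity]
  push_cast
  ring

end BiAltMoments

/-! ### The asymptotic theorem for bi-alternating U-statistics. -/

theorem theorem5p1 {Ω S : Type*} [MeasurableSpace Ω] [MeasurableSpace S]
    (P : Measure Ω) [IsProbabilityMeasure P] (ν : Measure S) [IsProbabilityMeasure ν]
    (X : ℕ → Ω → S) (hXm : ∀ i, Measurable (X i)) (hXi : iIndepFun X P)
    (hXν : ∀ i, P.map (X i) = ν)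
    (f : S → S → ℝ) (hf : Measurable (Function.uncurry f))
    (hf2 : MemLp (Function.uncurry f) 2 (ν.prod ν)) :
    -- Notation: `U n`, its mean, `Var f₁₂(X₁, X₂)`; the operators with kernels `\hat f₁₂` on
    -- real `L²(S × [0,1])` and `f₁₂` on real and complex `L²(S)`.
    let U : ℕ → Ω → ℝ := biAltU X f
    let EU : ℕ → ℝ := fun n => ∫ ω, U n ω ∂P
    let V12 : ℝ := Var[fun ω => hoeffding12 ν f (X 0 ω) (X 1 ω); P]
    let h12 := memLp_hoeffding12 ν hf hf2
    let That := integralOperator (ν.prod (volume : Measure unitInterval))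
      (hatKernel (hoeffding12 ν f)) (memLp_hatKernel ν (measurable_hoeffding12 ν hf) h12)
    let TR := integralOperator ν (hoeffding12 ν f) h12
    let TC := integralOperator ν (fun x y => (hoeffding12 ν f x y : ℂ)) h12.ofReal
    -- Mean and weak law of large numbers.
    ((∀ n, MemLp (U n) 2 P) ∧
      (∀ n, EU n = -((n / 2 : ℕ) : ℝ) * kernelMean ν f) ∧
      (EU =O[atTop] fun n => (n : ℝ)) ∧
      TendstoInMeasure P (fun n ω => ((n.choose 2 : ℕ) : ℝ)⁻¹ * U n ω) atTop (fun _ => 0)) ∧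
    -- Variance and limit distribution.
    (((fun n => Var[U n; P] - 1 / 2 * (n : ℝ) ^ 2 * V12) =O[atTop] fun n => (n : ℝ)) ∧
      IsSelfAdjoint That ∧
      (∃ (R : ℕ∞) (c : SeqIndex R → ℝ), ListsNonzeroEigenvalues That c) ∧
      ∀ (R : ℕ∞) (c : SeqIndex R → ℝ), ListsNonzeroEigenvalues That c →
        HasSum (fun r => c r ^ 2) V12 ∧
        ∀ (Ω' : Type*) [MeasurableSpace Ω'] (P' : Measure Ω') [IsProbabilityMeasure P']
          (ζ : SeqIndex R → Ω' → ℝ), (∀ r, Measurable (ζ r)) → iIndepFun ζ P' →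
          (∀ r, P'.map (ζ r) = gaussianReal 0 1) →
          ∃ W : Ω' → ℝ, IsL2Sum P' (fun r ω => 1 / 2 * c r * (ζ r ω ^ 2 - 1)) W ∧
            TendstoInDistribution (fun (n : ℕ) ω => (n : ℝ)⁻¹ * (U n ω - EU n)) atTop W
              (fun _ => P) P' ∧
            Var[W; P'] = 1 / 2 * ∑' r, c r ^ 2 ∧ Var[W; P'] = 1 / 2 * V12) ∧
    -- Symmetric `f`: the coefficients are the nonzero eigenvalues of `T_{f₁₂}`.
    ((∀ᵐ p ∂(ν.prod ν), f p.1 p.2 = f p.2 p.1) →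
      IsSelfAdjoint TR ∧
      ∀ (R : ℕ∞) (c : SeqIndex R → ℝ),
        ListsNonzeroEigenvalues That c ↔ ListsNonzeroEigenvalues TR c) ∧
    -- Antisymmetric `f`: the limit is a sum of independent stochastic areas.
    ((∀ᵐ p ∂(ν.prod ν), f p.1 p.2 = -f p.2 p.1) →
      ContinuousLinearMap.adjoint TC = -TC ∧
      (∃ ρ : Measure ℝ, IsStochasticAreaLaw ρ) ∧
      (∃ (Q : ℕ∞) (c : SeqIndex Q → ℝ), ListsPositiveImaginaryEigenvalues TC c) ∧
      ∀ (Q : ℕ∞) (c : SeqIndex Q → ℝ), ListsPositiveImaginaryEigenvalues TC c →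
        HasSum (fun q => c q ^ 2) (1 / 2 * V12) ∧
        ∀ (Ω' : Type*) [MeasurableSpace Ω'] (P' : Measure Ω') [IsProbabilityMeasure P']
          (η : SeqIndex Q → Ω' → ℝ), (∀ q, Measurable (η q)) → iIndepFun η P' →
          (∀ q, IsStochasticAreaLaw (P'.map (η q))) →
          ∃ W : Ω' → ℝ, IsL2Sum P' (fun q ω => c q * η q ω) W ∧
            TendstoInDistribution (fun (n : ℕ) ω => (n : ℝ)⁻¹ * U n ω) atTop W (fun _ => P) P' ∧
            Var[W; P'] = ∑' q, c q ^ 2 ∧ Var[W; P'] = 1 / 2 * V12) ∧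
    -- The case `f₁₂ = 0`.
    ((∀ᵐ p ∂(ν.prod ν), hoeffding12 ν f p.1 p.2 = 0) →
      let σe2 : ℝ := 1 / 2 * (Var[hoeffding1 ν f; ν] + Var[hoeffding2 ν f; ν])
      let σo2 : ℝ := 1 / 2 * Var[fun x => hoeffding1 ν f x + hoeffding2 ν f x; ν]
      ((fun n : ℕ => Var[U (2 * n); P] - (2 * n : ℕ) * σe2) =O[atTop] fun _ => (1 : ℝ)) ∧
      ((fun n : ℕ => Var[U (2 * n + 1); P] - (2 * n + 1 : ℕ) * σo2) =O[atTop]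
        fun _ => (1 : ℝ)) ∧
      TendstoInDistribution
        (fun (n : ℕ) ω => (√((2 * n : ℕ) : ℝ))⁻¹ * (U (2 * n) ω - EU (2 * n))) atTop id
        (fun _ => P) (gaussianReal 0 σe2.toNNReal) ∧
      TendstoInDistribution
        (fun (n : ℕ) ω => (√((2 * n + 1 : ℕ) : ℝ))⁻¹ * (U (2 * n + 1) ω - EU (2 * n + 1)))
        atTop id (fun _ => P) (gaussianReal 0 σo2.toNNReal)) := by
  intro U EU V12 h12 That TR TC
  have hm12 := measurable_hoeffding12 ν hf
  have hhat := memLp_hatKernel ν hm12 h12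
  have hV12 : V12 = ∫ p : S × S, hoeffding12 ν f p.1 p.2 ^ 2 ∂(ν.prod ν) :=
    variance_hoeffding12 hXm hXi hXν hf hf2
  have hsym : ∀ᵐ p ∂((ν.prod (volume : Measure unitInterval)).prod
      (ν.prod (volume : Measure unitInterval))),
      hatKernel (hoeffding12 ν f) p.1 p.2 = hatKernel (hoeffding12 ν f) p.2 p.1 :=
    ae_of_all _ fun p => hatKernel_comm _ _
  refine ⟨⟨memLp_biAltU hXm hXi hXν hf2, integral_biAltU hXm hXi hXν hf hf2,
    isBigO_integral_biAltU hXm hXi hXν hf hf2,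
    tendstoInMeasure_inv_choose_mul_biAltU hXm hXi hXν hf hf2⟩,
    ⟨isBigO_variance_biAltU_sub hXm hXi hXν hf hf2, isSelfAdjoint_integralOperator hhat hsym,
      exists_listsNonzeroEigenvalues_integralOperator hhat hsym, fun R c hc => ?_⟩,
    fun hs => ?_, fun ha => ?_, fun h0 => ?_⟩
  · obtain ⟨e, he1, he2, he3⟩ := hc.exists_orthonormal_integralOperator hhat hsym
    rw [integral_sq_hatKernel hm12 h12, ← hV12] at he3
    refine ⟨he3, fun Ω' _ P' _ ζ hζ hind hl => ?_⟩
    obtain ⟨W, hW, -, hWv, hWc⟩ := exists_isL2Sum_chaos hζ hind hl he3.summable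
    exact ⟨W, hW, tendstoInDistribution_biAltU hXm hXi hXν hf hf2 hhat he1 hc.1 he2 he3
      hW.1.aemeasurable hWc, hWv, by rw [hWv, he3.tsum_eq]⟩
  · have hs' := hoeffding12_swap_of_symmetric hs
    exact ⟨isSelfAdjoint_integralOperator h12 hs', fun R c =>
      listsNonzeroEigenvalues_hatKernel_iff hm12 h12 hhat hs' c⟩
  · obtain ⟨hμ, ha'⟩ := hoeffding12_swap_of_antisymmetric ha
    obtain ⟨ρ, hρ, -⟩ := exists_isStochasticAreaLaw
    refine ⟨adjoint_integralOperator_of_antisymm h12.ofReal ha', ⟨ρ, hρ⟩,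
      exists_listsPositiveImaginaryEigenvalues h12.ofReal ha', fun Q c hc => ?_⟩
    obtain ⟨e, he1, he2, he3, he4⟩ :=
      exists_orthonormal_hatKernel_of_antisymmetric hhat h12.ofReal ha' hc
    rw [← hV12] at he3 he4
    refine ⟨he4, fun Ω' _ P' _ η hη hind hl => ?_⟩
    obtain ⟨W, hW, hWv, hWc⟩ := exists_isL2Sum_stochasticArea hη hind hl he4.summable
    -- The eigenvalues of `That` enter only through the explicit family built from `c`; regrouping
    -- their product of characteristic functions identifies the limit as the sum of stochastic
    -- areas.
    have hlim := tendstoInDistribution_biAltU hXm hXi hXν hf hf2 hhat he1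
      (fun p => mul_ne_zero (hc.1 p.1).ne' (div_ne_zero two_ne_zero (oddFreq_ne_zero _))) he2 he3
      hW.1.aemeasurable fun t => hasProd_chaosChar_of_stochasticArea he3.summable (hWc t)
    have hEU : ∀ n, ∫ ω, biAltU X f n ω ∂P = 0 := fun n => by
      rw [integral_biAltU hXm hXi hXν hf hf2, hμ, mul_zero]
    simp only [hEU, sub_zero] at hlim
    exact ⟨W, hW, hlim, hWv, by rw [hWv, he4.tsum_eq]⟩
  · intro σe2 σo2
    have hV0 : V12 = 0 := by
      rw [hV12]
      refine integral_eq_zero_of_ae ?_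
      filter_upwards [h0] with p hp
      rw [hp]
      simp
    have he : 1 / 2 * linVar ν f 0 = σe2 :=
      congrArg (1 / 2 * ·) (linVar_even (ν := ν) (f := f) 0)
    have ho : 1 / 2 * linVar ν f 1 = σo2 :=
      congrArg (1 / 2 * ·) (linVar_odd (ν := ν) (f := f) 0)
    have hve := variance_biAltU_sub_of_hoeffding12_eq_zero hXm hXi hXν hf hf2 hV0 zero_lt_two
    have hvo := variance_biAltU_sub_of_hoeffding12_eq_zero hXm hXi hXν hf hf2 hV0 one_lt_two
    have hde := tendstoInDistribution_biAltU_of_hoeffding12_eq_zero hXm hXi hXν hf hf2 hV0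
      zero_lt_two
    have hdo := tendstoInDistribution_biAltU_of_hoeffding12_eq_zero hXm hXi hXν hf hf2 hV0
      one_lt_two
    rw [he] at hve hde
    rw [ho] at hvo hdo
    refine ⟨(isBigO_const_const (-(((0 : ℕ) : ℝ) * σe2)) one_ne_zero atTop).congr_left fun m =>
      (hve m).symm, (isBigO_const_const (-(((1 : ℕ) : ℝ) * σo2)) one_ne_zero atTop).congr_left
        fun m => (hvo m).symm, hde, hdo⟩
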